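/- Let $Q\in L^1_{\mathrm{loc}}(]0,\infty[;\mathbb{C})$ satisfy $\int_1^\infty|Q(x)|\,\mathrm{d}x<\infty$, and let $k\in\mathbb{C}$ with $\operatorname{Re}k\ge 0$, $k\neq 0$. For $m\in\mathbb{C}$ set $$L_{m^2}:=-\partial_x^2+\Big(m^2-\frac14\Big)\frac1{x^2}+Q(x),\qquad L^0_{m^2}:=-\partial_x^2+\Big(m^2-\frac14\Big)\frac1{x^2},\qquad w_m^0(x,k):=\sqrt{\tfrac{2kx}{\pi}}\,K_m(kx),$$ where $K_m$ is the Macdonald function, i.e. $\sqrt{\tfrac{2z}{\pi}}K_m(z)=\tfrac{\sqrt z}{\sqrt{2\pi}}\int_0^\infty \mathrm{e}^{-\frac z2(s+s^{-1})}s^{-m-1}\,\mathrm{d}s$ for $\operatorname{Re}z>0$, extended by continuity to the imaginary axis without $0$. Let $AC^1]0,\infty[$ be the set of differentiable functions $]0,\infty[\,\to\mathbb{C}$ whose derivative is locally absolutely continuous. Let $G^0_\leftarrow$ be the backward Green's operator of $L^0_{m^2}+k^2$, with integral kernel $$G^0_\leftarrow(x,y)=-\theta(y-x)\,\frac{h_1(x)h_2(y)-h_2(x)h_1(y)}{h_1h_2'-h_1'h_2},$$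 where $\theta$ is the Heaviside function and $h_1,h_2$ is any pair of solutions of $L^0_{m^2}h=-k^2h$ on $]0,\infty[$ with nonzero (constant) Wronskian $h_1h_2'-h_1'h_2$; the kernel does not depend on the choice of the pair. For $a>0$ let $X_a$ be the Banach space of (classes of) measurable functions $f$ on $]a,\infty[$ with $\operatorname{ess\,sup}_{x>a}|f(x)|\mathrm{e}^{x\operatorname{Re}k}<\infty$. Then for every $m\in\mathbb{C}$ there is a unique $w_m(\cdot,k)\in AC^1]0,\infty[$ that solves $L_{m^2}w=-k^2w$ (almost everywhere) on $]0,\infty[$ and satisfies $$w_m(x,k)-w_m^0(x,k)=o(\mathrm{e}^{-x\operatorname{Re}k}),\qquad \partial_xw_m(x,k)-\partial_xw_m^0(x,k)=o(\mathrm{e}^{-x\operatorname{Re}k}),\qquad x\to\infty.$$ It is given by $w_m(\cdot,k)=(1+G^0_\leftarrow Q)^{-1}w_m^0(\cdot,k)$, in the following sense: for every $a>0$ the operator $G^0_\leftarrow Q$ is bounded on $X_a$ (with absolutely convergent integrals), $1+G^0_\leftarrow Q$ is invertible on $X_a$ with bounded inverse, the restrictions of $w_m^0(\cdot,k)$ and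 $w_m(\cdot,k)$ to $]a,\infty[$ belong to $X_a$, and $w_m(x,k)+(G^0_\leftarrow Q\,w_m)(x,k)=w_m^0(x,k)$ for all $x>a$. Moreover $w_m(x,k)=w_{-m}(x,k)$ for all $m\in\mathbb{C}$ and $x>0$. -/

import Mathlib

open MeasureTheory Set Filter Asymptotics
open scoped ENNReal NNReal

noncomputable section

namespace PerturbedBessel

/-- The integral formula of the 1d Macdonald function; it converges for `Re z > 0`:
`√z / √(2π) * ∫₀^∞ exp (-(z/2) (s + s⁻¹)) s^(-m-1) ds = √(2z/π) K_m(z)`. -/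
def macdonaldIntegral (m z : ℂ) : ℂ :=
  z ^ (1 / 2 : ℂ) / (Real.sqrt (2 * Real.pi) : ℂ) *
    ∫ s in Ioi (0 : ℝ), Complex.exp (-(z / 2) * ((s : ℂ) + (s : ℂ)⁻¹)) * (s : ℂ) ^ (-m - 1)

/-- The 1d Macdonald function `𝒦_m(z) = √(2z/π) K_m(z)` for `Re z ≥ 0`, `z ≠ 0`: the integral
formula for `Re z > 0`, and its continuous extension (which is the restriction of the analytic
continuation to the plane cut along `]-∞, 0]`) on the imaginary axis. -/
def macdonald (m : ℂ) : ℂ → ℂ :=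
  extendFrom {z : ℂ | 0 < z.re} (macdonaldIntegral m)

/-- The unperturbed Jost solution `w_m^0(x, k) = 𝒦_m(k x)`. -/
def freeJost (m k : ℂ) (x : ℝ) : ℂ :=
  macdonald m (k * x)

/-- `f ∈ AC¹]0,∞[`: `f` is differentiable on `]0,∞[` and its derivative is absolutely continuous
on all compact subintervals of `]0,∞[`. Values at `x ≤ 0` are irrelevant. -/
def IsAC1 (f : ℝ → ℂ) : Prop :=
  DifferentiableOn ℝ f (Ioi 0) ∧
    ∀ a b : ℝ, 0 < a → a ≤ b → AbsolutelyContinuousOnInterval (deriv f) a b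

/-- The perturbed Bessel operator `L_{m²} = -∂ₓ² + (m² - 1/4) / x² + Q(x)`. -/
def besselOp (Q : ℝ → ℂ) (m : ℂ) (f : ℝ → ℂ) (x : ℝ) : ℂ :=
  -deriv (deriv f) x + ((m ^ 2 - 1 / 4) / (x : ℂ) ^ 2 + Q x) * f x

/-- `f ∈ AC¹]0,∞[` solves `L_{m²} f = -k² f` on `]0,∞[`. -/
def IsSolution (Q : ℝ → ℂ) (m k : ℂ) (f : ℝ → ℂ) : Prop :=
  IsAC1 f ∧ ∀ᵐ x ∂(volume.restrict (Ioi (0 : ℝ))), besselOp Q m f x = -k ^ 2 * f x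

def wronskian (f g : ℝ → ℂ) (x : ℝ) : ℂ :=
  f x * deriv g x - deriv f x * g x

/-- Two solutions of the unperturbed equation with nonzero Wronskian. The Wronskian of two
solutions is constant on `]0,∞[`, so that it may be evaluated at `x = 1`. -/
def IsFundamentalPair (m k : ℂ) (h : (ℝ → ℂ) × (ℝ → ℂ)) : Prop :=
  IsSolution 0 m k h.1 ∧ IsSolution 0 m k h.2 ∧ wronskian h.1 h.2 1 ≠ 0

/-- Some fundamental pair of the unperturbed equation (one always exists). -/
def fundamentalPair (m k : ℂ) : (ℝ → ℂ) × (ℝ → ℂ) :=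
  Classical.epsilon (IsFundamentalPair m k)

/-- The integral kernel of the canonical bisolution,
`(h₁(x) h₂(y) - h₂(x) h₁(y)) / 𝒲(h₁, h₂)`. For `x, y > 0` it does not depend on the choice of the
fundamental pair. -/
def canonicalBisolution (m k : ℂ) (x y : ℝ) : ℂ :=
  ((fundamentalPair m k).1 x * (fundamentalPair m k).2 y -
      (fundamentalPair m k).2 x * (fundamentalPair m k).1 y) /
    wronskian (fundamentalPair m k).1 (fundamentalPair m k).2 1

/-- The kernel of the backward Green's operator, `-θ(y - x) G_↔(x, y)`. -/
def backwardGreen (m k : ℂ) (x y : ℝ) : ℂ :=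
  if x ≤ y then -canonicalBisolution m k x y else 0

/-- The kernel of the composition of the backward Green's operator with the multiplication
by `Q`. -/
def backwardGreenMul (Q : ℝ → ℂ) (m k : ℂ) (x y : ℝ) : ℂ :=
  backwardGreen m k x y * Q y

/-- The operator with integral kernel `K`, acting on functions on `]a,∞[`. -/
def kernelOp (a : ℝ) (K : ℝ → ℝ → ℂ) (f : ℝ → ℂ) (x : ℝ) : ℂ :=
  ∫ y in Ioi a, K x y * f y

/-- The weight `x ↦ exp (-x Re k)`. -/
def expWeight (k : ℂ) (x : ℝ) : ℝ :=
  Real.exp (-x * k.re)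

/-- The norm of the weighted space `L^∞(]a,∞[, φ)`, the essential supremum of `|f / φ|`. -/
def weightedNorm (a : ℝ) (φ : ℝ → ℝ) (f : ℝ → ℂ) : ℝ≥0∞ :=
  eLpNorm (fun x => f x / (φ x : ℂ)) ∞ (volume.restrict (Ioi a))

/-- `f ∈ L^∞(]a,∞[, φ)`. -/
def MemWeighted (a : ℝ) (φ : ℝ → ℝ) (f : ℝ → ℂ) : Prop :=
  MemLp (fun x => f x / (φ x : ℂ)) ∞ (volume.restrict (Ioi a))

/-- `K` is the kernel of a bounded operator on `L^∞(]a,∞[, φ)` (with absolutely convergent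
integrals), and `1 + K` is invertible there, with bounded inverse. -/
structure OneAddInvertible (a : ℝ) (φ : ℝ → ℝ) (K : ℝ → ℝ → ℂ) : Prop where
  integrable : ∀ f, MemWeighted a φ f → ∀ x, a < x → IntegrableOn (fun y => K x y * f y) (Ioi a)
  bounded : ∃ C : ℝ≥0, ∀ f, MemWeighted a φ f →
    MemWeighted a φ (kernelOp a K f) ∧
      weightedNorm a φ (kernelOp a K f) ≤ C * weightedNorm a φ f
  injective : ∀ g₁ g₂, MemWeighted a φ g₁ → MemWeighted a φ g₂ →
    (∀ᵐ x ∂(volume.restrict (Ioi a)), g₁ x + kernelOp a K g₁ x = g₂ x + kernelOp a K g₂ x) →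
    g₁ =ᵐ[volume.restrict (Ioi a)] g₂
  surjective : ∃ C : ℝ≥0, ∀ f, MemWeighted a φ f → ∃ g, MemWeighted a φ g ∧
    weightedNorm a φ g ≤ C * weightedNorm a φ f ∧
    ∀ᵐ x ∂(volume.restrict (Ioi a)), g x + kernelOp a K g x = f x

/-- `g = (1 + K)⁻¹ f` on `]a,∞[`: both functions belong to `L^∞(]a,∞[, φ)`, the operator
`1 + K` is invertible on that space, and `(1 + K) g = f` on `]a,∞[`. -/
def IsInverseImage (a : ℝ) (φ : ℝ → ℝ) (K : ℝ → ℝ → ℂ) (f g : ℝ → ℂ) : Prop :=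
  OneAddInvertible a φ K ∧ MemWeighted a φ f ∧ MemWeighted a φ g ∧
    ∀ x, a < x → g x + kernelOp a K g x = f x

/-- `w ∈ AC¹]0,∞[` solves the perturbed equation and is asymptotic to the unperturbed Jost
solution at infinity, together with its derivative, up to `o(exp (-x Re k))`. -/
structure IsJostSolution (Q : ℝ → ℂ) (m k : ℂ) (w : ℝ → ℂ) : Prop where
  isSolution : IsSolution Q m k w
  sub_isLittleO : (fun x => w x - freeJost m k x) =o[atTop] expWeight k
  deriv_sub_isLittleO :
    (fun x => deriv w x - deriv (freeJost m k) x) =o[atTop] expWeight k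

end PerturbedBessel

end

noncomputable section

open scoped Topology

namespace PerturbedBessel

/-! ### Absolutely continuous functions -/

/-! Variation of parameters turns the Jost problem into the Volterra equation `w + G Q w = w⁰` on
`]a,∞[`, and everything rests on the kernel bound `‖G(x, y)‖ ≤ C exp ((y - x) Re k)` for `a ≤ x ≤
y`. An energy estimate (`IsClassical.energy_le`) bounds the growth of free solutions, and `G(x, ·)`
is, up to sign, the free solution with data `0, 1` at `x` (`exists_bisolution_bound`).

In the weight `exp (-x Re k)` alone, `G Q` is bounded but need not be a contraction. In the weight
`exp (-x Re k) exp (l ∫ₓ^∞ |Q|)` its norm is at most `C / l`, so for large `l` a Neumann series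
inverts `1 + G Q` (`oneAddInvertible_of_schur`). Since `∫ₐ^∞ |Q|` is finite, the two weights are
equivalent (`oneAddInvertible_backwardGreenMul`). The same Schur test, with a weight on all of
`]0,∞[`, solves the free initial value problem and supplies the fundamental pair.

That `w⁰` lies in the weighted space and solves the free equation has to be shown up to the
imaginary axis, where the defining integral need not converge. A Gaussian integral gives a
holomorphic continuation `macdonaldExt` to the sector `|arg z| < 3π/4`, bounded by `C exp (-Re z)`
away from `0`; the identity theorem identifies it with the Macdonald function and carries over the
differential equation.

Solutions on different half-lines agree by injectivity and glue to one function on `]0,∞[`. Writing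
the integral through two tail integrals shows that it is `AC¹`, solves the perturbed equation, and
differs from `w⁰`, with its derivative, by at most a constant times `exp (-x Re k) ∫ₓ^∞ |Q|`
(`isJostSolution_of_solvesIntegralEq`). Conversely, the Wronskians of the difference of two Jost
solutions with free solutions vanish at infinity, so this difference solves the homogeneous integral
equation and is zero (`IsJostSolution.eqOn`). Symmetry in `m` follows from uniqueness, as the
equation depends on `m²` and `w⁰` is even in `m`. -/

lemma _root_.LipschitzOnWith.comp_absolutelyContinuousOnInterval {X Y : Type*}
    [PseudoMetricSpace X] [PseudoMetricSpace Y] {f : ℝ → X} {g : X → Y} {s : Set X} {K : ℝ≥0}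
    {a b : ℝ} (hg : LipschitzOnWith K g s) (hf : AbsolutelyContinuousOnInterval f a b)
    (hs : MapsTo f (uIcc a b) s) :
    AbsolutelyContinuousOnInterval (fun x => g (f x)) a b := by
  rw [absolutelyContinuousOnInterval_iff] at hf ⊢
  intro ε hε
  obtain ⟨δ, hδ, h⟩ := hf (ε / (K + 1)) (by positivity)
  refine ⟨δ, hδ, fun E hE hlt => ?_⟩
  have h1 := h E hE hlt
  have hmem := hE.1
  calc ∑ i ∈ Finset.range E.1, dist (g (f (E.2 i).1)) (g (f (E.2 i).2))
      ≤ ∑ i ∈ Finset.range E.1, K * dist (f (E.2 i).1) (f (E.2 i).2) := by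
        refine Finset.sum_le_sum fun i hi => ?_
        exact hg.dist_le_mul _ (hs (hmem i hi).1) _ (hs (hmem i hi).2)
    _ = K * ∑ i ∈ Finset.range E.1, dist (f (E.2 i).1) (f (E.2 i).2) := by
        rw [Finset.mul_sum]
    _ ≤ (K + 1) * ∑ i ∈ Finset.range E.1, dist (f (E.2 i).1) (f (E.2 i).2) := by
        gcongr
        linarith
    _ < (K + 1) * (ε / (K + 1)) := by
        gcongr
    _ = ε := by field_simp

lemma _root_.AbsolutelyContinuousOnInterval.congr {X : Type*} [PseudoMetricSpace X] {f g : ℝ → X}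
    {a b : ℝ} (hf : AbsolutelyContinuousOnInterval f a b) (h : EqOn f g (uIcc a b)) :
    AbsolutelyContinuousOnInterval g a b := by
  rw [absolutelyContinuousOnInterval_iff] at hf ⊢
  intro ε hε
  obtain ⟨δ, hδ, H⟩ := hf ε hε
  refine ⟨δ, hδ, fun E hE hlt => ?_⟩
  convert H E hE hlt using 1
  refine Finset.sum_congr rfl fun i hi => ?_
  rw [h (hE.1 i hi).1, h (hE.1 i hi).2]

/-- Real and imaginary parts are primitives of real integrable functions; they are recombined
through the isometric embedding of `ℝ` and multiplication by `i`. -/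
lemma absolutelyContinuousOnInterval_integral_complex {f : ℝ → ℂ} {a b : ℝ}
    (h : IntervalIntegrable f volume a b) :
    AbsolutelyContinuousOnInterval (fun x => ∫ t in a..x, f t) a b := by
  have hre : AbsolutelyContinuousOnInterval (fun x => ∫ t in a..x, (f t).re) a b :=
    IntervalIntegrable.absolutelyContinuousOnInterval_intervalIntegral
      ⟨h.1.re, h.2.re⟩ left_mem_uIcc
  have him : AbsolutelyContinuousOnInterval (fun x => ∫ t in a..x, (f t).im) a b :=
    IntervalIntegrable.absolutelyContinuousOnInterval_intervalIntegral
      ⟨h.1.im, h.2.im⟩ left_mem_uIcc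
  have hL : LipschitzOnWith 1 ((↑) : ℝ → ℂ) univ :=
    Complex.isometry_ofReal.lipschitz.lipschitzOnWith
  have hre' := hL.comp_absolutelyContinuousOnInterval hre (mapsTo_univ _ _)
  have him' := (hL.comp_absolutelyContinuousOnInterval him (mapsTo_univ _ _)).const_smul Complex.I
  refine (hre'.fun_add him').congr fun x hx => ?_
  have hi : IntervalIntegrable f volume a x := h.mono_set (uIcc_subset_uIcc_left hx)
  apply Complex.ext
  · have := Complex.reCLM.intervalIntegral_comp_comm hi
    simp at this
    simp [this]
  · have := Complex.imCLM.intervalIntegral_comp_comm hi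
    simp at this
    simp [this]

/-- Fundamental theorem of calculus for a complex absolutely continuous function. -/
lemma sub_eq_integral_of_absolutelyContinuous {f f' : ℝ → ℂ} {a b : ℝ} (hab : a ≤ b)
    (hf : AbsolutelyContinuousOnInterval f a b) (hf' : IntervalIntegrable f' volume a b)
    (hd : ∀ᵐ x, x ∈ Icc a b → HasDerivAt f (f' x) x) :
    f b - f a = ∫ t in a..b, f' t := by
  have hF := absolutelyContinuousOnInterval_integral_complex hf'
  have hsub := hf.fun_sub hF
  -- An absolutely continuous function with almost everywhere vanishing derivative is constant; this
  -- is applied to `f` minus the primitive of `f'`.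
  have hz : ∀ᵐ x, x ∈ uIcc a b → HasDerivAt (fun x => f x - ∫ t in a..x, f' t) 0 x := by
    filter_upwards [hd, hf'.ae_hasDerivAt_integral] with x h1 h2 hx
    have h2' := h2 hx a left_mem_uIcc
    rw [uIcc_of_le hab] at hx
    simpa using (h1 hx).fun_sub h2'
  obtain ⟨C, hC⟩ := hsub.const_of_ae_hasDerivAt_zero hz
  have e1 := hC a left_mem_uIcc
  have e2 := hC b right_mem_uIcc
  simp only [intervalIntegral.integral_same, sub_zero] at e1
  rw [e1, ← e2]
  ring

/-! ### The Schur test on weighted `L^∞` spaces -/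

section Schur

variable {a : ℝ} {φ : ℝ → ℝ} {K : ℝ → ℝ → ℂ}

lemma MemWeighted.memLp {f : ℝ → ℂ} (hf : MemWeighted a φ f) :
    MemLp (fun x => f x / (φ x : ℂ)) ∞ (volume.restrict (Ioi a)) :=
  hf

lemma MemWeighted.ae_norm_le (hφ : ∀ x, a < x → 0 < φ x) {f : ℝ → ℂ} (hf : MemWeighted a φ f) :
    ∀ᵐ y ∂(volume.restrict (Ioi a)), ‖f y‖ ≤ (weightedNorm a φ f).toReal * φ y := by
  have h := ae_le_eLpNormEssSup (f := fun x => f x / (φ x : ℂ)) (μ := volume.restrict (Ioi a))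
  have hfin : weightedNorm a φ f ≠ ∞ := hf.2.ne
  filter_upwards [h, ae_restrict_mem measurableSet_Ioi] with y hy hya
  have hpos := hφ y hya
  rw [← eLpNorm_exponent_top] at hy
  have h2 := ENNReal.toReal_mono hfin hy
  rw [toReal_enorm, norm_div, Complex.norm_real, Real.norm_of_nonneg hpos.le] at h2
  rwa [div_le_iff₀ hpos] at h2

lemma MemWeighted.aestronglyMeasurable (hφm : Measurable φ) (hφ : ∀ x, a < x → 0 < φ x)
    {f : ℝ → ℂ} (hf : MemWeighted a φ f) :
    AEStronglyMeasurable f (volume.restrict (Ioi a)) := by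
  have h := hf.1.mul (f := fun x => f x / (φ x : ℂ)) (g := fun x => (φ x : ℂ))
    (Complex.measurable_ofReal.comp hφm).aestronglyMeasurable
  refine h.congr ?_
  filter_upwards [ae_restrict_mem measurableSet_Ioi] with y hy
  have : (φ y : ℂ) ≠ 0 := by exact_mod_cast (hφ y hy).ne'
  simp [this]

lemma memWeighted_of_ae_bound (hφm : Measurable φ) (hφ : ∀ x, a < x → 0 < φ x) {f : ℝ → ℂ}
    (hf : AEStronglyMeasurable f (volume.restrict (Ioi a))) {M : ℝ}
    (hM : ∀ᵐ y ∂(volume.restrict (Ioi a)), ‖f y‖ ≤ M * φ y) :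
    MemWeighted a φ f ∧ weightedNorm a φ f ≤ ENNReal.ofReal M := by
  have hb : ∀ᵐ y ∂(volume.restrict (Ioi a)), ‖f y / (φ y : ℂ)‖ ≤ M := by
    filter_upwards [hM, ae_restrict_mem measurableSet_Ioi] with y hy hya
    have hpos := hφ y hya
    rwa [norm_div, Complex.norm_real, Real.norm_of_nonneg hpos.le, div_le_iff₀ hpos]
  have hm : AEStronglyMeasurable (fun y => f y / (φ y : ℂ)) (volume.restrict (Ioi a)) :=
    hf.div₀ (Complex.measurable_ofReal.comp hφm).aestronglyMeasurable
  refine ⟨memLp_top_of_bound hm M hb, ?_⟩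
  rw [weightedNorm, eLpNorm_exponent_top]
  exact eLpNormEssSup_le_of_ae_bound hb

lemma integrable_kernel_mul (hφm : Measurable φ) (hφ : ∀ x, a < x → 0 < φ x)
    (hKx : ∀ x, a < x → AEStronglyMeasurable (K x) (volume.restrict (Ioi a)))
    (hint : ∀ x, a < x → IntegrableOn (fun y => ‖K x y‖ * φ y) (Ioi a))
    {f : ℝ → ℂ} (hf : MemWeighted a φ f) {x : ℝ} (hx : a < x) :
    IntegrableOn (fun y => K x y * f y) (Ioi a) := by
  refine Integrable.mono' ((hint x hx).const_mul (weightedNorm a φ f).toReal)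
    ((hKx x hx).mul (hf.aestronglyMeasurable hφm hφ)) ?_
  filter_upwards [hf.ae_norm_le hφ] with y hy
  rw [norm_mul]
  calc ‖K x y‖ * ‖f y‖ ≤ ‖K x y‖ * ((weightedNorm a φ f).toReal * φ y) := by gcongr
    _ = _ := by ring

lemma norm_kernelOp_le (hφ : ∀ x, a < x → 0 < φ x)
    (hint : ∀ x, a < x → IntegrableOn (fun y => ‖K x y‖ * φ y) (Ioi a))
    {f : ℝ → ℂ} (hf : MemWeighted a φ f) {x : ℝ} (hx : a < x) :
    ‖kernelOp a K f x‖ ≤ (weightedNorm a φ f).toReal * ∫ y in Ioi a, ‖K x y‖ * φ y := by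
  rw [kernelOp, ← integral_const_mul]
  refine norm_integral_le_of_norm_le ((hint x hx).const_mul _) ?_
  filter_upwards [hf.ae_norm_le hφ] with y hy
  rw [norm_mul]
  calc ‖K x y‖ * ‖f y‖ ≤ ‖K x y‖ * ((weightedNorm a φ f).toReal * φ y) := by gcongr
    _ = _ := by ring

lemma kernelOp_congr_ae {f g : ℝ → ℂ} (h : f =ᵐ[volume.restrict (Ioi a)] g) (x : ℝ) :
    kernelOp a K f x = kernelOp a K g x := by
  refine integral_congr_ae ?_
  filter_upwards [h] with y hy
  simp [hy]

lemma aestronglyMeasurable_kernelOp (hφm : Measurable φ) (hφ : ∀ x, a < x → 0 < φ x)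
    (hK : AEStronglyMeasurable (fun p : ℝ × ℝ => K p.1 p.2)
      ((volume.restrict (Ioi a)).prod (volume.restrict (Ioi a))))
    {f : ℝ → ℂ} (hf : MemWeighted a φ f) :
    AEStronglyMeasurable (kernelOp a K f) (volume.restrict (Ioi a)) := by
  have h := hK.mul ((hf.aestronglyMeasurable hφm hφ).comp_snd (μ := volume.restrict (Ioi a)))
  exact h.integral_prod_right'

/-- The Schur test: if `∫ |K(x, y)| φ(y) dy ≤ θ φ(x)` with `θ < 1`, then `1 + K` is invertible
on `L^∞(]a,∞[, φ)`. -/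
theorem oneAddInvertible_of_schur (hφm : Measurable φ) (hφ : ∀ x, a < x → 0 < φ x)
    (hK : AEStronglyMeasurable (fun p : ℝ × ℝ => K p.1 p.2)
      ((volume.restrict (Ioi a)).prod (volume.restrict (Ioi a))))
    (hKx : ∀ x, a < x → AEStronglyMeasurable (K x) (volume.restrict (Ioi a)))
    (hint : ∀ x, a < x → IntegrableOn (fun y => ‖K x y‖ * φ y) (Ioi a))
    {θ : ℝ} (hθ0 : 0 ≤ θ) (hθ : θ < 1)
    (hle : ∀ x, a < x → ∫ y in Ioi a, ‖K x y‖ * φ y ≤ θ * φ x) :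
    OneAddInvertible a φ K := by
  have hbd : ∀ f, MemWeighted a φ f → MemWeighted a φ (kernelOp a K f) ∧
      weightedNorm a φ (kernelOp a K f) ≤ ENNReal.ofReal (θ * (weightedNorm a φ f).toReal) := by
    intro f hf
    refine memWeighted_of_ae_bound hφm hφ (aestronglyMeasurable_kernelOp hφm hφ hK hf) ?_
    filter_upwards [ae_restrict_mem measurableSet_Ioi] with x hx
    calc _ ≤ _ := norm_kernelOp_le hφ hint hf hx
      _ ≤ (weightedNorm a φ f).toReal * (θ * φ x) := by gcongr; exact hle x hx
      _ = _ := by ring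
  have hmemU : ∀ u : Lp ℂ ∞ (volume.restrict (Ioi a)),
      (fun x => (u x * (φ x : ℂ)) / (φ x : ℂ)) =ᵐ[volume.restrict (Ioi a)] u := by
    intro u
    filter_upwards [ae_restrict_mem measurableSet_Ioi] with y hy
    have : (φ y : ℂ) ≠ 0 := by exact_mod_cast (hφ y hy).ne'
    simp [this]
  have hmemW : ∀ u : Lp ℂ ∞ (volume.restrict (Ioi a)), MemWeighted a φ (fun x => u x * (φ x : ℂ)) :=
    fun u => (memLp_congr_ae (hmemU u)).2 (Lp.memLp u)
  have hnormW : ∀ u : Lp ℂ ∞ (volume.restrict (Ioi a)),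
      weightedNorm a φ (fun x => u x * (φ x : ℂ)) = eLpNorm u ∞ (volume.restrict (Ioi a)) :=
    fun u => eLpNorm_congr_ae (hmemU u)
  have hφne : ∀ᵐ y ∂(volume.restrict (Ioi a)), (φ y : ℂ) ≠ 0 := by
    filter_upwards [ae_restrict_mem measurableSet_Ioi] with y hy
    exact_mod_cast (hφ y hy).ne'
  have hadd : ∀ f g, MemWeighted a φ f → MemWeighted a φ g → ∀ x, a < x →
      kernelOp a K (fun y => f y + g y) x = kernelOp a K f x + kernelOp a K g x := by
    intro f g hf hg x hx
    simp only [kernelOp, mul_add]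
    exact integral_add (integrable_kernel_mul hφm hφ hKx hint hf hx)
      (integrable_kernel_mul hφm hφ hKx hint hg hx)
  -- Conjugation by the weight: `u ↦ K (u φ) / φ` acts on the unweighted `L^∞`, where the Schur
  -- bound says that its norm is at most `θ`.
  let T₀ : Lp ℂ ∞ (volume.restrict (Ioi a)) →ₗ[ℂ] Lp ℂ ∞ (volume.restrict (Ioi a)) :=
    { toFun := fun u => (hbd _ (hmemW u)).1.memLp.toLp
      map_add' := by
        intro u v
        rw [← MemLp.toLp_add, MemLp.toLp_eq_toLp_iff]
        filter_upwards [ae_restrict_mem measurableSet_Ioi] with x hx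
        simp only [Pi.add_apply]
        rw [← add_div, ← hadd _ _ (hmemW u) (hmemW v) x hx]
        congr 1
        refine kernelOp_congr_ae ?_ x
        filter_upwards [Lp.coeFn_add u v] with y hy
        rw [hy, Pi.add_apply]
        ring
      map_smul' := by
        intro c u
        rw [RingHom.id_apply, ← MemLp.toLp_const_smul, MemLp.toLp_eq_toLp_iff]
        refine Filter.Eventually.of_forall fun x => ?_
        simp only [Pi.smul_apply, smul_eq_mul]
        rw [← mul_div_assoc]
        congr 1
        rw [kernelOp, kernelOp, ← integral_const_mul]
        refine integral_congr_ae ?_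
        filter_upwards [Lp.coeFn_smul c u] with y hy
        rw [hy, Pi.smul_apply, smul_eq_mul]
        ring }
  have hT₀ : ∀ u, ‖T₀ u‖ ≤ θ * ‖u‖ := by
    intro u
    have h := (hbd _ (hmemW u)).2
    rw [hnormW] at h
    have := ENNReal.toReal_mono ENNReal.ofReal_ne_top h
    rw [ENNReal.toReal_ofReal (by positivity)] at this
    change ‖(hbd _ (hmemW u)).1.memLp.toLp‖ ≤ _
    rw [Lp.norm_toLp, Lp.norm_def]
    exact this
  let T : Lp ℂ ∞ (volume.restrict (Ioi a)) →L[ℂ] Lp ℂ ∞ (volume.restrict (Ioi a)) :=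
    T₀.mkContinuous θ hT₀
  have hTlt : ‖-T‖ < 1 := by
    rw [norm_neg]
    exact (T₀.mkContinuous_norm_le hθ0 hT₀).trans_lt hθ
  -- Neumann series for `1 - (-T)`.
  obtain ⟨S, hS⟩ := isUnit_one_sub_of_norm_lt_one hTlt
  rw [sub_neg_eq_add] at hS
  obtain ⟨R, hR1, hR2⟩ : ∃ R : Lp ℂ ∞ (volume.restrict (Ioi a)) →L[ℂ]
      Lp ℂ ∞ (volume.restrict (Ioi a)), R * (1 + T) = 1 ∧ (1 + T) * R = 1 :=
    ⟨S.inv, by rw [← hS]; exact S.inv_val, by rw [← hS]; exact S.val_inv⟩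
  have hTapp : ∀ u, T u =ᵐ[volume.restrict (Ioi a)]
      fun x => kernelOp a K (fun y => u y * (φ y : ℂ)) x / (φ x : ℂ) :=
    fun u => (hbd _ (hmemW u)).1.memLp.coeFn_toLp
  have hback : ∀ f (hf : MemWeighted a φ f),
      (fun y => (hf.memLp.toLp : Lp ℂ ∞ (volume.restrict (Ioi a))) y * (φ y : ℂ))
        =ᵐ[volume.restrict (Ioi a)] f := by
    intro f hf
    filter_upwards [hf.memLp.coeFn_toLp, hφne] with y hy hne
    rw [hy]
    field_simp
  refine ⟨fun f hf x hx => integrable_kernel_mul hφm hφ hKx hint hf hx, ?_, ?_, ?_⟩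
  · refine ⟨θ.toNNReal, fun f hf => ⟨(hbd f hf).1, (hbd f hf).2.trans ?_⟩⟩
    rw [ENNReal.ofReal_mul hθ0, ENNReal.ofReal_toReal (show weightedNorm a φ f ≠ ∞ from hf.2.ne)]
    rfl
  · intro g₁ g₂ h₁ h₂ h
    have key : (1 + T) h₁.memLp.toLp = (1 + T) h₂.memLp.toLp := by
      refine Lp.ext ?_
      simp only [add_apply, one_apply_eq_self]
      filter_upwards [h, Lp.coeFn_add h₁.memLp.toLp (T h₁.memLp.toLp), Lp.coeFn_add h₂.memLp.toLp (T h₂.memLp.toLp),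
        hTapp h₁.memLp.toLp, hTapp h₂.memLp.toLp, h₁.memLp.coeFn_toLp, h₂.memLp.coeFn_toLp] with x hx e1 e2 e3 e4 e5 e6
      rw [e1, e2, Pi.add_apply, Pi.add_apply, e3, e4, e5, e6,
        kernelOp_congr_ae (hback g₁ h₁), kernelOp_congr_ae (hback g₂ h₂), ← add_div, ← add_div, hx]
    have key2 : h₁.memLp.toLp = h₂.memLp.toLp := by
      have e := congrArg R key
      rwa [← mul_apply_eq_comp, ← mul_apply_eq_comp, hR1,
        one_apply_eq_self, one_apply_eq_self] at e
    filter_upwards [hback g₁ h₁, hback g₂ h₂] with x e1 e2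
    rw [← e1, ← e2, key2]
  · refine ⟨‖R‖₊, fun f hf => ?_⟩
    set u := R hf.memLp.toLp with hu
    have hSu : (1 + T) u = hf.memLp.toLp := by
      rw [hu, ← mul_apply_eq_comp, hR2, one_apply_eq_self]
    refine ⟨fun x => u x * (φ x : ℂ), hmemW u, ?_, ?_⟩
    · rw [hnormW]
      have h1 : ‖u‖ₑ ≤ ‖R‖ₑ * ‖hf.memLp.toLp‖ₑ :=
        ContinuousLinearMap.le_opENorm _ _
      rw [Lp.enorm_def, Lp.enorm_toLp] at h1
      exact h1
    · have e := hSu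
      simp only [add_apply, one_apply_eq_self] at e
      have e' := Lp.coeFn_add u (T u)
      rw [e] at e'
      filter_upwards [e', hTapp u, hf.memLp.coeFn_toLp, hφne] with x e1 e2 e3 hne
      rw [e3, Pi.add_apply, e2] at e1
      field_simp at e1
      rw [e1]
      ring

lemma weightedNorm_le_of_weight_le {ψ : ℝ → ℝ} (hφ : ∀ x, a < x → 0 < φ x) {B : ℝ≥0}
    (hle : ∀ x, a < x → φ x ≤ B * ψ x) (f : ℝ → ℂ) :
    weightedNorm a ψ f ≤ B * weightedNorm a φ f := by
  rw [weightedNorm, weightedNorm]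
  refine eLpNorm_le_nnreal_smul_eLpNorm_of_ae_le_mul ?_ ∞
  filter_upwards [ae_restrict_mem measurableSet_Ioi] with x hx
  have h1 := hφ x hx
  have h2 := hle x hx
  have h3 : 0 < (B : ℝ) * ψ x := h1.trans_le h2
  have h4 : 0 < ψ x := pos_of_mul_pos_right h3 B.2
  rw [← NNReal.coe_le_coe]
  push_cast
  rw [norm_div, norm_div, Complex.norm_real, Complex.norm_real, Real.norm_of_nonneg h1.le,
    Real.norm_of_nonneg h4.le, div_le_iff₀ h4]
  calc ‖f x‖ = ‖f x‖ / φ x * φ x := by field_simp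
    _ ≤ ‖f x‖ / φ x * (B * ψ x) := by gcongr
    _ = _ := by ring

lemma MemWeighted.of_weight_le {ψ : ℝ → ℝ} (hφm : Measurable φ) (hψm : Measurable ψ)
    (hφ : ∀ x, a < x → 0 < φ x) {B : ℝ≥0}
    (hle : ∀ x, a < x → φ x ≤ B * ψ x) {f : ℝ → ℂ} (hf : MemWeighted a φ f) :
    MemWeighted a ψ f :=
  ⟨(hf.aestronglyMeasurable hφm hφ).div₀ (Complex.measurable_ofReal.comp hψm).aestronglyMeasurable,
    (weightedNorm_le_of_weight_le hφ hle f).trans_lt (ENNReal.mul_lt_top (by simp) hf.2)⟩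

/-- Invertibility on a weighted space depends only on the equivalence class of the weight. -/
theorem OneAddInvertible.of_equivalent_weight {ψ : ℝ → ℝ} (hφm : Measurable φ)
    (hψm : Measurable ψ) (hφ : ∀ x, a < x → 0 < φ x) (hψ : ∀ x, a < x → 0 < ψ x) {B D : ℝ≥0}
    (hB : ∀ x, a < x → φ x ≤ B * ψ x) (hD : ∀ x, a < x → ψ x ≤ D * φ x)
    (h : OneAddInvertible a φ K) : OneAddInvertible a ψ K := by
  have up : ∀ {f}, MemWeighted a φ f → MemWeighted a ψ f := fun hf =>
    hf.of_weight_le hφm hψm hφ hB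
  have down : ∀ {f}, MemWeighted a ψ f → MemWeighted a φ f := fun hf =>
    hf.of_weight_le hψm hφm hψ hD
  have chain : ∀ (C : ℝ≥0) (f g : ℝ → ℂ), weightedNorm a φ g ≤ C * weightedNorm a φ f →
      weightedNorm a ψ g ≤ (B * C * D : ℝ≥0) * weightedNorm a ψ f := by
    intro C f g hfg
    calc weightedNorm a ψ g ≤ B * weightedNorm a φ g := weightedNorm_le_of_weight_le hφ hB g
      _ ≤ B * (C * (D * weightedNorm a ψ f)) := by
        gcongr
        exact hfg.trans (by gcongr; exact weightedNorm_le_of_weight_le hψ hD f)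
      _ = _ := by push_cast; ring
  obtain ⟨C, hC⟩ := h.bounded
  obtain ⟨C', hC'⟩ := h.surjective
  refine ⟨fun f hf => h.integrable f (down hf), ⟨B * C * D, fun f hf => ?_⟩,
    fun g₁ g₂ h₁ h₂ => h.injective g₁ g₂ (down h₁) (down h₂), ⟨B * C' * D, fun f hf => ?_⟩⟩
  · exact ⟨up (hC f (down hf)).1, chain _ _ _ (hC f (down hf)).2⟩
  · obtain ⟨g, hg, hle, heq⟩ := hC' f (down hf)
    exact ⟨g, up hg, chain _ _ _ hle, heq⟩

end Schur

/-! ### Solutions of the Bessel equations -/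

/-- The coefficient of the unperturbed equation in the form `h'' = (k² + (m² - 1/4) / x²) h`. -/
def besselCoeff (m k : ℂ) (x : ℝ) : ℂ :=
  k ^ 2 + (m ^ 2 - 1 / 4) / (x : ℂ) ^ 2

lemma continuousOn_besselCoeff (m k : ℂ) : ContinuousOn (besselCoeff m k) (Ioi 0) := by
  refine continuousOn_const.add (continuousOn_const.div (by fun_prop) fun x hx => ?_)
  have : (x : ℂ) ≠ 0 := by exact_mod_cast (ne_of_gt hx)
  exact pow_ne_zero 2 this

lemma absolutelyContinuousOnInterval_of_hasDerivAt {f f' : ℝ → ℂ} {a b : ℝ} (hab : a ≤ b)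
    (hf : ∀ x ∈ Icc a b, HasDerivAt f (f' x) x) (hf' : ContinuousOn f' (Icc a b)) :
    AbsolutelyContinuousOnInterval f a b := by
  obtain ⟨C, hC⟩ := isCompact_Icc.exists_bound_of_continuousOn hf'
  have hL : LipschitzOnWith C.toNNReal f (Icc a b) := by
    refine (convex_Icc a b).lipschitzOnWith_of_nnnorm_hasDerivWithin_le
      (fun x hx => (hf x hx).hasDerivWithinAt) fun x hx => ?_
    rw [← norm_toNNReal]
    exact Real.toNNReal_le_toNNReal (hC x hx)
  rw [← uIcc_of_le hab] at hL
  exact hL.absolutelyContinuousOnInterval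

lemma isSolution_iff {Q : ℝ → ℂ} {m k : ℂ} {f : ℝ → ℂ} :
    IsSolution Q m k f ↔ IsAC1 f ∧ ∀ᵐ x ∂(volume.restrict (Ioi (0 : ℝ))),
      deriv (deriv f) x = (besselCoeff m k x + Q x) * f x := by
  refine and_congr_right fun _ => ?_
  have h : ∀ x, besselOp Q m f x = -k ^ 2 * f x ↔
      deriv (deriv f) x = (besselCoeff m k x + Q x) * f x := by
    intro x
    rw [besselOp, besselCoeff]
    constructor <;> intro h <;> linear_combination -h
  simp only [h]

/-- `h` is a twice differentiable solution of the unperturbed equation. -/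
def IsClassical (m k : ℂ) (h : ℝ → ℂ) : Prop :=
  ∀ x, 0 < x → HasDerivAt h (deriv h x) x ∧ HasDerivAt (deriv h) (besselCoeff m k x * h x) x

lemma IsClassical.of_hasDerivAt {m k : ℂ} {h h' : ℝ → ℂ}
    (h1 : ∀ x, 0 < x → HasDerivAt h (h' x) x)
    (h2 : ∀ x, 0 < x → HasDerivAt h' (besselCoeff m k x * h x) x) : IsClassical m k h := by
  intro x hx
  refine ⟨(h1 x hx).differentiableAt.hasDerivAt, (h2 x hx).congr_of_eventuallyEq ?_⟩
  filter_upwards [Ioi_mem_nhds hx] with y hy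
  exact (h1 y hy).deriv

lemma IsClassical.continuousOn {m k : ℂ} {h : ℝ → ℂ} (hh : IsClassical m k h) :
    ContinuousOn h (Ioi 0) :=
  fun x hx => (hh x hx).1.continuousAt.continuousWithinAt

lemma IsClassical.continuousOn_deriv {m k : ℂ} {h : ℝ → ℂ} (hh : IsClassical m k h) :
    ContinuousOn (deriv h) (Ioi 0) :=
  fun x hx => (hh x hx).2.continuousAt.continuousWithinAt

lemma Icc_subset_Ioi_zero {a b : ℝ} (ha : 0 < a) : Icc a b ⊆ Ioi 0 :=
  fun _ hx => ha.trans_le hx.1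

lemma IsClassical.absolutelyContinuous {m k : ℂ} {h : ℝ → ℂ} (hh : IsClassical m k h) {a b : ℝ}
    (ha : 0 < a) (hab : a ≤ b) : AbsolutelyContinuousOnInterval h a b :=
  absolutelyContinuousOnInterval_of_hasDerivAt hab (fun x hx => (hh x (ha.trans_le hx.1)).1)
    (hh.continuousOn_deriv.mono (Icc_subset_Ioi_zero ha))

lemma IsClassical.absolutelyContinuous_deriv {m k : ℂ} {h : ℝ → ℂ} (hh : IsClassical m k h)
    {a b : ℝ} (ha : 0 < a) (hab : a ≤ b) : AbsolutelyContinuousOnInterval (deriv h) a b :=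
  absolutelyContinuousOnInterval_of_hasDerivAt hab (fun x hx => (hh x (ha.trans_le hx.1)).2)
    (((continuousOn_besselCoeff m k).mul hh.continuousOn).mono (Icc_subset_Ioi_zero ha))

lemma IsClassical.isSolution {m k : ℂ} {h : ℝ → ℂ} (hh : IsClassical m k h) :
    IsSolution 0 m k h := by
  refine isSolution_iff.2 ⟨⟨fun x hx => (hh x hx).1.differentiableAt.differentiableWithinAt,
    fun a b ha hab => hh.absolutelyContinuous_deriv ha hab⟩, ?_⟩
  filter_upwards [ae_restrict_mem measurableSet_Ioi] with x hx
  rw [(hh x hx).2.deriv]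
  simp

lemma IsAC1.hasDerivAt {f : ℝ → ℂ} (hf : IsAC1 f) {x : ℝ} (hx : 0 < x) :
    HasDerivAt f (deriv f x) x :=
  (hf.1.differentiableAt (Ioi_mem_nhds hx)).hasDerivAt

lemma IsAC1.continuousOn {f : ℝ → ℂ} (hf : IsAC1 f) : ContinuousOn f (Ioi 0) :=
  hf.1.continuousOn

lemma IsAC1.continuousOn_deriv {f : ℝ → ℂ} (hf : IsAC1 f) : ContinuousOn (deriv f) (Ioi 0) := by
  intro x hx
  have hx : 0 < x := hx
  have h := (hf.2 (x / 2) (x + 1) (by linarith) (by linarith)).continuousOn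
  rw [uIcc_of_le (by linarith)] at h
  exact (h.continuousAt (Icc_mem_nhds (by linarith) (by linarith))).continuousWithinAt

lemma IsAC1.absolutelyContinuous {f : ℝ → ℂ} (hf : IsAC1 f) {a b : ℝ}
    (ha : 0 < a) (hab : a ≤ b) : AbsolutelyContinuousOnInterval f a b :=
  absolutelyContinuousOnInterval_of_hasDerivAt hab (fun _ hx => hf.hasDerivAt (ha.trans_le hx.1))
    (hf.continuousOn_deriv.mono (Icc_subset_Ioi_zero ha))

/-- Absolute continuity gives bounded variation, hence differentiability almost everywhere. Thus the
second `deriv` in the equation is a genuine derivative almost everywhere, not a default value. -/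
lemma IsSolution.ae_hasDerivAt_deriv {Q : ℝ → ℂ} {m k : ℂ} {f : ℝ → ℂ} (hf : IsSolution Q m k f)
    {a b : ℝ} (ha : 0 < a) (hab : a ≤ b) :
    ∀ᵐ x, x ∈ Icc a b → HasDerivAt (deriv f) ((besselCoeff m k x + Q x) * f x) x := by
  obtain ⟨h1, h2⟩ := isSolution_iff.1 hf
  have h3 := (h1.2 a b ha hab).boundedVariationOn.ae_differentiableAt_of_mem_uIcc
  rw [ae_restrict_iff' measurableSet_Ioi] at h2
  filter_upwards [h2, h3] with x h2 h3 hx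
  rw [← h2 (ha.trans_le hx.1)]
  rw [uIcc_of_le hab] at h3
  exact (h3 hx).hasDerivAt

/-- For `Q = 0` the coefficient is continuous, so `deriv f` is the primitive of a continuous
function and the equation holds at every point. This makes the chosen fundamental pair, known only
as an `AC¹` pair, available for pointwise calculus. -/
lemma IsSolution.isClassical {m k : ℂ} {f : ℝ → ℂ} (hf : IsSolution 0 m k f) :
    IsClassical m k f := by
  intro x hx
  have hAC := hf.1
  refine ⟨hAC.hasDerivAt hx, ?_⟩
  have hcont : ContinuousOn (fun x => besselCoeff m k x * f x) (Ioi 0) :=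
    (continuousOn_besselCoeff m k).mul hAC.continuousOn
  have hx2 : 0 < x / 2 := by linarith
  have key : ∀ y, x / 2 ≤ y →
      deriv f y = deriv f (x / 2) + ∫ t in (x / 2)..y, besselCoeff m k t * f t := by
    intro y hy
    have h := hf.ae_hasDerivAt_deriv hx2 hy
    simp only [Pi.zero_apply, add_zero] at h
    rw [← sub_eq_integral_of_absolutelyContinuous hy (hAC.2 _ _ hx2 hy) _ h]
    · ring
    · refine ContinuousOn.intervalIntegrable ?_
      rw [uIcc_of_le hy]
      exact hcont.mono (Icc_subset_Ioi_zero hx2)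
  have hI : HasDerivAt (fun y => ∫ t in (x / 2)..y, besselCoeff m k t * f t)
      (besselCoeff m k x * f x) x := by
    refine intervalIntegral.integral_hasDerivAt_right ?_ ?_ ?_
    · refine ContinuousOn.intervalIntegrable ?_
      rw [uIcc_of_le (by linarith)]
      exact hcont.mono (Icc_subset_Ioi_zero hx2)
    · exact hcont.stronglyMeasurableAtFilter isOpen_Ioi x hx
    · exact hcont.continuousAt (Ioi_mem_nhds hx)
  refine (hI.const_add (deriv f (x / 2))).congr_of_eventuallyEq ?_
  filter_upwards [Ici_mem_nhds (show x / 2 < x by linarith)] with y hy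
  exact key y hy

lemma IsClassical.wronskian_eq {m k : ℂ} {f g : ℝ → ℂ} (hf : IsClassical m k f)
    (hg : IsClassical m k g) {x y : ℝ} (hx : 0 < x) (hy : 0 < y) :
    wronskian f g x = wronskian f g y := by
  have hd : ∀ x, 0 < x → HasDerivAt (wronskian f g) 0 x := by
    intro x hx
    have h := ((hf x hx).1.fun_mul (hg x hx).2).fun_sub ((hf x hx).2.fun_mul (hg x hx).1)
    exact h.congr_deriv (by ring)
  refine (convex_Ioi (0 : ℝ)).is_const_of_fderivWithin_eq_zero (𝕜 := ℝ)
    (fun x hx => (hd x hx).differentiableAt.differentiableWithinAt) (fun x hx => ?_) hx hy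
  rw [fderivWithin_of_isOpen isOpen_Ioi hx]
  ext
  simp [(hd x hx).deriv]

lemma IsClassical.linear_combination {m k : ℂ} {f g : ℝ → ℂ} (hf : IsClassical m k f)
    (hg : IsClassical m k g) (α β : ℂ) : IsClassical m k (fun x => α * f x + β * g x) := by
  refine IsClassical.of_hasDerivAt (h' := fun x => α * deriv f x + β * deriv g x)
    (fun x hx => ((hf x hx).1.const_mul α).fun_add ((hg x hx).1.const_mul β)) fun x hx => ?_
  exact (((hf x hx).2.const_mul α).fun_add ((hg x hx).2.const_mul β)).congr_deriv (by ring)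

/-! ### Growth of the solutions of the unperturbed equation -/

/-- Energy estimate for the unperturbed equation. -/
lemma IsClassical.energy_le {m k : ℂ} (hk : 0 ≤ k.re) (hk0 : k ≠ 0) {h : ℝ → ℂ}
    (hh : IsClassical m k h) {x y : ℝ} (hx : 0 < x) (hxy : x ≤ y) :
    ‖deriv h y + k * h y‖ ^ 2 + ‖deriv h y - k * h y‖ ^ 2 ≤
      (‖deriv h x + k * h x‖ ^ 2 + ‖deriv h x - k * h x‖ ^ 2) *
        Real.exp (2 * k.re * (y - x) + 2 * ‖m ^ 2 - 1 / 4‖ / ‖k‖ / x) := by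
  set c : ℂ := m ^ 2 - 1 / 4 with hc
  have hkpos : 0 < ‖k‖ := norm_pos_iff.2 hk0
  set b : ℝ := 2 * ‖c‖ / ‖k‖ with hb
  have hb0 : 0 ≤ b := by positivity
  -- The combinations `h' ± k h` diagonalise the equation with the `x⁻²` term removed: `p` has rate
  -- `k` and `q` has rate `-k`. Hence `E` grows at rate at most `2 Re k` up to a perturbation of
  -- size `b / x²`.
  set p : ℝ → ℂ := fun x => deriv h x + k * h x with hp
  set q : ℝ → ℂ := fun x => deriv h x - k * h x with hq
  set E : ℝ → ℝ := fun x => ‖p x‖ ^ 2 + ‖q x‖ ^ 2 with hE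
  -- Integrating factor for `E' ≤ (2 Re k + b / x²) E`.
  set e : ℝ → ℝ := fun x => Real.exp (-2 * k.re * x + b * x⁻¹) with he
  have hpd : ∀ x, 0 < x → HasDerivAt p (k * p x + c / (x : ℂ) ^ 2 * h x) x := by
    intro x hx
    refine ((hh x hx).2.fun_add ((hh x hx).1.const_mul k)).congr_deriv ?_
    simp only [hp, besselCoeff, hc]
    ring
  have hqd : ∀ x, 0 < x → HasDerivAt q (-(k * q x) + c / (x : ℂ) ^ 2 * h x) x := by
    intro x hx
    refine ((hh x hx).2.fun_sub ((hh x hx).1.const_mul k)).congr_deriv ?_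
    simp only [hq, besselCoeff, hc]
    ring
  have hEd : ∀ x, 0 < x → HasDerivAt E
      (2 * inner ℝ (p x) (k * p x + c / (x : ℂ) ^ 2 * h x) +
        2 * inner ℝ (q x) (-(k * q x) + c / (x : ℂ) ^ 2 * h x)) x :=
    fun x hx => (hpd x hx).norm_sq.fun_add (hqd x hx).norm_sq
  have hed : ∀ x, 0 < x → HasDerivAt e (e x * (-2 * k.re - b / x ^ 2)) x := by
    intro x hx
    have h1 := (((hasDerivAt_id x).const_mul (-2 * k.re)).fun_add
      ((hasDerivAt_inv hx.ne').const_mul b)).exp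
    refine h1.congr_deriv ?_
    simp only [he, id]
    ring
  have hEle : ∀ x, 0 < x → 2 * inner ℝ (p x) (k * p x + c / (x : ℂ) ^ 2 * h x) +
        2 * inner ℝ (q x) (-(k * q x) + c / (x : ℂ) ^ 2 * h x) ≤
      (2 * k.re + b / x ^ 2) * E x := by
    intro x hx
    have i1 : inner ℝ (p x) (k * p x) = k.re * ‖p x‖ ^ 2 := by
      rw [Complex.inner, ← Complex.normSq_eq_norm_sq, Complex.normSq_apply]
      simp
      ring
    have i2 : inner ℝ (q x) (k * q x) = k.re * ‖q x‖ ^ 2 := by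
      rw [Complex.inner, ← Complex.normSq_eq_norm_sq, Complex.normSq_apply]
      simp
      ring
    have j1 := real_inner_le_norm (p x) (c / (x : ℂ) ^ 2 * h x)
    have j2 := real_inner_le_norm (q x) (c / (x : ℂ) ^ 2 * h x)
    have hn : ‖c / (x : ℂ) ^ 2 * h x‖ = ‖c‖ / x ^ 2 * ‖h x‖ := by
      rw [norm_mul, norm_div, norm_pow, Complex.norm_real, Real.norm_of_nonneg hx.le]
    have hhx : 2 * ‖k‖ * ‖h x‖ ≤ ‖p x‖ + ‖q x‖ := by
      calc 2 * ‖k‖ * ‖h x‖ = ‖p x - q x‖ := by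
            rw [show p x - q x = 2 * k * h x by simp only [hp, hq]; ring]
            simp
        _ ≤ _ := norm_sub_le _ _
    rw [inner_add_right, inner_add_right, inner_neg_right, i1, i2]
    rw [hn] at j1 j2
    have hd0 : 0 ≤ ‖c‖ / x ^ 2 := by positivity
    have hbx : b / x ^ 2 = 2 * (‖c‖ / x ^ 2) / ‖k‖ := by rw [hb]; ring
    -- The perturbation is controlled by `E` because `h = (p - q) / (2k)`; this is where `k ≠ 0`
    -- enters.
    have key : 2 * (‖p x‖ + ‖q x‖) * ((‖c‖ / x ^ 2) * ‖h x‖) ≤ b / x ^ 2 * E x := by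
      rw [hbx, div_mul_eq_mul_div (2 * (‖c‖ / x ^ 2)), le_div_iff₀ hkpos]
      have : (‖p x‖ + ‖q x‖) * (2 * ‖k‖ * ‖h x‖) ≤ 2 * E x := by
        calc _ ≤ (‖p x‖ + ‖q x‖) * (‖p x‖ + ‖q x‖) := by gcongr
          _ ≤ 2 * E x := by simp only [hE]; nlinarith [sq_nonneg (‖p x‖ - ‖q x‖)]
      nlinarith [mul_le_mul_of_nonneg_left this hd0]
    have hqk : 0 ≤ k.re * ‖q x‖ ^ 2 := by positivity
    simp only [hE] at key ⊢
    nlinarith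
  have hanti : AntitoneOn (fun x => E x * e x) (Ioi 0) := by
    have hder : ∀ x, 0 < x → HasDerivAt (fun x => E x * e x) _ x :=
      fun x hx => (hEd x hx).fun_mul (hed x hx)
    refine antitoneOn_of_deriv_nonpos (convex_Ioi 0)
      (fun x hx => (hder x hx).continuousAt.continuousWithinAt)
      (fun x hx => ?_) fun x hx => ?_
    · rw [interior_Ioi] at hx
      exact (hder x hx).differentiableAt.differentiableWithinAt
    · rw [interior_Ioi] at hx
      rw [(hder x hx).deriv]
      have he0 : 0 ≤ e x := (Real.exp_pos _).le
      nlinarith [mul_le_mul_of_nonneg_right (hEle x hx) he0]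
  have h1 := hanti hx (hx.trans_le hxy) hxy
  simp only [he] at h1
  have hypos : 0 < y := hx.trans_le hxy
  have hE0 : 0 ≤ E x := by positivity
  have hEy : E y = E y * Real.exp (-2 * k.re * y + b * y⁻¹) *
      Real.exp (2 * k.re * y - b * y⁻¹) := by
    rw [mul_assoc, ← Real.exp_add]
    simp
  calc E y = _ := hEy
    _ ≤ E x * Real.exp (-2 * k.re * x + b * x⁻¹) * Real.exp (2 * k.re * y - b * y⁻¹) := by
      gcongr
    _ = E x * Real.exp (2 * k.re * (y - x) + b / x - b * y⁻¹) := by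
      rw [mul_assoc, ← Real.exp_add]
      congr 2
      ring
    _ ≤ E x * Real.exp (2 * k.re * (y - x) + b / x) := by
      gcongr
      have : 0 ≤ b * y⁻¹ := by positivity
      linarith

/-- Solutions of the unperturbed equation grow at most like `exp (x Re k)`. -/
lemma exists_growth_bound (m : ℂ) {k : ℂ} (hk : 0 ≤ k.re) (hk0 : k ≠ 0) {a : ℝ} (ha : 0 < a) :
    ∃ C : ℝ, 0 ≤ C ∧ ∀ h : ℝ → ℂ, IsClassical m k h → ∀ x y : ℝ, a ≤ x → x ≤ y →
      ‖h y‖ ≤ C * Real.exp ((y - x) * k.re) * (‖h x‖ + ‖deriv h x‖) ∧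
      ‖deriv h y‖ ≤ C * Real.exp ((y - x) * k.re) * (‖h x‖ + ‖deriv h x‖) := by
  have hkpos : 0 < ‖k‖ := norm_pos_iff.2 hk0
  -- Square root of the perturbative factor in the energy estimate, made uniform by `x ≥ a`. The
  -- factors `1 + ‖k‖` and `1 + 1 / ‖k‖` below come from passing from `(h, h')` to `h' ± k h` and
  -- back.
  set D : ℝ := Real.exp (‖m ^ 2 - 1 / 4‖ / ‖k‖ / a) with hD
  refine ⟨2 * D * (1 + ‖k‖) * (1 + 1 / ‖k‖), by positivity, fun h hh x y hx hxy => ?_⟩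
  have hx0 : 0 < x := ha.trans_le hx
  have hE := hh.energy_le hk hk0 hx0 hxy
  set A := ‖h x‖ + ‖deriv h x‖ with hA
  have hA0 : 0 ≤ A := by positivity
  have h1 : ‖deriv h x + k * h x‖ ≤ (1 + ‖k‖) * A := by
    refine (norm_add_le _ _).trans ?_
    rw [norm_mul, hA]
    nlinarith [norm_nonneg (h x), norm_nonneg (deriv h x)]
  have h2 : ‖deriv h x - k * h x‖ ≤ (1 + ‖k‖) * A := by
    refine (norm_sub_le _ _).trans ?_
    rw [norm_mul, hA]
    nlinarith [norm_nonneg (h x), norm_nonneg (deriv h x)]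
  have hexp : Real.exp (2 * k.re * (y - x) + 2 * ‖m ^ 2 - 1 / 4‖ / ‖k‖ / x) ≤
      (D * Real.exp ((y - x) * k.re)) ^ 2 := by
    rw [hD, ← Real.exp_add, ← Real.exp_nat_mul, Real.exp_le_exp]
    have : ‖m ^ 2 - 1 / 4‖ / ‖k‖ / x ≤ ‖m ^ 2 - 1 / 4‖ / ‖k‖ / a := by gcongr
    push_cast
    have e : 2 * ‖m ^ 2 - 1 / 4‖ / ‖k‖ / x = 2 * (‖m ^ 2 - 1 / 4‖ / ‖k‖ / x) := by ring
    rw [e]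
    linarith
  have hsq : ∀ P R B F : ℝ, 0 ≤ P → 0 ≤ R → P ≤ B → R ≤ B → 0 ≤ F →
      (P ^ 2 + R ^ 2) * F ^ 2 ≤ 2 * (B * F) ^ 2 := by
    intro P R B F hP hR hPB hRB hF
    have e1 : P ^ 2 ≤ B ^ 2 := by gcongr
    have e2 : R ^ 2 ≤ B ^ 2 := by gcongr
    nlinarith [mul_le_mul_of_nonneg_right (add_le_add e1 e2) (sq_nonneg F)]
  have hfin : ‖deriv h y + k * h y‖ ^ 2 + ‖deriv h y - k * h y‖ ^ 2 ≤
      2 * ((1 + ‖k‖) * A * (D * Real.exp ((y - x) * k.re))) ^ 2 :=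
    (hE.trans (by gcongr)).trans
      (hsq _ _ _ _ (norm_nonneg _) (norm_nonneg _) h1 h2 (by positivity))
  set Z := (1 + ‖k‖) * A * (D * Real.exp ((y - x) * k.re)) with hZ
  have hZ0 : 0 ≤ Z := by positivity
  have b1 : ‖deriv h y + k * h y‖ ≤ 2 * Z := by
    refine abs_le_of_sq_le_sq' ?_ (by positivity) |>.2
    nlinarith [sq_nonneg ‖deriv h y - k * h y‖, sq_nonneg Z]
  have b2 : ‖deriv h y - k * h y‖ ≤ 2 * Z := by
    refine abs_le_of_sq_le_sq' ?_ (by positivity) |>.2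
    nlinarith [sq_nonneg ‖deriv h y + k * h y‖, sq_nonneg Z]
  have b3 : 2 * ‖k‖ * ‖h y‖ ≤ 2 * Z + 2 * Z := by
    calc 2 * ‖k‖ * ‖h y‖ = ‖(deriv h y + k * h y) - (deriv h y - k * h y)‖ := by
          rw [show (deriv h y + k * h y) - (deriv h y - k * h y) = 2 * k * h y by ring]
          simp
      _ ≤ _ := (norm_sub_le _ _).trans (add_le_add b1 b2)
  have b4 : 2 * ‖deriv h y‖ ≤ 2 * Z + 2 * Z := by
    calc 2 * ‖deriv h y‖ = ‖(deriv h y + k * h y) + (deriv h y - k * h y)‖ := by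
          rw [show (deriv h y + k * h y) + (deriv h y - k * h y) = 2 * deriv h y by ring]
          simp
      _ ≤ _ := (norm_add_le _ _).trans (add_le_add b1 b2)
  have e : 2 * D * (1 + ‖k‖) * (1 + 1 / ‖k‖) * Real.exp ((y - x) * k.re) * A =
      2 * Z + 2 * Z / ‖k‖ := by
    rw [hZ]
    field_simp
  rw [e]
  have hZk : 0 ≤ 2 * Z / ‖k‖ := by positivity
  have : ‖h y‖ ≤ 2 * Z / ‖k‖ := by
    rw [le_div_iff₀ hkpos]
    linarith
  constructor <;> linarith

/-! ### Existence of a fundamental pair -/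

/-- The kernel of `f ↦ -∫₁ˣ (x - y) V(y) f(y) dy`. -/
def initialKernel (V : ℝ → ℂ) (x y : ℝ) : ℂ :=
  -(((x - y : ℝ) : ℂ) * V y * ((Ioc 1 x).indicator 1 y - (Ioc x 1).indicator 1 y))

lemma initialKernel_eq_of_notMem {V : ℝ → ℂ} {x y : ℝ} (h : y ∉ uIoc 1 x) :
    initialKernel V x y = 0 := by
  rw [uIoc, mem_Ioc, not_and_or] at h
  have h1 : y ∉ Ioc 1 x := by
    rintro ⟨h1, h2⟩
    rcases h with h | h
    · exact h ((min_le_left _ _).trans_lt h1)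
    · exact h (h2.trans (le_max_right _ _))
  have h2 : y ∉ Ioc x 1 := by
    rintro ⟨h1, h2⟩
    rcases h with h | h
    · exact h ((min_le_right _ _).trans_lt h1)
    · exact h (h2.trans (le_max_left _ _))
  simp [initialKernel, h1, h2]

lemma norm_initialKernel_le {V : ℝ → ℂ} (x y : ℝ) :
    ‖initialKernel V x y‖ ≤ |x - y| * ‖V y‖ := by
  rw [initialKernel, norm_neg, norm_mul, norm_mul, Complex.norm_real, Real.norm_eq_abs]
  refine mul_le_of_le_one_right (by positivity) ?_
  by_cases h1 : y ∈ Ioc 1 x <;> by_cases h2 : y ∈ Ioc x 1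
  · simp [h1, h2]
  · simp [h1, h2]
  · simp [h1, h2]
  · simp [h1, h2]

lemma uIoc_subset_Ioi_zero {x : ℝ} (hx : 0 < x) : uIoc 1 x ⊆ Ioi 0 :=
  fun _ hy => (lt_min one_pos hx).trans hy.1

lemma uIcc_subset_Ioi_zero {x : ℝ} (hx : 0 < x) : uIcc 1 x ⊆ Ioi 0 :=
  fun _ hy => (lt_min one_pos hx).trans_le hy.1

/-- The difference of the two indicators encodes the orientation of `∫₁ˣ`, so that one kernel serves
both sides of the initial point. -/
lemma kernelOp_initialKernel {V f : ℝ → ℂ} {x : ℝ} (hx : 0 < x) :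
    kernelOp 0 (initialKernel V) f x = -∫ y in (1 : ℝ)..x, ((x - y : ℝ) : ℂ) * V y * f y := by
  have h0 : ∀ y, initialKernel V x y * f y =
      (uIoc 1 x).indicator (fun y => initialKernel V x y * f y) y := by
    intro y
    by_cases h : y ∈ uIoc 1 x
    · rw [indicator_of_mem h]
    · rw [indicator_of_notMem h, initialKernel_eq_of_notMem h, zero_mul]
  rw [kernelOp, integral_congr_ae (Eventually.of_forall h0),
    setIntegral_indicator measurableSet_uIoc,
    inter_eq_self_of_subset_right (uIoc_subset_Ioi_zero hx)]
  rcases le_total 1 x with h | h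
  · rw [uIoc_of_le h, intervalIntegral.integral_of_le h, ← integral_neg]
    refine setIntegral_congr_fun measurableSet_Ioc fun y hy => ?_
    have : y ∉ Ioc x 1 := fun hh => absurd hy.1 (not_lt.2 hh.2)
    simp [initialKernel, hy, this]
  · rw [uIoc_of_ge h, intervalIntegral.integral_of_ge h, neg_neg]
    refine setIntegral_congr_fun measurableSet_Ioc fun y hy => ?_
    have : y ∉ Ioc 1 x := fun hh => absurd hh.1 (not_lt.2 hy.2)
    simp [initialKernel, hy, this]

/-- The weight `exp (l (x + 1 / x))`. -/
def initialWeight (l x : ℝ) : ℝ :=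
  Real.exp (l * (x + x⁻¹))

lemma hasDerivAt_initialWeight (l : ℝ) {x : ℝ} (hx : 0 < x) :
    HasDerivAt (initialWeight l) (l * (1 - (x ^ 2)⁻¹) * initialWeight l x) x := by
  have h := (((hasDerivAt_id x).fun_add (hasDerivAt_inv hx.ne')).const_mul l).exp
  refine h.congr_deriv ?_
  simp only [initialWeight, id]
  ring

lemma hasDerivAt_deriv_initialWeight (l : ℝ) {x : ℝ} (hx : 0 < x) :
    HasDerivAt (fun x => l * (1 - (x ^ 2)⁻¹) * initialWeight l x)
      ((l ^ 2 * (1 - (x ^ 2)⁻¹) ^ 2 + 2 * l * (x ^ 3)⁻¹) * initialWeight l x) x := by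
  have h1 : HasDerivAt (fun x : ℝ => (x ^ 2)⁻¹) (-2 * (x ^ 3)⁻¹) x := by
    refine ((hasDerivAt_pow 2 x).fun_inv (by positivity)).congr_deriv ?_
    field_simp
    norm_num
    ring
  refine (((h1.const_sub 1).const_mul l).fun_mul (hasDerivAt_initialWeight l hx)).congr_deriv ?_
  ring

/-- For large `l`, the second derivative of the weight dominates `N (1 + x⁻²)` times the
weight. -/
lemma le_deriv_deriv_initialWeight {N l x : ℝ} (hN : 0 ≤ N) (hl : 20 * N + 1 ≤ l) (hx : 0 < x) :
    N * (1 + (x ^ 2)⁻¹) ≤ l ^ 2 * (1 - (x ^ 2)⁻¹) ^ 2 + 2 * l * (x ^ 3)⁻¹ := by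
  set t := x⁻¹ with ht
  have ht0 : 0 < t := by positivity
  rw [← inv_pow, ← inv_pow, ← ht]
  have hl0 : 0 < l := by linarith
  have hl2 : 20 * N ≤ l ^ 2 := by nlinarith
  -- For `t` far from `1` the term `l² (1 - t²)²` dominates; near `t = 1`, where it vanishes, `2 l
  -- t³` takes over. The constant `20` is dictated by the middle range, where `2 l t³ ≥ l / 4` must
  -- exceed `5 N`.
  rcases le_total t (1 / 2) with h | h
  · have e1 : t ^ 2 ≤ 1 / 4 := by nlinarith
    have e2 : 1 / 2 ≤ (1 - t ^ 2) ^ 2 := by nlinarith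
    have e3 : 0 ≤ 2 * l * t ^ 3 := by positivity
    nlinarith [mul_le_mul_of_nonneg_left e2 (sq_nonneg l), mul_le_mul_of_nonneg_left e1 hN]
  · rcases le_total t 2 with h' | h'
    · have e1 : 1 / 8 ≤ t ^ 3 := by
        calc (1 / 8 : ℝ) = (1 / 2) ^ 3 := by norm_num
          _ ≤ t ^ 3 := by gcongr
      have e2 : t ^ 2 ≤ 4 := by nlinarith
      have e3 : 0 ≤ l ^ 2 * (1 - t ^ 2) ^ 2 := by positivity
      nlinarith [mul_le_mul_of_nonneg_left e1 hl0.le, mul_le_mul_of_nonneg_left e2 hN]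
    · have e1 : 4 ≤ t ^ 2 := by nlinarith
      have e2 : 1 + t ^ 2 ≤ (1 - t ^ 2) ^ 2 := by nlinarith
      have e3 : 0 ≤ 2 * l * t ^ 3 := by positivity
      have e4 : N ≤ l ^ 2 := by linarith
      have e5 : N * (1 + t ^ 2) ≤ l ^ 2 * (1 - t ^ 2) ^ 2 := by gcongr
      linarith

/-- The weight `φ` satisfies `‖V‖ φ ≤ φ'' / 2` and has its critical point at the initial point `1`.
Taylor's formula therefore gives `∫₁ˣ (x - y) φ''(y) dy = φ(x) - φ(1)`. Using `2 N` in the condition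
on `l` produces the contraction factor `1 / 2`. -/
lemma setIntegral_uIoc_le_initialWeight {V : ℝ → ℂ} (hV : ContinuousOn V (Ioi 0)) {N l : ℝ}
    (hN : 0 ≤ N) (hVN : ∀ x, 0 < x → ‖V x‖ ≤ N * (1 + (x ^ 2)⁻¹)) (hl : 20 * (2 * N) + 1 ≤ l)
    {x : ℝ} (hx : 0 < x) :
    ∫ y in uIoc 1 x, |x - y| * ‖V y‖ * initialWeight l y ≤ 1 / 2 * initialWeight l x := by
  set φ := initialWeight l with hφ
  set φ2 : ℝ → ℝ := fun x => (l ^ 2 * (1 - (x ^ 2)⁻¹) ^ 2 + 2 * l * (x ^ 3)⁻¹) * φ x with hφ2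
  have hφpos : ∀ x, 0 < φ x := fun x => Real.exp_pos _
  have hφc : ContinuousOn φ (Ioi 0) :=
    fun y hy => (hasDerivAt_initialWeight l hy).continuousAt.continuousWithinAt
  have hφ2c : ContinuousOn φ2 (Ioi 0) := by
    refine ContinuousOn.mul ?_ hφc
    refine ContinuousOn.add (continuousOn_const.mul ((continuousOn_const.sub ?_).pow 2))
      (continuousOn_const.mul ?_)
    · exact (continuousOn_id.pow 2).inv₀ fun y hy => pow_ne_zero 2 (ne_of_gt hy)
    · exact (continuousOn_id.pow 3).inv₀ fun y hy => pow_ne_zero 3 (ne_of_gt hy)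
  have hpt : ∀ y, 0 < y → ‖V y‖ * φ y ≤ 1 / 2 * φ2 y := by
    intro y hy
    have h1 := le_deriv_deriv_initialWeight (N := 2 * N) (by positivity) hl hy
    have h2 := hVN y hy
    simp only [hφ2]
    rw [← mul_assoc]
    refine mul_le_mul_of_nonneg_right ?_ (hφpos y).le
    linarith
  have hFTC : ∫ y in (1 : ℝ)..x, (x - y) * φ2 y = φ x - φ 1 := by
    have hd : ∀ y ∈ uIcc 1 x, HasDerivAt
        (fun y => (x - y) * (l * (1 - (y ^ 2)⁻¹) * φ y) + φ y) ((x - y) * φ2 y) y := by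
      intro y hy
      have hy0 := uIcc_subset_Ioi_zero hx hy
      have := ((((hasDerivAt_id y).const_sub x).fun_mul
        (hasDerivAt_deriv_initialWeight l hy0)).fun_add (hasDerivAt_initialWeight l hy0))
      refine this.congr_deriv ?_
      simp only [hφ2, hφ, id]
      ring
    rw [intervalIntegral.integral_eq_sub_of_hasDerivAt hd]
    · norm_num
    · refine ContinuousOn.intervalIntegrable ?_
      exact ((continuousOn_const.sub continuousOn_id).mul hφ2c).mono (uIcc_subset_Ioi_zero hx)
  have hmono : ∫ y in uIoc 1 x, |x - y| * ‖V y‖ * φ y ≤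
      ∫ y in uIoc 1 x, 1 / 2 * (|x - y| * φ2 y) := by
    have hc1 : ContinuousOn (fun y => |x - y| * ‖V y‖ * φ y) (uIcc 1 x) :=
      ((((continuousOn_const.sub continuousOn_id).abs).mul hV.norm).mul hφc).mono
        (uIcc_subset_Ioi_zero hx)
    have hc2 : ContinuousOn (fun y => 1 / 2 * (|x - y| * φ2 y)) (uIcc 1 x) :=
      (continuousOn_const.mul (((continuousOn_const.sub continuousOn_id).abs).mul hφ2c)).mono
        (uIcc_subset_Ioi_zero hx)
    refine setIntegral_mono_on (hc1.integrableOn_compact isCompact_uIcc |>.mono_set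
      uIoc_subset_uIcc) (hc2.integrableOn_compact isCompact_uIcc |>.mono_set
      uIoc_subset_uIcc) measurableSet_uIoc fun y hy => ?_
    have := mul_le_mul_of_nonneg_left (hpt y (uIoc_subset_Ioi_zero hx hy)) (abs_nonneg (x - y))
    linarith
  refine hmono.trans ?_
  rw [integral_const_mul]
  have : ∫ y in uIoc 1 x, |x - y| * φ2 y = φ x - φ 1 := by
    rw [← hFTC]
    rcases le_total 1 x with h | h
    · rw [uIoc_of_le h, intervalIntegral.integral_of_le h]
      refine setIntegral_congr_fun measurableSet_Ioc fun y hy => ?_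
      rw [abs_of_nonneg (sub_nonneg.2 hy.2)]
    · rw [uIoc_of_ge h, intervalIntegral.integral_of_ge h, ← integral_neg]
      refine setIntegral_congr_fun measurableSet_Ioc fun y hy => ?_
      rw [abs_of_nonpos (sub_nonpos.2 hy.1.le)]
      ring
  rw [this]
  linarith [hφpos 1]

lemma oneAddInvertible_initialKernel {V : ℝ → ℂ} (hV : ContinuousOn V (Ioi 0)) {N l : ℝ}
    (hN : 0 ≤ N) (hVN : ∀ x, 0 < x → ‖V x‖ ≤ N * (1 + (x ^ 2)⁻¹)) (hl : 20 * (2 * N) + 1 ≤ l) :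
    OneAddInvertible 0 (initialWeight l) (initialKernel V) := by
  have hφpos : ∀ x, 0 < initialWeight l x := fun x => Real.exp_pos _
  have hφm : Measurable (initialWeight l) := by
    unfold initialWeight
    fun_prop
  have hφc : ContinuousOn (initialWeight l) (Ioi 0) :=
    fun y hy => (hasDerivAt_initialWeight l hy).continuousAt.continuousWithinAt
  have hVm : AEStronglyMeasurable V (volume.restrict (Ioi 0)) :=
    hV.aestronglyMeasurable measurableSet_Ioi
  have hset1 : MeasurableSet {p : ℝ × ℝ | p.2 ∈ Ioc 1 p.1} :=
    (measurableSet_lt measurable_const measurable_snd).inter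
      (measurableSet_le measurable_snd measurable_fst)
  have hset2 : MeasurableSet {p : ℝ × ℝ | p.2 ∈ Ioc p.1 1} :=
    (measurableSet_lt measurable_fst measurable_snd).inter
      (measurableSet_le measurable_snd measurable_const)
  have hind : Measurable (fun p : ℝ × ℝ => ((Ioc 1 p.1).indicator 1 p.2 : ℂ) -
      (Ioc p.1 1).indicator 1 p.2) := by
    have h1 : Measurable ({p : ℝ × ℝ | p.2 ∈ Ioc 1 p.1}.indicator (1 : ℝ × ℝ → ℂ)) :=
      measurable_one.indicator hset1
    have h2 : Measurable ({p : ℝ × ℝ | p.2 ∈ Ioc p.1 1}.indicator (1 : ℝ × ℝ → ℂ)) :=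
      measurable_one.indicator hset2
    exact h1.sub h2
  have hK : AEStronglyMeasurable (fun p : ℝ × ℝ => initialKernel V p.1 p.2)
      ((volume.restrict (Ioi 0)).prod (volume.restrict (Ioi 0))) := by
    refine AEStronglyMeasurable.neg (AEStronglyMeasurable.mul (AEStronglyMeasurable.mul ?_
      (hVm.comp_snd (μ := volume.restrict (Ioi 0)))) hind.aestronglyMeasurable)
    exact (by fun_prop : Measurable fun p : ℝ × ℝ => ((p.1 - p.2 : ℝ) : ℂ)).aestronglyMeasurable
  have hKx : ∀ x, AEStronglyMeasurable (initialKernel V x) (volume.restrict (Ioi 0)) := by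
    intro x
    refine AEStronglyMeasurable.neg (AEStronglyMeasurable.mul (AEStronglyMeasurable.mul ?_
      hVm) ?_)
    · exact (by fun_prop : Measurable fun y : ℝ => ((x - y : ℝ) : ℂ)).aestronglyMeasurable
    · exact (hind.comp (measurable_prodMk_left (x := x))).aestronglyMeasurable
  have hle : ∀ x y, ‖initialKernel V x y‖ * initialWeight l y ≤
      (uIoc 1 x).indicator (fun y => |x - y| * ‖V y‖ * initialWeight l y) y := by
    intro x y
    by_cases h : y ∈ uIoc 1 x
    · rw [indicator_of_mem h]
      exact mul_le_mul_of_nonneg_right (norm_initialKernel_le x y) (hφpos y).le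
    · rw [indicator_of_notMem h, initialKernel_eq_of_notMem h, norm_zero, zero_mul]
  have hdom : ∀ x, 0 < x → IntegrableOn
      ((uIoc 1 x).indicator (fun y => |x - y| * ‖V y‖ * initialWeight l y)) (Ioi 0) := by
    intro x hx
    refine Integrable.integrableOn ?_
    rw [integrable_indicator_iff measurableSet_uIoc]
    have hc1 : ContinuousOn (fun y => |x - y| * ‖V y‖ * initialWeight l y) (uIcc 1 x) :=
      ((((continuousOn_const.sub continuousOn_id).abs).mul hV.norm).mul hφc).mono
        (uIcc_subset_Ioi_zero hx)
    exact (hc1.integrableOn_compact isCompact_uIcc).mono_set uIoc_subset_uIcc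
  have hint : ∀ x, 0 < x →
      IntegrableOn (fun y => ‖initialKernel V x y‖ * initialWeight l y) (Ioi 0) := by
    intro x hx
    refine Integrable.mono' (hdom x hx) ((hKx x).norm.mul hφm.aestronglyMeasurable)
      (Eventually.of_forall fun y => ?_)
    rw [Real.norm_of_nonneg (mul_nonneg (norm_nonneg _) (hφpos y).le)]
    exact hle x y
  refine oneAddInvertible_of_schur hφm (fun x _ => hφpos x) hK (fun x _ => hKx x) hint
    (θ := 1 / 2) (by norm_num) (by norm_num) fun x hx => ?_
  refine (integral_mono (hint x hx) (hdom x hx) (hle x)).trans ?_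
  rw [setIntegral_indicator measurableSet_uIoc,
    inter_eq_self_of_subset_right (uIoc_subset_Ioi_zero hx)]
  exact setIntegral_uIoc_le_initialWeight hV hN hVN hl hx

lemma norm_besselCoeff_le (m k : ℂ) {x : ℝ} (hx : 0 < x) :
    ‖besselCoeff m k x‖ ≤ (‖k‖ ^ 2 + ‖m ^ 2 - 1 / 4‖) * (1 + (x ^ 2)⁻¹) := by
  have h : ‖besselCoeff m k x‖ ≤ ‖k‖ ^ 2 + ‖m ^ 2 - 1 / 4‖ * (x ^ 2)⁻¹ := by
    refine (norm_add_le _ _).trans (le_of_eq ?_)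
    rw [norm_pow, norm_div, norm_pow, Complex.norm_real, Real.norm_of_nonneg hx.le, div_eq_mul_inv]
  have : 0 ≤ (x ^ 2)⁻¹ := by positivity
  nlinarith [sq_nonneg ‖k‖, norm_nonneg (m ^ 2 - 1 / 4), mul_nonneg (sq_nonneg ‖k‖) this]

/-- The initial value problem of the unperturbed equation at `x = 1`. -/
lemma exists_isClassical_initial (m k α β : ℂ) :
    ∃ h : ℝ → ℂ, IsClassical m k h ∧ h 1 = α ∧ deriv h 1 = β := by
  set V := besselCoeff m k with hVdef
  have hV : ContinuousOn V (Ioi 0) := continuousOn_besselCoeff m k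
  set N : ℝ := ‖k‖ ^ 2 + ‖m ^ 2 - 1 / 4‖ with hN
  have hN0 : 0 ≤ N := by positivity
  set l : ℝ := 20 * (2 * N) + 1 with hl
  have hl1 : 1 ≤ l := by rw [hl]; linarith
  have hinv := oneAddInvertible_initialKernel hV hN0 (fun x hx => norm_besselCoeff_le m k hx)
    (le_refl l)
  have hφm : Measurable (initialWeight l) := by
    unfold initialWeight
    fun_prop
  have hφpos : ∀ x, 0 < initialWeight l x := fun x => Real.exp_pos _
  -- The initial value problem is equivalent to `v = v₀ + ∫₁ˣ (x - y) V(y) v(y) dy`, with `v₀` the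
  -- affine function carrying the data.
  set v₀ : ℝ → ℂ := fun x => α + β * ((x - 1 : ℝ) : ℂ) with hv₀
  have hv₀mem : MemWeighted 0 (initialWeight l) v₀ := by
    refine (memWeighted_of_ae_bound (M := ‖α‖ + ‖β‖) hφm (fun x _ => hφpos x) ?_ ?_).1
    · exact (by fun_prop : Continuous v₀).aestronglyMeasurable
    · filter_upwards [ae_restrict_mem measurableSet_Ioi] with x hx
      have hx0 : 0 < x := hx
      have h1 : x + 1 ≤ initialWeight l x := by
        refine (Real.add_one_le_exp x).trans (Real.exp_le_exp.2 ?_)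
        have : 0 < x⁻¹ := by positivity
        nlinarith
      have h2 : |x - 1| ≤ initialWeight l x := by
        rw [abs_le]
        constructor <;> linarith
      calc ‖v₀ x‖ ≤ ‖α‖ + ‖β‖ * |x - 1| := by
            refine (norm_add_le _ _).trans (le_of_eq ?_)
            rw [norm_mul, Complex.norm_real, Real.norm_eq_abs]
        _ ≤ ‖α‖ * initialWeight l x + ‖β‖ * initialWeight l x := by
            gcongr
            exact le_mul_of_one_le_right (norm_nonneg _) (by linarith)
        _ = _ := by ring
  obtain ⟨C, hC⟩ := hinv.surjective
  obtain ⟨g, hg, -, hgeq⟩ := hC v₀ hv₀mem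
  have hgm := hg.aestronglyMeasurable hφm (fun x _ => hφpos x)
  have hgb := hg.ae_norm_le (fun x _ => hφpos x)
  have hφc : ContinuousOn (initialWeight l) (Ioi 0) :=
    fun y hy => (hasDerivAt_initialWeight l hy).continuousAt.continuousWithinAt
  have hgint : ∀ a b : ℝ, 0 < a → IntegrableOn g (Icc a b) := by
    intro a b ha
    have hsub := Icc_subset_Ioi_zero (b := b) ha
    refine Integrable.mono' (g := fun y => (weightedNorm 0 (initialWeight l) g).toReal *
      initialWeight l y) ?_ (hgm.mono_set hsub) (ae_restrict_of_ae_restrict_of_subset hsub hgb)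
    exact ((continuousOn_const.mul hφc).mono hsub).integrableOn_compact isCompact_Icc
  -- The solution `g` is only determined almost everywhere. The right-hand side of the equation
  -- depends only on its class and picks a representative that satisfies the equation at every
  -- point.
  set v : ℝ → ℂ := fun x => v₀ x - kernelOp 0 (initialKernel V) g x with hv
  have hgv : g =ᵐ[volume.restrict (Ioi 0)] v := by
    filter_upwards [hgeq] with x hx
    simp only [hv]
    rw [← hx]
    ring
  have hvint : ∀ a b : ℝ, 0 < a → IntegrableOn v (Icc a b) := fun a b ha =>
    (hgint a b ha).congr_fun_ae
      (ae_restrict_of_ae_restrict_of_subset (Icc_subset_Ioi_zero ha) hgv)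
  have hVvint : ∀ W : ℝ → ℂ, ContinuousOn W (Ioi 0) → ∀ a b : ℝ, 0 < a → 0 < b →
      IntervalIntegrable (fun y => W y * v y) volume a b := by
    intro W hW a b ha hb
    have hpos : 0 < min a b := lt_min ha hb
    refine IntegrableOn.intervalIntegrable ?_
    exact (hvint _ _ hpos).continuousOn_mul (hW.mono (Icc_subset_Ioi_zero hpos)) isCompact_Icc
  set I : ℝ → ℂ := fun x => ∫ y in (1 : ℝ)..x, V y * v y with hI
  set J : ℝ → ℂ := fun x => ∫ y in (1 : ℝ)..x, ((y : ℂ) * V y) * v y with hJ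
  have hyV : ContinuousOn (fun y : ℝ => (y : ℂ) * V y) (Ioi 0) :=
    (by fun_prop : Continuous fun y : ℝ => (y : ℂ)).continuousOn.mul hV
  -- Splitting `x - y` leaves `x` only in the limits of integration and in a factor outside.
  -- Regularity then bootstraps: primitives of integrable functions make `v` continuous, and
  -- primitives of continuous functions make it `C¹`.
  have hveq : ∀ x, 0 < x → v x = v₀ x + (x : ℂ) * I x - J x := by
    intro x hx
    have h1 : kernelOp 0 (initialKernel V) g x = kernelOp 0 (initialKernel V) v x :=
      kernelOp_congr_ae hgv x
    have h2 : v x = v₀ x - kernelOp 0 (initialKernel V) g x := rfl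
    rw [h2, h1, kernelOp_initialKernel hx, sub_neg_eq_add, add_sub_assoc]
    congr 1
    simp only [hI, hJ]
    rw [← intervalIntegral.integral_const_mul, ← intervalIntegral.integral_sub
      ((hVvint V hV 1 x one_pos hx).const_mul _) (hVvint _ hyV 1 x one_pos hx)]
    refine intervalIntegral.integral_congr fun y _ => ?_
    push_cast
    ring
  have hIcont : ∀ W : ℝ → ℂ, ContinuousOn W (Ioi 0) →
      ContinuousOn (fun x => ∫ y in (1 : ℝ)..x, W y * v y) (Ioi 0) := by
    intro W hW x hx
    have hx0 : 0 < x := hx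
    set a := min 1 (x / 2) with ha
    have ha0 : 0 < a := lt_min one_pos (by linarith)
    have h : ContinuousOn (fun x => ∫ y in (1 : ℝ)..x, W y * v y) (uIcc a (x + 1)) := by
      refine intervalIntegral.continuousOn_primitive_interval' (hVvint W hW a (x + 1) ha0
        (by linarith)) ?_
      rw [uIcc_of_le ((min_le_left _ _).trans (by linarith))]
      exact ⟨min_le_left _ _, by linarith⟩
    rw [uIcc_of_le ((min_le_left _ _).trans (by linarith))] at h
    exact (h.continuousAt (Icc_mem_nhds ((min_le_right _ _).trans_lt (by linarith))
      (by linarith))).continuousWithinAt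
  have hvc : ContinuousOn v (Ioi 0) := by
    refine ContinuousOn.congr ?_ hveq
    exact ((by fun_prop : Continuous v₀).continuousOn.add
      ((by fun_prop : Continuous fun y : ℝ => (y : ℂ)).continuousOn.mul (hIcont V hV))).sub
      (hIcont _ hyV)
  have hId : ∀ W : ℝ → ℂ, ContinuousOn W (Ioi 0) → ∀ x, 0 < x →
      HasDerivAt (fun x => ∫ y in (1 : ℝ)..x, W y * v y) (W x * v x) x := by
    intro W hW x hx
    exact intervalIntegral.integral_hasDerivAt_right (hVvint W hW 1 x one_pos hx)
      ((hW.mul hvc).stronglyMeasurableAtFilter isOpen_Ioi x hx)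
      ((hW.mul hvc).continuousAt (Ioi_mem_nhds hx))
  have hd1 : ∀ x, 0 < x → HasDerivAt v (β + I x) x := by
    intro x hx
    have hx1 : HasDerivAt (fun x : ℝ => (x : ℂ)) 1 x := Complex.ofRealCLM.hasDerivAt
    have h0 : HasDerivAt v₀ β x := by
      have := ((hx1.sub_const 1).const_mul β).const_add α
      refine (this.congr_deriv (mul_one β)).congr_of_eventuallyEq
        (Eventually.of_forall fun y => ?_)
      simp [hv₀]
    have h1 := (h0.fun_add (hx1.fun_mul (hId V hV x hx))).fun_sub (hId _ hyV x hx)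
    refine (h1.congr_deriv ?_).congr_of_eventuallyEq ?_
    · simp only [hI]
      ring
    · filter_upwards [Ioi_mem_nhds hx] with y hy using hveq y hy
  have hcl : IsClassical m k v := IsClassical.of_hasDerivAt hd1 fun x hx =>
    (hId V hV x hx).const_add β
  refine ⟨v, hcl, ?_, ?_⟩
  · rw [hveq 1 one_pos]
    simp [hv₀, hI, hJ]
  · rw [(hd1 1 one_pos).deriv]
    simp [hI]

lemma exists_isFundamentalPair (m k : ℂ) : ∃ h, IsFundamentalPair m k h := by
  obtain ⟨h₁, c₁, e₁, d₁⟩ := exists_isClassical_initial m k 1 0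
  obtain ⟨h₂, c₂, e₂, d₂⟩ := exists_isClassical_initial m k 0 1
  refine ⟨(h₁, h₂), c₁.isSolution, c₂.isSolution, ?_⟩
  simp [wronskian, e₁, e₂, d₁, d₂]

lemma isFundamentalPair_fundamentalPair (m k : ℂ) :
    IsFundamentalPair m k (fundamentalPair m k) :=
  Classical.epsilon_spec (exists_isFundamentalPair m k)

lemma isClassical_fundamentalPair_fst (m k : ℂ) : IsClassical m k (fundamentalPair m k).1 :=
  (isFundamentalPair_fundamentalPair m k).1.isClassical

lemma isClassical_fundamentalPair_snd (m k : ℂ) : IsClassical m k (fundamentalPair m k).2 :=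
  (isFundamentalPair_fundamentalPair m k).2.1.isClassical

lemma wronskian_fundamentalPair_ne_zero (m k : ℂ) :
    wronskian (fundamentalPair m k).1 (fundamentalPair m k).2 1 ≠ 0 :=
  (isFundamentalPair_fundamentalPair m k).2.2

lemma wronskian_fundamentalPair (m k : ℂ) {x : ℝ} (hx : 0 < x) :
    (fundamentalPair m k).1 x * deriv (fundamentalPair m k).2 x -
      deriv (fundamentalPair m k).1 x * (fundamentalPair m k).2 x =
    wronskian (fundamentalPair m k).1 (fundamentalPair m k).2 1 :=
  (isClassical_fundamentalPair_fst m k).wronskian_eq (isClassical_fundamentalPair_snd m k) hx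
    one_pos

/-! ### Bounds on the kernel of the canonical bisolution -/

/-- The derivative of the canonical bisolution in its first variable. -/
def canonicalBisolutionDeriv (m k : ℂ) (x y : ℝ) : ℂ :=
  (deriv (fundamentalPair m k).1 x * (fundamentalPair m k).2 y -
      deriv (fundamentalPair m k).2 x * (fundamentalPair m k).1 y) /
    wronskian (fundamentalPair m k).1 (fundamentalPair m k).2 1

/-- In the variable `y` both kernels are free solutions. Their data at `y = x` are `(0, 1)` for the
bisolution and `(-1, 0)` for its `x`-derivative, so the growth bound from `x` to `y` applies with a
constant independent of `x ≥ a`. -/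
lemma exists_bisolution_bound (m : ℂ) {k : ℂ} (hk : 0 ≤ k.re) (hk0 : k ≠ 0) {a : ℝ}
    (ha : 0 < a) : ∃ C : ℝ, 0 ≤ C ∧ ∀ x y : ℝ, a ≤ x → x ≤ y →
      ‖canonicalBisolution m k x y‖ ≤ C * Real.exp ((y - x) * k.re) ∧
      ‖canonicalBisolutionDeriv m k x y‖ ≤ C * Real.exp ((y - x) * k.re) := by
  obtain ⟨C, hC0, hC⟩ := exists_growth_bound m hk hk0 ha
  refine ⟨C, hC0, fun x y hax hxy => ?_⟩
  have hx : 0 < x := ha.trans_le hax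
  set W := wronskian (fundamentalPair m k).1 (fundamentalPair m k).2 1 with hW
  have hW0 : W ≠ 0 := wronskian_fundamentalPair_ne_zero m k
  have hWx := wronskian_fundamentalPair m k hx
  rw [← hW] at hWx
  have c₁ := isClassical_fundamentalPair_fst m k
  have c₂ := isClassical_fundamentalPair_snd m k
  set h₁ := (fundamentalPair m k).1 with hh₁
  set h₂ := (fundamentalPair m k).2 with hh₂
  have hder : ∀ α β : ℂ, deriv (fun y => α * h₂ y + β * h₁ y) x =
      α * deriv h₂ x + β * deriv h₁ x := fun α β =>
    (((c₂ x hx).1.const_mul α).fun_add ((c₁ x hx).1.const_mul β)).deriv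
  constructor
  · have hcl := c₂.linear_combination c₁ (h₁ x / W) (-h₂ x / W)
    have h := (hC _ hcl x y hax hxy).1
    rw [hder, show h₁ x / W * h₂ x + -h₂ x / W * h₁ x = 0 by ring,
      show h₁ x / W * deriv h₂ x + -h₂ x / W * deriv h₁ x = 1 by
        rw [← div_self hW0]; nth_rewrite 3 [← hWx]; ring] at h
    rw [canonicalBisolution, ← hW, ← hh₁, ← hh₂]
    rw [show (h₁ x * h₂ y - h₂ x * h₁ y) / W = h₁ x / W * h₂ y + -h₂ x / W * h₁ y by ring]
    simpa using h
  · have hcl := c₂.linear_combination c₁ (deriv h₁ x / W) (-deriv h₂ x / W)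
    have h := (hC _ hcl x y hax hxy).1
    rw [hder, show deriv h₁ x / W * deriv h₂ x + -deriv h₂ x / W * deriv h₁ x = 0 by ring,
      show deriv h₁ x / W * h₂ x + -deriv h₂ x / W * h₁ x = -1 by
        rw [← div_self hW0]; nth_rewrite 3 [← hWx]; ring] at h
    rw [canonicalBisolutionDeriv, ← hW, ← hh₁, ← hh₂]
    rw [show (deriv h₁ x * h₂ y - deriv h₂ x * h₁ y) / W =
      deriv h₁ x / W * h₂ y + -deriv h₂ x / W * h₁ y by ring]
    simpa using h

/-! ### Holomorphic parametric integrals -/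

/-- An integral of a dominated family of holomorphic functions is holomorphic. -/
lemma hasDerivAt_integral_of_holomorphic {α : Type*} [MeasurableSpace α] {μ : Measure α}
    {U : Set ℂ} (hU : IsOpen U) {f : ℂ → α → ℂ} {b : α → ℝ}
    (hm : ∀ z ∈ U, AEStronglyMeasurable (f z) μ) (hb : Integrable b μ)
    (hle : ∀ z ∈ U, ∀ v, ‖f z v‖ ≤ b v)
    (hd : ∀ v, DifferentiableOn ℂ (fun z => f z v) U) {z : ℂ} (hz : z ∈ U) :
    HasDerivAt (fun z => ∫ v, f z v ∂μ) (∫ v, deriv (fun z => f z v) z ∂μ) z := by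
  obtain ⟨r, hr, hball⟩ := Metric.isOpen_iff.1 hU z hz
  -- The derivative is a pointwise limit of difference quotients along a sequence of increments,
  -- which are measurable in the parameter.
  have hmeas : AEStronglyMeasurable (fun v => deriv (fun z => f z v) z) μ := by
    have hu : Tendsto (fun n : ℕ => ((r / 2 * (1 / ((n : ℝ) + 1)) : ℝ) : ℂ)) atTop (𝓝[≠] 0) := by
      refine tendsto_nhdsWithin_iff.2 ⟨?_, Eventually.of_forall fun n => ?_⟩
      · have h := (tendsto_one_div_add_atTop_nhds_zero_nat (𝕜 := ℝ)).const_mul (r / 2)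
        rw [mul_zero] at h
        have := (Complex.continuous_ofReal.tendsto 0).comp h
        simpa [Function.comp_def] using this
      · have : (0 : ℝ) < r / 2 * (1 / ((n : ℝ) + 1)) := by positivity
        rw [mem_compl_iff, mem_singleton_iff, Complex.ofReal_eq_zero]
        exact this.ne'
    have hmem : ∀ n : ℕ, z + ((r / 2 * (1 / ((n : ℝ) + 1)) : ℝ) : ℂ) ∈ U := by
      intro n
      apply hball
      rw [Metric.mem_ball, dist_eq_norm, add_sub_cancel_left, Complex.norm_real,
        Real.norm_of_nonneg (by positivity)]
      have : (1 : ℝ) / ((n : ℝ) + 1) ≤ 1 := by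
        rw [div_le_one (by positivity)]
        linarith [(Nat.cast_nonneg n : (0 : ℝ) ≤ n)]
      nlinarith
    refine aestronglyMeasurable_of_tendsto_ae atTop
      (f := fun (n : ℕ) v => ((r / 2 * (1 / ((n : ℝ) + 1)) : ℝ) : ℂ)⁻¹ •
        (f (z + ((r / 2 * (1 / ((n : ℝ) + 1)) : ℝ) : ℂ)) v - f z v))
      (fun n => ((hm _ (hmem n)).sub (hm z hz)).const_smul
        (((r / 2 * (1 / ((n : ℝ) + 1)) : ℝ) : ℂ)⁻¹)) ?_
    refine Eventually.of_forall fun v => ?_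
    have h := ((hd v).differentiableAt (hU.mem_nhds hz)).hasDerivAt
    exact (hasDerivAt_iff_tendsto_slope_zero.1 h).comp hu
  refine (hasDerivAt_integral_of_dominated_loc_of_deriv_le
    (F := f) (F' := fun z v => deriv (fun z => f z v) z) (bound := fun v => b v / (r / 2))
    (Metric.ball_mem_nhds z (half_pos hr)) ?_ ?_ hmeas ?_ (hb.div_const _) ?_).2
  · filter_upwards [hU.mem_nhds hz] with w hw using hm w hw
  · exact Integrable.mono' hb (hm z hz) (Eventually.of_forall (hle z hz))
  · refine Eventually.of_forall fun v w hw => ?_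
    have hsub : Metric.closedBall w (r / 2) ⊆ U := by
      intro y hy
      apply hball
      rw [Metric.mem_ball] at hw ⊢
      rw [Metric.mem_closedBall] at hy
      linarith [dist_triangle y w z]
    -- Cauchy's estimate on circles of radius `r / 2` makes the bound on the functions a bound on
    -- their derivatives, so no separate domination of the derivative is needed.
    refine Complex.norm_deriv_le_of_forall_mem_sphere_norm_le (half_pos hr) ?_ fun y hy =>
      hle y (hsub (Metric.sphere_subset_closedBall hy)) v
    refine ((hd v).mono ?_).diffContOnCl
    exact Metric.closure_ball_subset_closedBall.trans hsub
  · refine Eventually.of_forall fun v w hw => ?_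
    have hwU : w ∈ U := hball (Metric.ball_subset_ball (by linarith) hw)
    exact ((hd v).differentiableAt (hU.mem_nhds hwU)).hasDerivAt

/-! ### The integral formula of the Macdonald function -/

/-- The integrand of `2 K_m(z) = ∫ exp (-z cosh t - m t) dt`. -/
def macdonaldIntegrand (m z : ℂ) (t : ℝ) : ℂ :=
  Complex.exp (-z * (Real.cosh t : ℂ) - m * t)

/-- Substitution `s = exp t`. -/
lemma macdonaldIntegral_eq (m z : ℂ) : macdonaldIntegral m z =
    z ^ (1 / 2 : ℂ) / (Real.sqrt (2 * Real.pi) : ℂ) * ∫ t : ℝ, macdonaldIntegrand m z t := by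
  rw [macdonaldIntegral]
  congr 1
  have h := integral_image_eq_integral_abs_deriv_smul (s := univ) (f := Real.exp)
    MeasurableSet.univ (fun x _ => (Real.hasDerivAt_exp x).hasDerivWithinAt)
    (Real.exp_injective.injOn)
    (fun s : ℝ => Complex.exp (-(z / 2) * ((s : ℂ) + (s : ℂ)⁻¹)) * (s : ℂ) ^ (-m - 1))
  rw [image_univ, Real.range_exp, setIntegral_univ] at h
  rw [h]
  refine integral_congr_ae (Eventually.of_forall fun t => ?_)
  simp only
  have h0 : ((Real.exp t : ℝ) : ℂ) ≠ 0 := by exact_mod_cast (Real.exp_pos t).ne'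
  rw [abs_of_pos (Real.exp_pos t), Complex.real_smul, Complex.cpow_def_of_ne_zero h0,
    ← Complex.ofReal_log (Real.exp_pos t).le, Real.log_exp, Complex.ofReal_exp, ← Complex.exp_neg,
    ← Complex.exp_add, ← Complex.exp_add, macdonaldIntegrand, Complex.ofReal_cosh, Complex.cosh]
  congr 1
  ring

/-- Reflection `t ↦ -t`, as `cosh` is even. -/
lemma macdonaldIntegral_neg (m : ℂ) : macdonaldIntegral (-m) = macdonaldIntegral m := by
  funext z
  rw [macdonaldIntegral_eq, macdonaldIntegral_eq]
  congr 1
  rw [← integral_neg_eq_self]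
  refine integral_congr_ae (Eventually.of_forall fun t => ?_)
  simp [macdonaldIntegrand]

lemma freeJost_neg (m : ℂ) : freeJost (-m) = freeJost m := by
  unfold freeJost macdonald
  rw [macdonaldIntegral_neg]

lemma sq_div_four_le_cosh (t : ℝ) : t ^ 2 / 4 ≤ Real.cosh t := by
  rw [← Real.cosh_abs, Real.cosh_eq, ← sq_abs]
  have := Real.quadratic_le_exp_of_nonneg (abs_nonneg t)
  have := Real.exp_pos (-|t|)
  linarith [abs_nonneg t]

lemma cosh_le_exp_abs (t : ℝ) : Real.cosh t ≤ Real.exp |t| := by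
  rw [← Real.cosh_abs, Real.cosh_eq]
  have : Real.exp (-|t|) ≤ Real.exp |t| := Real.exp_le_exp.2 (by linarith [abs_nonneg t])
  linarith

/-- Completing the square: `M |t| ≤ M² / (2d) + d t² / 2` leaves half of the Gaussian. -/
lemma integrable_exp_neg_sq_add_abs {d M : ℝ} (hd : 0 < d) :
    Integrable fun t : ℝ => Real.exp (-d * t ^ 2 + M * |t|) := by
  have h := (integrable_exp_neg_mul_sq (half_pos hd)).const_mul (Real.exp (M ^ 2 / (2 * d)))
  refine Integrable.mono' h (by fun_prop : Continuous fun t : ℝ =>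
    Real.exp (-d * t ^ 2 + M * |t|)).aestronglyMeasurable (Eventually.of_forall fun t => ?_)
  rw [Real.norm_of_nonneg (Real.exp_pos _).le, ← Real.exp_add, Real.exp_le_exp]
  have e : M ^ 2 / (2 * d) = (M / d) ^ 2 * (d / 2) := by field_simp
  have e2 : M = (M / d) * d := by field_simp
  rw [e]
  nth_rewrite 1 [e2]
  rw [← sq_abs t]
  nlinarith [sq_nonneg (M / d - |t|)]

lemma integrable_exp_neg_cosh {d : ℝ} (hd : 0 < d) (M : ℝ) :
    Integrable fun t : ℝ => Real.exp (-d * Real.cosh t + M * |t|) := by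
  have h := integrable_exp_neg_sq_add_abs (M := M) (show 0 < d / 4 by positivity)
  refine Integrable.mono' h (by fun_prop : Continuous fun t : ℝ =>
    Real.exp (-d * Real.cosh t + M * |t|)).aestronglyMeasurable (Eventually.of_forall fun t => ?_)
  rw [Real.norm_of_nonneg (Real.exp_pos _).le, Real.exp_le_exp]
  nlinarith [sq_div_four_le_cosh t]

lemma continuous_macdonaldIntegrand (m z : ℂ) : Continuous (macdonaldIntegrand m z) := by
  unfold macdonaldIntegrand
  fun_prop

lemma norm_macdonaldIntegrand_le {m z : ℂ} {d : ℝ} (hz : d ≤ z.re) (t : ℝ) :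
    ‖macdonaldIntegrand m z t‖ ≤ Real.exp (-d * Real.cosh t + ‖m‖ * |t|) := by
  rw [macdonaldIntegrand, Complex.norm_exp, Real.exp_le_exp]
  have h1 : (-z * (Real.cosh t : ℂ) - m * t).re = -z.re * Real.cosh t - m.re * t := by
    simp only [Complex.sub_re, Complex.mul_re, Complex.neg_re, Complex.ofReal_re,
      Complex.ofReal_im, mul_zero, sub_zero]
  rw [h1]
  have h2 : -(m.re * t) ≤ ‖m‖ * |t| := by
    calc -(m.re * t) ≤ |m.re * t| := neg_le_abs _
      _ = |m.re| * |t| := abs_mul _ _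
      _ ≤ ‖m‖ * |t| := by gcongr; exact Complex.abs_re_le_norm m
  nlinarith [Real.cosh_pos t]

lemma norm_cosh_pow_mul_macdonaldIntegrand_le {m z : ℂ} {d : ℝ} (hz : d ≤ z.re) (n : ℕ) (t : ℝ) :
    ‖(Real.cosh t : ℂ) ^ n * macdonaldIntegrand m z t‖ ≤
      Real.exp (-d * Real.cosh t + (n + ‖m‖) * |t|) := by
  rw [norm_mul, norm_pow, Complex.norm_real, Real.norm_of_nonneg (Real.cosh_pos t).le]
  calc _ ≤ Real.exp |t| ^ n * Real.exp (-d * Real.cosh t + ‖m‖ * |t|) := by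
        gcongr
        · exact cosh_le_exp_abs t
        · exact norm_macdonaldIntegrand_le hz t
    _ = _ := by
        rw [← Real.exp_nat_mul, ← Real.exp_add]
        congr 1
        ring

lemma integrable_cosh_pow_mul_macdonaldIntegrand (m : ℂ) {z : ℂ} (hz : 0 < z.re) (n : ℕ) :
    Integrable fun t : ℝ => (Real.cosh t : ℂ) ^ n * macdonaldIntegrand m z t := by
  refine Integrable.mono' (integrable_exp_neg_cosh hz (n + ‖m‖)) ?_
    (Eventually.of_forall fun t => norm_cosh_pow_mul_macdonaldIntegrand_le le_rfl n t)
  have := continuous_macdonaldIntegrand m z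
  exact (by fun_prop : Continuous fun t : ℝ =>
    (Real.cosh t : ℂ) ^ n * macdonaldIntegrand m z t).aestronglyMeasurable

/-- The integrals `∫ cosh^n t exp (-z cosh t - m t) dt`. -/
def macdonaldMoment (m : ℂ) (n : ℕ) (z : ℂ) : ℂ :=
  ∫ t : ℝ, (Real.cosh t : ℂ) ^ n * macdonaldIntegrand m z t

lemma hasDerivAt_macdonaldMoment (m : ℂ) (n : ℕ) {z : ℂ} (hz : 0 < z.re) :
    HasDerivAt (macdonaldMoment m n) (-macdonaldMoment m (n + 1) z) z := by
  have hder : ∀ (t : ℝ) (w : ℂ), HasDerivAt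
      (fun w => (Real.cosh t : ℂ) ^ n * macdonaldIntegrand m w t)
      (-((Real.cosh t : ℂ) ^ (n + 1) * macdonaldIntegrand m w t)) w := by
    intro t w
    have h1 : HasDerivAt (fun w : ℂ => -w * (Real.cosh t : ℂ) - m * t)
        (-1 * (Real.cosh t : ℂ)) w :=
      (((hasDerivAt_id w).neg).mul_const _).sub_const _
    refine (h1.cexp.const_mul ((Real.cosh t : ℂ) ^ n)).congr_deriv ?_
    simp only [macdonaldIntegrand]
    ring
  have h := hasDerivAt_integral_of_holomorphic (μ := volume) (U := {w : ℂ | z.re / 2 < w.re})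
    (isOpen_lt continuous_const Complex.continuous_re)
    (f := fun w t => (Real.cosh t : ℂ) ^ n * macdonaldIntegrand m w t)
    (b := fun t => Real.exp (-(z.re / 2) * Real.cosh t + (n + ‖m‖) * |t|))
    (fun w hw => ?_) (integrable_exp_neg_cosh (half_pos hz) _)
    (fun w hw t => norm_cosh_pow_mul_macdonaldIntegrand_le (le_of_lt hw) n t)
    (fun t w _ => (hder t w).differentiableAt.differentiableWithinAt)
    (z := z) (by simp only [mem_ofPred_eq]; linarith)
  · simp only [(hder _ _).deriv, integral_neg] at h
    exact h
  · have := continuous_macdonaldIntegrand m w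
    exact (by fun_prop : Continuous fun t : ℝ =>
      (Real.cosh t : ℂ) ^ n * macdonaldIntegrand m w t).aestronglyMeasurable

/-- The modified Bessel equation. -/
lemma macdonaldMoment_bessel (m : ℂ) {z : ℂ} (hz : 0 < z.re) :
    z ^ 2 * macdonaldMoment m 2 z - z * macdonaldMoment m 1 z -
      (z ^ 2 + m ^ 2) * macdonaldMoment m 0 z = 0 := by
  have i0 := integrable_cosh_pow_mul_macdonaldIntegrand m hz 0
  have i1 := integrable_cosh_pow_mul_macdonaldIntegrand m hz 1
  have i2 := integrable_cosh_pow_mul_macdonaldIntegrand m hz 2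
  -- The integrand of Bessel's expression is the exact `t`-derivative of `(m - z sinh t) exp (-z
  -- cosh t - m t)`, which is integrable together with its derivative; hence its integral vanishes.
  have hder : ∀ t : ℝ, HasDerivAt
      (fun t : ℝ => (m - z * (Real.sinh t : ℂ)) * macdonaldIntegrand m z t)
      (z ^ 2 * ((Real.cosh t : ℂ) ^ 2 * macdonaldIntegrand m z t) -
        z * ((Real.cosh t : ℂ) ^ 1 * macdonaldIntegrand m z t) -
        (z ^ 2 + m ^ 2) * ((Real.cosh t : ℂ) ^ 0 * macdonaldIntegrand m z t)) t := by
    intro t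
    have hs : HasDerivAt (fun t : ℝ => (Real.sinh t : ℂ)) (Real.cosh t : ℂ) t :=
      (Real.hasDerivAt_sinh t).ofReal_comp
    have hc : HasDerivAt (fun t : ℝ => (Real.cosh t : ℂ)) (Real.sinh t : ℂ) t :=
      (Real.hasDerivAt_cosh t).ofReal_comp
    have ht : HasDerivAt (fun t : ℝ => (t : ℂ)) 1 t := Complex.ofRealCLM.hasDerivAt
    have hE : HasDerivAt (macdonaldIntegrand m z)
        (macdonaldIntegrand m z t * (-z * (Real.sinh t : ℂ) - m * 1)) t :=
      ((hc.const_mul (-z)).fun_sub (ht.const_mul m)).cexp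
    refine (((hs.const_mul z).const_sub m).fun_mul hE).congr_deriv ?_
    have hsq : (Real.cosh t : ℂ) ^ 2 = 1 + (Real.sinh t : ℂ) ^ 2 := by
      exact_mod_cast Real.cosh_sq' t
    rw [hsq]
    ring
  have hint : Integrable fun t : ℝ =>
      (m - z * (Real.sinh t : ℂ)) * macdonaldIntegrand m z t := by
    refine Integrable.mono' ((i0.norm.const_mul ‖m‖).add (i1.norm.const_mul ‖z‖)) ?_
      (Eventually.of_forall fun t => ?_)
    · have := continuous_macdonaldIntegrand m z
      exact (by fun_prop : Continuous fun t : ℝ =>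
        (m - z * (Real.sinh t : ℂ)) * macdonaldIntegrand m z t).aestronglyMeasurable
    · have hsc : |Real.sinh t| ≤ Real.cosh t := by
        refine abs_le_of_sq_le_sq ?_ (Real.cosh_pos t).le
        rw [Real.cosh_sq']
        linarith
      simp only [Pi.add_apply, norm_mul, pow_zero, pow_one, one_mul,
        Complex.norm_real, Real.norm_of_nonneg (Real.cosh_pos t).le]
      calc ‖m - z * (Real.sinh t : ℂ)‖ * ‖macdonaldIntegrand m z t‖
          ≤ (‖m‖ + ‖z‖ * Real.cosh t) * ‖macdonaldIntegrand m z t‖ := by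
            gcongr
            refine (norm_sub_le _ _).trans ?_
            rw [norm_mul, Complex.norm_real, Real.norm_eq_abs]
            gcongr
        _ = _ := by ring
  have hint₁ : Integrable fun t : ℝ => z ^ 2 * ((Real.cosh t : ℂ) ^ 2 * macdonaldIntegrand m z t) -
      z * ((Real.cosh t : ℂ) ^ 1 * macdonaldIntegrand m z t) :=
    (i2.const_mul (z ^ 2)).sub (i1.const_mul z)
  have hint' := hint₁.sub (i0.const_mul (z ^ 2 + m ^ 2))
  have h := integral_eq_zero_of_hasDerivAt_of_integrable hder hint' hint
  rw [integral_sub hint₁ (i0.const_mul (z ^ 2 + m ^ 2)),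
    integral_sub (i2.const_mul (z ^ 2)) (i1.const_mul z), integral_const_mul, integral_const_mul,
    integral_const_mul] at h
  exact h

lemma hasDerivAt_cpow_half {z : ℂ} (hz : z ∈ Complex.slitPlane) :
    HasDerivAt (fun z : ℂ => z ^ (1 / 2 : ℂ)) (z ^ (1 / 2 : ℂ) / (2 * z)) z := by
  have h0 := Complex.slitPlane_ne_zero hz
  refine ((hasDerivAt_id z).cpow_const (c := (1 / 2 : ℂ)) hz).congr_deriv ?_
  simp only [id]
  rw [Complex.cpow_sub _ _ h0, Complex.cpow_one]
  field_simp

/-- The integral formula satisfies the unperturbed equation `F'' = (1 + (m² - 1/4) / z²) F`. -/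
lemma exists_hasDerivAt_macdonaldIntegral (m : ℂ) : ∃ F' : ℂ → ℂ, ∀ z : ℂ, 0 < z.re →
    HasDerivAt (macdonaldIntegral m) (F' z) z ∧
      HasDerivAt F' ((1 + (m ^ 2 - 1 / 4) / z ^ 2) * macdonaldIntegral m z) z := by
  have hF : macdonaldIntegral m = fun z => ((Real.sqrt (2 * Real.pi) : ℂ))⁻¹ *
      (z ^ (1 / 2 : ℂ) * macdonaldMoment m 0 z) := by
    funext z
    rw [macdonaldIntegral_eq, macdonaldMoment]
    simp only [pow_zero, one_mul]
    ring
  refine ⟨fun z => ((Real.sqrt (2 * Real.pi) : ℂ))⁻¹ *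
    (z ^ (1 / 2 : ℂ) / (2 * z) * macdonaldMoment m 0 z +
      z ^ (1 / 2 : ℂ) * -macdonaldMoment m 1 z), fun z hz => ?_⟩
  have hsl : z ∈ Complex.slitPlane := Or.inl hz
  have h0 : z ≠ 0 := Complex.slitPlane_ne_zero hsl
  have d0 := hasDerivAt_macdonaldMoment m 0 hz
  have d1 := hasDerivAt_macdonaldMoment m 1 hz
  have dz := hasDerivAt_cpow_half hsl
  constructor
  · rw [hF]
    exact (dz.fun_mul d0).const_mul _
  · have d2 : HasDerivAt (fun z : ℂ => 2 * z) 2 z := by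
      simpa using (hasDerivAt_id z).const_mul (2 : ℂ)
    have h2 := ((((dz.fun_div d2 (by simpa using h0)).fun_mul d0).fun_add
      (dz.fun_mul d1.fun_neg)).const_mul ((Real.sqrt (2 * Real.pi) : ℂ))⁻¹)
    refine h2.congr_deriv ?_
    rw [hF]
    have hb := macdonaldMoment_bessel m hz
    simp only [Nat.reduceAdd, zero_add]
    have e : macdonaldMoment m 2 z = (z * macdonaldMoment m 1 z +
        (z ^ 2 + m ^ 2) * macdonaldMoment m 0 z) / z ^ 2 := by
      rw [eq_div_iff (pow_ne_zero 2 h0)]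
      linear_combination hb
    rw [e]
    field_simp
    ring

/-! ### A Gaussian integral for the Macdonald function

For `z > 0` the substitution `v = 2 √z sinh (t / 2)` turns the integral formula into
`exp (-z) / √(2π) ∫ exp (-v² / 2) (w + √(1 + w²))^(-2m) / √(1 + w²) dv` with `w = v / (2 √z)`,
which is holomorphic on a neighbourhood of the closed right half-plane without `0`. -/

/-- A sector that contains the closed right half-plane without `0`. -/
def sector : Set ℂ :=
  {z | 0 < z.re + |z.im|}

lemma isOpen_sector : IsOpen sector :=
  isOpen_lt continuous_const (Complex.continuous_re.add Complex.continuous_im.abs)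

lemma mem_sector_of_re_pos {z : ℂ} (hz : 0 < z.re) : z ∈ sector :=
  add_pos_of_pos_of_nonneg hz (abs_nonneg _)

lemma mem_sector_of_re_nonneg {z : ℂ} (hz : 0 ≤ z.re) (h0 : z ≠ 0) : z ∈ sector := by
  rcases hz.eq_or_lt with h | h
  · refine add_pos_of_nonneg_of_pos hz (abs_pos.2 fun hi => h0 (Complex.ext h.symm hi))
  · exact mem_sector_of_re_pos h

lemma sector_subset_slitPlane : sector ⊆ Complex.slitPlane := by
  intro z hz
  have hz : 0 < z.re + |z.im| := hz
  rw [Complex.mem_slitPlane_iff]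
  by_cases h : z.im = 0
  · rw [h, abs_zero, add_zero] at hz
    exact Or.inl hz
  · exact Or.inr h

lemma isPreconnected_sector : IsPreconnected sector := by
  have h : StarConvex ℝ (1 : ℂ) sector := by
    intro z hz a b ha hb hab
    have hz : 0 < z.re + |z.im| := hz
    change 0 < (a • (1 : ℂ) + b • z).re + |(a • (1 : ℂ) + b • z).im|
    simp only [Complex.add_re, Complex.smul_re, Complex.one_re, Complex.add_im, Complex.smul_im,
      Complex.one_im, smul_eq_mul, mul_one, mul_zero, zero_add, abs_mul, abs_of_nonneg hb]
    rcases ha.eq_or_lt with h | h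
    · have : b = 1 := by linarith
      rw [← h, this]
      linarith
    · nlinarith [mul_nonneg hb hz.le]
  exact (h.isPathConnected (mem_sector_of_re_pos (by simp))).isConnected.isPreconnected

/-- The variable `w = v / (2 √z)`. -/
def gaussVar (z : ℂ) (v : ℝ) : ℂ :=
  (v : ℂ) / (2 * z ^ (1 / 2 : ℂ))

/-- The square root `√(1 + w²)`. -/
def gaussRoot (z : ℂ) (v : ℝ) : ℂ :=
  (1 + (v : ℂ) ^ 2 / (4 * z)) ^ (1 / 2 : ℂ)

/-- The integrand `exp (-v² / 2) (w + √(1 + w²))^(-2m) / √(1 + w²)`. -/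
def gaussIntegrand (m z : ℂ) (v : ℝ) : ℂ :=
  Complex.exp (-((v : ℂ) ^ 2 / 2)) *
    Complex.exp (-2 * m * Complex.log (gaussVar z v + gaussRoot z v)) / gaussRoot z v

lemma cpow_half_sq (z : ℂ) : (z ^ (1 / 2 : ℂ)) ^ 2 = z := by
  rw [← Complex.cpow_nat_mul]
  simp

lemma cpow_half_re_pos {z : ℂ} (hz : z ∈ Complex.slitPlane) : 0 < (z ^ (1 / 2 : ℂ)).re := by
  have h0 := Complex.slitPlane_ne_zero hz
  rw [Complex.cpow_def_of_ne_zero h0, Complex.exp_re]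
  refine mul_pos (Real.exp_pos _) (Real.cos_pos_of_mem_Ioo ?_)
  have him : (Complex.log z * (1 / 2)).im = z.arg / 2 := by
    rw [show Complex.log z * (1 / 2) = Complex.log z / 2 by ring]
    rw [Complex.div_ofNat_im, Complex.log_im]
  rw [him]
  have h1 := Complex.arg_le_pi z
  have h2 := Complex.neg_pi_lt_arg z
  have h3 : z.arg ≠ Real.pi := (Complex.mem_slitPlane_iff_arg.1 hz).1
  have h4 : z.arg < Real.pi := lt_of_le_of_ne h1 h3
  constructor <;> linarith

/-- With `τ = v² / (4 |z|²)` the number is `1 + τ z̄`. When `Re z < 0`, membership in the sector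
forces `|Re z| ≤ |Im z|`, and then its squared modulus is at least `(1 + s)² + s² ≥ 1 / 2` with `s =
τ Re z`. The sector thus keeps `1 + w²` away from its zero and from the cut of the square root. -/
lemma one_half_le_norm_one_add {z : ℂ} (hz : z ∈ sector) (v : ℝ) :
    1 + (v : ℂ) ^ 2 / (4 * z) ∈ Complex.slitPlane ∧ 1 / 2 ≤ ‖1 + (v : ℂ) ^ 2 / (4 * z)‖ := by
  have hz' : 0 < z.re + |z.im| := hz
  have h0 : z ≠ 0 := Complex.slitPlane_ne_zero (sector_subset_slitPlane hz)
  have hN : 0 < Complex.normSq z := Complex.normSq_pos.2 h0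
  set τ : ℝ := v ^ 2 / (4 * Complex.normSq z) with hτ
  have hτ0 : 0 ≤ τ := by positivity
  have e : 1 + (v : ℂ) ^ 2 / (4 * z) = ⟨1 + τ * z.re, -(τ * z.im)⟩ := by
    have : (v : ℂ) ^ 2 / (4 * z) = (τ : ℂ) * (starRingEnd ℂ) z := by
      have hN' : (Complex.normSq z : ℂ) ≠ 0 := by exact_mod_cast hN.ne'
      rw [hτ]
      push_cast
      rw [div_mul_eq_mul_div, div_eq_div_iff (by simpa using h0) (by simpa using hN'),
        ← Complex.mul_conj]
      ring
    rw [this]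
    apply Complex.ext <;> simp
  rw [e]
  constructor
  · rw [Complex.mem_slitPlane_iff]
    by_cases h : τ * z.im = 0
    · left
      rcases mul_eq_zero.1 h with h | h
      · simp [h]
      · rw [h, abs_zero, add_zero] at hz'
        have : 0 ≤ τ * z.re := by positivity
        simp only
        linarith
    · right
      simpa using h
  · have hsq : (1 / 2) ^ 2 ≤ ‖(⟨1 + τ * z.re, -(τ * z.im)⟩ : ℂ)‖ ^ 2 := by
      rw [← Complex.normSq_eq_norm_sq, Complex.normSq_mk]
      rcases le_total 0 z.re with h | h
      · have : 0 ≤ τ * z.re := by positivity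
        nlinarith [sq_nonneg (τ * z.im)]
      · have h2 : (τ * z.re) ^ 2 ≤ (τ * z.im) ^ 2 := by
          rw [mul_pow, mul_pow]
          refine mul_le_mul_of_nonneg_left ?_ (sq_nonneg τ)
          rw [← sq_abs z.re, ← sq_abs z.im]
          have : |z.re| ≤ |z.im| := by rw [abs_of_nonpos h]; linarith
          gcongr
        nlinarith [sq_nonneg (1 + 2 * (τ * z.re))]
    exact abs_le_of_sq_le_sq' hsq (norm_nonneg _) |>.2

lemma gaussRoot_sq {z : ℂ} (v : ℝ) :
    gaussRoot z v ^ 2 = 1 + gaussVar z v ^ 2 := by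
  rw [gaussRoot, cpow_half_sq, gaussVar, div_pow, mul_pow, cpow_half_sq]
  norm_num

lemma gaussRoot_re_pos {z : ℂ} (hz : z ∈ sector) (v : ℝ) : 0 < (gaussRoot z v).re :=
  cpow_half_re_pos (one_half_le_norm_one_add hz v).1

lemma one_half_le_norm_gaussRoot {z : ℂ} (hz : z ∈ sector) (v : ℝ) :
    1 / 2 ≤ ‖gaussRoot z v‖ := by
  have h := (one_half_le_norm_one_add hz v).2
  rw [← cpow_half_sq (1 + (v : ℂ) ^ 2 / (4 * z)), norm_pow] at h
  change 1 / 2 ≤ ‖gaussRoot z v‖ ^ 2 at h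
  nlinarith [norm_nonneg (gaussRoot z v)]

lemma norm_gaussRoot_le (z : ℂ) (v : ℝ) : ‖gaussRoot z v‖ ≤ 1 + ‖gaussVar z v‖ := by
  refine abs_le_of_sq_le_sq' ?_ (by positivity) |>.2
  rw [← norm_pow, gaussRoot_sq]
  refine (norm_add_le _ _).trans ?_
  rw [norm_pow, norm_one]
  nlinarith [norm_nonneg (gaussVar z v)]

lemma gaussSum_mul (z : ℂ) (v : ℝ) :
    (gaussVar z v + gaussRoot z v) * (gaussRoot z v - gaussVar z v) = 1 := by
  linear_combination gaussRoot_sq (z := z) v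

/-- For `σ = w + √(1 + w²)` the inverse is `√(1 + w²) - w`, so `σ + σ⁻¹ = 2 √(1 + w²)` has positive
real part. Since `σ` and `σ⁻¹` have real parts of the same sign, `Re σ > 0`, and the principal
logarithm of `σ` is holomorphic in `z`. -/
lemma gaussSum_re_pos {z : ℂ} (hz : z ∈ sector) (v : ℝ) :
    0 < (gaussVar z v + gaussRoot z v).re := by
  set σ := gaussVar z v + gaussRoot z v with hσ
  have hmul := gaussSum_mul z v
  rw [← hσ] at hmul
  have h0 : σ ≠ 0 := left_ne_zero_of_mul_eq_one hmul
  have hinv : σ⁻¹ = gaussRoot z v - gaussVar z v := inv_eq_of_mul_eq_one_right hmul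
  have hN : 0 < Complex.normSq σ := Complex.normSq_pos.2 h0
  have hsum : σ.re + σ.re / Complex.normSq σ = 2 * (gaussRoot z v).re := by
    rw [← Complex.inv_re, hinv, hσ]
    simp
    ring
  have hr := gaussRoot_re_pos hz v
  by_contra hneg
  push Not at hneg
  have : σ.re / Complex.normSq σ ≤ 0 := div_nonpos_of_nonpos_of_nonneg hneg hN.le
  linarith

/-- Both `σ` and `σ⁻¹` have modulus at most `1 + 2 ‖w‖`, which bounds `|log ‖σ‖|`; the argument
contributes at most `π`. -/
lemma norm_log_gaussSum_le {z : ℂ} (hz : z ∈ sector) (v : ℝ) :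
    ‖Complex.log (gaussVar z v + gaussRoot z v)‖ ≤ 2 * ‖gaussVar z v‖ + Real.pi := by
  have hre := gaussSum_re_pos hz v
  have hmul := gaussSum_mul z v
  have hroot := norm_gaussRoot_le z v
  set σ := gaussVar z v + gaussRoot z v with hσ
  have h0 : σ ≠ 0 := left_ne_zero_of_mul_eq_one hmul
  have hpos : 0 < ‖σ‖ := norm_pos_iff.2 h0
  have hinv : σ⁻¹ = gaussRoot z v - gaussVar z v := inv_eq_of_mul_eq_one_right hmul
  have b1 : ‖σ‖ ≤ 1 + 2 * ‖gaussVar z v‖ := by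
    rw [hσ]
    linarith [norm_add_le (gaussVar z v) (gaussRoot z v)]
  have b2 : ‖σ‖⁻¹ ≤ 1 + 2 * ‖gaussVar z v‖ := by
    rw [← norm_inv, hinv]
    linarith [norm_sub_le (gaussRoot z v) (gaussVar z v)]
  have l1 : Real.log ‖σ‖ ≤ 2 * ‖gaussVar z v‖ := by
    linarith [Real.log_le_sub_one_of_pos hpos]
  have l2 : -Real.log ‖σ‖ ≤ 2 * ‖gaussVar z v‖ := by
    rw [← Real.log_inv]
    linarith [Real.log_le_sub_one_of_pos (inv_pos.2 hpos)]
  refine (Complex.norm_le_abs_re_add_abs_im _).trans (add_le_add ?_ ?_)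
  · rw [Complex.log_re, abs_le]
    constructor <;> linarith
  · rw [Complex.log_im]
    exact Complex.abs_arg_le_pi _

lemma norm_gaussVar (z : ℂ) (v : ℝ) : ‖gaussVar z v‖ = |v| / (2 * Real.sqrt ‖z‖) := by
  have h : ‖z ^ (1 / 2 : ℂ)‖ = Real.sqrt ‖z‖ := by
    rw [eq_comm, Real.sqrt_eq_iff_eq_sq (norm_nonneg _) (norm_nonneg _), ← norm_pow,
      cpow_half_sq]
  rw [gaussVar, norm_div, norm_mul, h, Complex.norm_real, Real.norm_eq_abs]
  norm_num

/-- A Gaussian bound on the integrand, uniform away from `0`. -/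
def gaussBound (m : ℂ) (d v : ℝ) : ℝ :=
  2 * Real.exp (2 * ‖m‖ * Real.pi) *
    Real.exp (-(1 / 2) * v ^ 2 + 2 * ‖m‖ / Real.sqrt d * |v|)

lemma integrable_gaussBound (m : ℂ) (d : ℝ) : Integrable (gaussBound m d) :=
  (integrable_exp_neg_sq_add_abs (by norm_num)).const_mul _

/-- The power of `σ` grows at most like an exponential of a multiple of `|v|`, which the Gaussian
absorbs. Only a lower bound on `‖z‖` enters, not one on `Re z`, so the estimate survives on the
imaginary axis. -/
lemma norm_gaussIntegrand_le {m z : ℂ} (hz : z ∈ sector) {d : ℝ} (hd : 0 < d) (hdz : d ≤ ‖z‖)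
    (v : ℝ) : ‖gaussIntegrand m z v‖ ≤ gaussBound m d v := by
  have hlog := norm_log_gaussSum_le hz v
  have hroot := one_half_le_norm_gaussRoot hz v
  have hvar : ‖gaussVar z v‖ ≤ |v| / (2 * Real.sqrt d) := by
    rw [norm_gaussVar]
    have : 0 < Real.sqrt d := Real.sqrt_pos.2 hd
    gcongr
  have h1 : ‖Complex.exp (-((v : ℂ) ^ 2 / 2))‖ = Real.exp (-(1 / 2) * v ^ 2) := by
    rw [Complex.norm_exp]
    congr 1
    rw [show -((v : ℂ) ^ 2 / 2) = ((-(1 / 2) * v ^ 2 : ℝ) : ℂ) by push_cast; ring]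
    exact Complex.ofReal_re _
  have h2 : ‖Complex.exp (-2 * m * Complex.log (gaussVar z v + gaussRoot z v))‖ ≤
      Real.exp (2 * ‖m‖ * Real.pi + 2 * ‖m‖ / Real.sqrt d * |v|) := by
    rw [Complex.norm_exp, Real.exp_le_exp]
    refine (Complex.re_le_norm _).trans ?_
    rw [norm_mul, norm_mul, norm_neg, Complex.norm_ofNat]
    calc 2 * ‖m‖ * ‖Complex.log (gaussVar z v + gaussRoot z v)‖
        ≤ 2 * ‖m‖ * (2 * (|v| / (2 * Real.sqrt d)) + Real.pi) := by
          gcongr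
          linarith
      _ = _ := by ring
  rw [gaussIntegrand, norm_div, norm_mul, h1, div_le_iff₀ (by linarith), gaussBound]
  calc _ ≤ Real.exp (-(1 / 2) * v ^ 2) *
        Real.exp (2 * ‖m‖ * Real.pi + 2 * ‖m‖ / Real.sqrt d * |v|) := by gcongr
    _ = 2 * Real.exp (2 * ‖m‖ * Real.pi) *
        Real.exp (-(1 / 2) * v ^ 2 + 2 * ‖m‖ / Real.sqrt d * |v|) * (1 / 2) := by
      rw [Real.exp_add, Real.exp_add]
      ring
    _ ≤ _ := by gcongr

lemma measurable_gaussIntegrand (m z : ℂ) : Measurable (gaussIntegrand m z) := by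
  unfold gaussIntegrand gaussRoot gaussVar
  fun_prop

lemma differentiableOn_gaussIntegrand (m : ℂ) (v : ℝ) :
    DifferentiableOn ℂ (fun z => gaussIntegrand m z v) sector := by
  intro z hz
  have hsl := sector_subset_slitPlane hz
  have h0 : z ≠ 0 := Complex.slitPlane_ne_zero hsl
  have hroot0 : gaussRoot z v ≠ 0 := by
    have := one_half_le_norm_gaussRoot hz v
    exact norm_pos_iff.1 (by linarith)
  have hhalf : DifferentiableAt ℂ (fun z : ℂ => z ^ (1 / 2 : ℂ)) z :=
    (hasDerivAt_cpow_half hsl).differentiableAt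
  have hhalf0 : z ^ (1 / 2 : ℂ) ≠ 0 := fun h => h0 (by rw [← cpow_half_sq z, h]; norm_num)
  have hvar : DifferentiableAt ℂ (fun z => gaussVar z v) z :=
    (differentiableAt_const _).fun_div (hhalf.const_mul 2) (by simpa using hhalf0)
  have harg : DifferentiableAt ℂ (fun z : ℂ => 1 + (v : ℂ) ^ 2 / (4 * z)) z :=
    ((differentiableAt_const _).fun_div (differentiableAt_id.const_mul 4)
      (by simpa using h0)).const_add 1
  have hrt : DifferentiableAt ℂ (fun z => gaussRoot z v) z :=
    DifferentiableAt.comp z (g := fun y : ℂ => y ^ (1 / 2 : ℂ))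
      (hasDerivAt_cpow_half (one_half_le_norm_one_add hz v).1).differentiableAt harg
  have hlog : DifferentiableAt ℂ (fun z => Complex.log (gaussVar z v + gaussRoot z v)) z :=
    (hvar.fun_add hrt).clog (Or.inl (gaussSum_re_pos hz v))
  exact (((hlog.const_mul (-2 * m)).cexp.const_mul _).fun_div hrt hroot0).differentiableWithinAt

/-- The holomorphic continuation of the Macdonald function to the sector. -/
def macdonaldExt (m z : ℂ) : ℂ :=
  Complex.exp (-z) / (Real.sqrt (2 * Real.pi) : ℂ) * ∫ v : ℝ, gaussIntegrand m z v

lemma differentiableOn_macdonaldExt (m : ℂ) : DifferentiableOn ℂ (macdonaldExt m) sector := by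
  intro z hz
  have h0 : z ≠ 0 := Complex.slitPlane_ne_zero (sector_subset_slitPlane hz)
  have hpos : 0 < ‖z‖ := norm_pos_iff.2 h0
  have hU : IsOpen (sector ∩ {w : ℂ | ‖z‖ / 2 < ‖w‖}) :=
    isOpen_sector.inter (isOpen_lt continuous_const continuous_norm)
  have h := hasDerivAt_integral_of_holomorphic (μ := volume) hU (f := gaussIntegrand m)
    (fun w _ => (measurable_gaussIntegrand m w).aestronglyMeasurable)
    (integrable_gaussBound m (‖z‖ / 2))
    (fun w hw v => norm_gaussIntegrand_le hw.1 (half_pos hpos) (le_of_lt hw.2) v)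
    (fun v => (differentiableOn_gaussIntegrand m v).mono inter_subset_left)
    (z := z) ⟨hz, by simp only [mem_ofPred_eq]; linarith⟩
  exact ((differentiableAt_id.neg.cexp.div_const _).fun_mul
    h.differentiableAt).differentiableWithinAt

lemma exists_norm_macdonaldExt_le (m : ℂ) {d : ℝ} (hd : 0 < d) :
    ∃ C : ℝ, 0 ≤ C ∧ ∀ z ∈ sector, d ≤ ‖z‖ → ‖macdonaldExt m z‖ ≤ C * Real.exp (-z.re) := by
  refine ⟨(Real.sqrt (2 * Real.pi))⁻¹ * ∫ v, gaussBound m d v, ?_, fun z hz hdz => ?_⟩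
  · refine mul_nonneg (by positivity) (integral_nonneg fun v => ?_)
    simp only [Pi.zero_apply, gaussBound]
    positivity
  · have h := norm_integral_le_of_norm_le (integrable_gaussBound m d)
      (Eventually.of_forall (norm_gaussIntegrand_le (m := m) hz hd hdz))
    rw [macdonaldExt, norm_mul, norm_div, Complex.norm_exp, Complex.neg_re, Complex.norm_real,
      Real.norm_of_nonneg (Real.sqrt_nonneg _)]
    calc _ ≤ Real.exp (-z.re) / Real.sqrt (2 * Real.pi) * ∫ v, gaussBound m d v := by gcongr
      _ = _ := by ring

/-- For real `x` the substitution `v = 2 √x sinh (t / 2)` maps the real line onto itself. It gives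
`√(1 + w²) = cosh (t / 2)`, `w + √(1 + w²) = exp (t / 2)` and `x + v² / 2 = x cosh t`. -/
lemma macdonaldExt_ofReal (m : ℂ) {x : ℝ} (hx : 0 < x) :
    macdonaldExt m x = macdonaldIntegral m x := by
  have hsx : 0 < Real.sqrt x := Real.sqrt_pos.2 hx
  have hhalf : (x : ℂ) ^ (1 / 2 : ℂ) = (Real.sqrt x : ℂ) := by
    rw [Real.sqrt_eq_rpow, Complex.ofReal_cpow hx.le]
    norm_num
  have hx0 : (x : ℂ) ≠ 0 := by exact_mod_cast hx.ne'
  have hder : ∀ t : ℝ, HasDerivAt (fun t : ℝ => 2 * Real.sqrt x * Real.sinh (t / 2))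
      (Real.sqrt x * Real.cosh (t / 2)) t := by
    intro t
    have h1 : HasDerivAt (fun t : ℝ => t / 2) (1 / 2) t := (hasDerivAt_id t).div_const 2
    refine (h1.sinh.const_mul (2 * Real.sqrt x)).congr_deriv ?_
    ring
  have hinj : Function.Injective (fun t : ℝ => 2 * Real.sqrt x * Real.sinh (t / 2)) := by
    intro s t hst
    have h1 : Real.sinh (s / 2) = Real.sinh (t / 2) :=
      mul_left_cancel₀ (by positivity : 2 * Real.sqrt x ≠ 0) hst
    have := Real.sinh_injective h1
    linarith
  have hsurj : Function.Surjective (fun t : ℝ => 2 * Real.sqrt x * Real.sinh (t / 2)) := by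
    intro y
    obtain ⟨s, hs⟩ := Real.sinh_surjective (y / (2 * Real.sqrt x))
    refine ⟨2 * s, ?_⟩
    simp only
    rw [mul_div_cancel_left₀ _ (two_ne_zero' ℝ), hs]
    field_simp
  have hsub := integral_image_eq_integral_abs_deriv_smul (s := univ) MeasurableSet.univ
    (fun t _ => (hder t).hasDerivWithinAt) hinj.injOn (gaussIntegrand m x)
  rw [image_univ, hsurj.range_eq, setIntegral_univ, setIntegral_univ] at hsub
  rw [macdonaldIntegral_eq, macdonaldExt, hsub, hhalf]
  rw [div_mul_eq_mul_div, div_mul_eq_mul_div, ← integral_const_mul, ← integral_const_mul]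
  congr 1
  refine integral_congr_ae (Eventually.of_forall fun t => ?_)
  simp only
  have hc := Real.cosh_pos (t / 2)
  have hvar : gaussVar x (2 * Real.sqrt x * Real.sinh (t / 2)) = (Real.sinh (t / 2) : ℂ) := by
    have : (Real.sqrt x : ℂ) ≠ 0 := by exact_mod_cast hsx.ne'
    rw [gaussVar, hhalf]
    push_cast
    field_simp
  have hroot : gaussRoot x (2 * Real.sqrt x * Real.sinh (t / 2)) = (Real.cosh (t / 2) : ℂ) := by
    have h1 : 1 + (((2 * Real.sqrt x * Real.sinh (t / 2) : ℝ) : ℂ)) ^ 2 / (4 * (x : ℂ)) =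
        ((Real.cosh (t / 2) ^ 2 : ℝ) : ℂ) := by
      have h2 : ((Real.sqrt x : ℝ) : ℂ) ^ 2 = x := by exact_mod_cast Real.sq_sqrt hx.le
      rw [Real.cosh_sq']
      push_cast
      rw [mul_pow, mul_pow, h2]
      field_simp
      ring
    rw [gaussRoot, h1, show (1 / 2 : ℂ) = ((1 / 2 : ℝ) : ℂ) by norm_num,
      ← Complex.ofReal_cpow (by positivity), ← Real.sqrt_eq_rpow, Real.sqrt_sq hc.le]
  have hlog : Complex.log ((Real.sinh (t / 2) : ℂ) + (Real.cosh (t / 2) : ℂ)) = (t : ℂ) / 2 := by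
    rw [← Complex.ofReal_add, Real.sinh_add_cosh, ← Complex.ofReal_log (Real.exp_pos _).le,
      Real.log_exp]
    push_cast
    rfl
  have hcC : (Real.cosh (t / 2) : ℂ) ≠ 0 := by exact_mod_cast hc.ne'
  rw [gaussIntegrand, hvar, hroot, hlog, abs_of_pos (by positivity), Complex.real_smul,
    macdonaldIntegrand]
  have hexp : Complex.exp (-(x : ℂ)) *
      (Complex.exp (-(((2 * Real.sqrt x * Real.sinh (t / 2) : ℝ) : ℂ) ^ 2 / 2)) *
        Complex.exp (-2 * m * ((t : ℂ) / 2))) =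
      Complex.exp (-(x : ℂ) * (Real.cosh t : ℂ) - m * t) := by
    rw [← Complex.exp_add, ← Complex.exp_add]
    congr 1
    have h2 : ((Real.sqrt x : ℝ) : ℂ) ^ 2 = x := by exact_mod_cast Real.sq_sqrt hx.le
    have h3 : (Real.cosh t : ℂ) = 1 + 2 * (Real.sinh (t / 2) : ℂ) ^ 2 := by
      have : Real.cosh t = 1 + 2 * Real.sinh (t / 2) ^ 2 := by
        have h4 := Real.cosh_two_mul (t / 2)
        rw [mul_div_cancel₀ t (two_ne_zero' ℝ), Real.cosh_sq'] at h4
        linarith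
      exact_mod_cast this
    rw [h3]
    push_cast
    rw [mul_pow, mul_pow, h2]
    ring
  rw [← hexp, Complex.ofReal_mul]
  field_simp

/-- Identity theorem on the half-plane, using agreement at the real points `1 + 1 / (n + 1)`, which
accumulate at `1`. -/
lemma macdonaldExt_eq_macdonaldIntegral (m : ℂ) {z : ℂ} (hz : 0 < z.re) :
    macdonaldExt m z = macdonaldIntegral m z := by
  have hopen : IsOpen {z : ℂ | 0 < z.re} := isOpen_lt continuous_const Complex.continuous_re
  have hconv : Convex ℝ {z : ℂ | 0 < z.re} := convex_halfSpace_re_gt 0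
  obtain ⟨F', hF'⟩ := exists_hasDerivAt_macdonaldIntegral m
  have a1 : AnalyticOnNhd ℂ (macdonaldExt m) {z : ℂ | 0 < z.re} :=
    ((differentiableOn_macdonaldExt m).mono fun z hz => mem_sector_of_re_pos hz).analyticOnNhd
      hopen
  have a2 : AnalyticOnNhd ℂ (macdonaldIntegral m) {z : ℂ | 0 < z.re} :=
    DifferentiableOn.analyticOnNhd
      (fun z hz => (hF' z hz).1.differentiableAt.differentiableWithinAt) hopen
  have hfreq : ∃ᶠ w in 𝓝[≠] (1 : ℂ), macdonaldExt m w = macdonaldIntegral m w := by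
    have hu : Tendsto (fun n : ℕ => ((1 + 1 / ((n : ℝ) + 1) : ℝ) : ℂ)) atTop (𝓝[≠] 1) := by
      refine tendsto_nhdsWithin_iff.2 ⟨?_, Eventually.of_forall fun n => ?_⟩
      · have h := (tendsto_one_div_add_atTop_nhds_zero_nat (𝕜 := ℝ)).const_add 1
        rw [add_zero] at h
        have := (Complex.continuous_ofReal.tendsto 1).comp h
        simpa [Function.comp_def] using this
      · rw [mem_compl_iff, mem_singleton_iff, ← Complex.ofReal_one, Complex.ofReal_inj]
        have : (0 : ℝ) < 1 / ((n : ℝ) + 1) := by positivity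
        linarith
    refine hu.frequently (Frequently.of_forall fun n => macdonaldExt_ofReal m ?_)
    positivity
  exact a1.eqOn_of_preconnected_of_frequently_eq a2 hconv.isPreconnected (z₀ := 1)
    (by simp) hfreq hz

/-- The equation is known in the open half-plane from the integral formula. Both sides are
holomorphic on the connected sector, so the identity theorem extends it to the sector, imaginary
axis included. -/
lemma hasDerivAt_deriv_macdonaldExt (m : ℂ) {z : ℂ} (hz : z ∈ sector) :
    HasDerivAt (deriv (macdonaldExt m))
      ((1 + (m ^ 2 - 1 / 4) / z ^ 2) * macdonaldExt m z) z := by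
  have hd := differentiableOn_macdonaldExt m
  have hd1 : DifferentiableOn ℂ (deriv (macdonaldExt m)) sector := hd.deriv isOpen_sector
  have hd2 : DifferentiableOn ℂ (deriv (deriv (macdonaldExt m))) sector :=
    hd1.deriv isOpen_sector
  have hr : DifferentiableOn ℂ (fun z => (1 + (m ^ 2 - 1 / 4) / z ^ 2) * macdonaldExt m z)
      sector := by
    refine DifferentiableOn.fun_mul ?_ hd
    intro z hz
    have h0 : z ≠ 0 := Complex.slitPlane_ne_zero (sector_subset_slitPlane hz)
    have hdiv : DifferentiableAt ℂ (fun z : ℂ => (m ^ 2 - 1 / 4) / z ^ 2) z :=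
      (differentiableAt_const _).fun_div (differentiableAt_fun_id.fun_pow 2) (pow_ne_zero 2 h0)
    exact (hdiv.const_add 1).differentiableWithinAt
  obtain ⟨F', hF'⟩ := exists_hasDerivAt_macdonaldIntegral m
  have hopen : IsOpen {z : ℂ | 0 < z.re} := isOpen_lt continuous_const Complex.continuous_re
  have hev : deriv (deriv (macdonaldExt m)) =ᶠ[𝓝 1]
      fun z => (1 + (m ^ 2 - 1 / 4) / z ^ 2) * macdonaldExt m z := by
    have e0 : ∀ z ∈ {z : ℂ | 0 < z.re}, macdonaldExt m =ᶠ[𝓝 z] macdonaldIntegral m := by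
      intro z hz
      filter_upwards [hopen.mem_nhds hz] with w hw
      exact macdonaldExt_eq_macdonaldIntegral m hw
    have e1 : ∀ z ∈ {z : ℂ | 0 < z.re}, deriv (macdonaldExt m) =ᶠ[𝓝 z] F' := by
      intro z hz
      filter_upwards [hopen.mem_nhds hz] with w hw
      rw [(e0 w hw).deriv_eq, (hF' w hw).1.deriv]
    filter_upwards [hopen.mem_nhds (show (1 : ℂ) ∈ {z : ℂ | 0 < z.re} by simp)] with w hw
    rw [(e1 w hw).deriv_eq, (hF' w hw).2.deriv, macdonaldExt_eq_macdonaldIntegral m hw]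
  have heq := (hd2.analyticOnNhd isOpen_sector).eqOn_of_preconnected_of_eventuallyEq
    (hr.analyticOnNhd isOpen_sector) isPreconnected_sector
    (mem_sector_of_re_pos (by simp : 0 < (1 : ℂ).re)) hev
  have h := (hd1.differentiableAt (isOpen_sector.mem_nhds hz)).hasDerivAt
  rw [heq hz] at h
  exact h

/-! ### The unperturbed Jost solution -/

/-- `macdonaldExt` is continuous on the closed half-plane without `0`, so it provides the limit
required by `extendFrom`. -/
lemma macdonald_eq (m : ℂ) {z : ℂ} (hz : 0 ≤ z.re) (h0 : z ≠ 0) :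
    macdonald m z = macdonaldExt m z := by
  refine extendFrom_eq ?_ ?_
  · rw [Complex.closure_setOfPred_lt_re]
    exact hz
  · have hc : ContinuousAt (macdonaldExt m) z :=
      ((differentiableOn_macdonaldExt m).differentiableAt
        (isOpen_sector.mem_nhds (mem_sector_of_re_nonneg hz h0))).continuousAt
    refine (hc.tendsto.mono_left nhdsWithin_le_nhds).congr' ?_
    filter_upwards [self_mem_nhdsWithin] with w hw
    exact macdonaldExt_eq_macdonaldIntegral m hw

lemma mul_ofReal_mem_sector {k : ℂ} (hk : 0 ≤ k.re) (hk0 : k ≠ 0) {x : ℝ} (hx : 0 < x) :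
    k * x ∈ sector := by
  refine mem_sector_of_re_nonneg ?_ (mul_ne_zero hk0 (by exact_mod_cast hx.ne'))
  rw [Complex.re_mul_ofReal]
  positivity

lemma freeJost_eq (m : ℂ) {k : ℂ} (hk : 0 ≤ k.re) (hk0 : k ≠ 0) {x : ℝ} (hx : 0 < x) :
    freeJost m k x = macdonaldExt m (k * x) := by
  refine macdonald_eq m ?_ (mul_ne_zero hk0 (by exact_mod_cast hx.ne'))
  rw [Complex.re_mul_ofReal]
  positivity

lemma isClassical_freeJost (m : ℂ) {k : ℂ} (hk : 0 ≤ k.re) (hk0 : k ≠ 0) :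
    IsClassical m k (freeJost m k) := by
  have hmul : ∀ x : ℝ, HasDerivAt (fun x : ℝ => k * (x : ℂ)) k x := fun x => by
    have h : HasDerivAt (fun x : ℝ => (x : ℂ)) 1 x := Complex.ofRealCLM.hasDerivAt
    simpa using h.const_mul k
  refine IsClassical.of_hasDerivAt (h' := fun x => deriv (macdonaldExt m) (k * x) * k)
    (fun x hx => ?_) fun x hx => ?_
  · have h1 := ((differentiableOn_macdonaldExt m).differentiableAt
      (isOpen_sector.mem_nhds (mul_ofReal_mem_sector hk hk0 hx))).hasDerivAt
    refine (HasDerivAt.comp x h1 (hmul x)).congr_of_eventuallyEq ?_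
    filter_upwards [Ioi_mem_nhds hx] with y hy
    exact freeJost_eq m hk hk0 hy
  · have h1 := hasDerivAt_deriv_macdonaldExt m (mul_ofReal_mem_sector hk hk0 hx)
    refine ((HasDerivAt.comp x h1 (hmul x)).mul_const k).congr_deriv ?_
    rw [freeJost_eq m hk hk0 hx, besselCoeff]
    have hx0 : (x : ℂ) ≠ 0 := by exact_mod_cast hx.ne'
    field_simp

lemma exists_norm_freeJost_le (m : ℂ) {k : ℂ} (hk : 0 ≤ k.re) (hk0 : k ≠ 0) {a : ℝ}
    (ha : 0 < a) : ∃ C : ℝ, 0 ≤ C ∧ ∀ x, a < x → ‖freeJost m k x‖ ≤ C * expWeight k x := by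
  have hkpos : 0 < ‖k‖ := norm_pos_iff.2 hk0
  obtain ⟨C, hC0, hC⟩ := exists_norm_macdonaldExt_le m (mul_pos hkpos ha)
  refine ⟨C, hC0, fun x hx => ?_⟩
  have hx0 : 0 < x := ha.trans hx
  rw [freeJost_eq m hk hk0 hx0]
  refine (hC _ (mul_ofReal_mem_sector hk hk0 hx0) ?_).trans (le_of_eq ?_)
  · rw [norm_mul, Complex.norm_real, Real.norm_of_nonneg hx0.le]
    gcongr
  · rw [expWeight, Complex.re_mul_ofReal]
    congr 2
    ring

/-! ### Tails of integrals -/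

lemma integral_Ioi_eq_sub {E : Type*} [NormedAddCommGroup E] [NormedSpace ℝ E] {f : ℝ → E}
    {c x : ℝ} (hf : IntegrableOn f (Ioi c)) (hx : c ≤ x) :
    ∫ y in Ioi x, f y = (∫ y in Ioi c, f y) - ∫ y in c..x, f y := by
  rw [intervalIntegral.integral_of_le hx, ← Ioc_union_Ioi_eq_Ioi hx,
    setIntegral_union (Ioc_disjoint_Ioi le_rfl) measurableSet_Ioi
      (hf.mono_set Ioc_subset_Ioi_self) (hf.mono_set (Ioi_subset_Ioi hx))]
  simp

lemma tendsto_integral_Ioi_atTop {E : Type*} [NormedAddCommGroup E] [NormedSpace ℝ E]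
    {f : ℝ → E} {c : ℝ} (hf : IntegrableOn f (Ioi c)) :
    Tendsto (fun x => ∫ y in Ioi x, f y) atTop (𝓝 0) := by
  have h := (intervalIntegral_tendsto_integral_Ioi c hf tendsto_id).const_sub
    (∫ y in Ioi c, f y)
  rw [sub_self] at h
  refine h.congr' ?_
  filter_upwards [eventually_ge_atTop c] with x hx
  exact (integral_Ioi_eq_sub hf hx).symm

lemma intervalIntegrable_of_integrableOn_Ioi {f : ℝ → ℂ} {c b : ℝ}
    (hf : IntegrableOn f (Ioi c)) (hcb : c ≤ b) : IntervalIntegrable f volume c b :=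
  (intervalIntegrable_iff_integrableOn_Ioc_of_le hcb).2 (hf.mono_set Ioc_subset_Ioi_self)

lemma absolutelyContinuous_integral_Ioi {f : ℝ → ℂ} {c a b : ℝ} (hf : IntegrableOn f (Ioi c))
    (hca : c < a) (hab : a ≤ b) :
    AbsolutelyContinuousOnInterval (fun x => ∫ y in Ioi x, f y) a b := by
  have hfa : IntegrableOn f (Ioi a) := hf.mono_set (Ioi_subset_Ioi hca.le)
  have hconst : AbsolutelyContinuousOnInterval (fun _ : ℝ => ∫ y in Ioi a, f y) a b :=
    (LipschitzWith.const _).lipschitzOnWith.absolutelyContinuousOnInterval (K := 0)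
  refine (hconst.fun_sub (absolutelyContinuousOnInterval_integral_complex
    (intervalIntegrable_of_integrableOn_Ioi hfa hab))).congr fun x hx => ?_
  rw [uIcc_of_le hab] at hx
  exact (integral_Ioi_eq_sub hfa hx.1).symm

lemma ae_hasDerivAt_integral_Ioi {f : ℝ → ℂ} {c a b : ℝ} (hf : IntegrableOn f (Ioi c))
    (hca : c < a) (hab : a ≤ b) :
    ∀ᵐ x, x ∈ Icc a b → HasDerivAt (fun x => ∫ y in Ioi x, f y) (-f x) x := by
  have hcb : c ≤ b := hca.le.trans hab
  filter_upwards [(intervalIntegrable_of_integrableOn_Ioi hf hcb).ae_hasDerivAt_integral]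
    with x hx hxab
  have hcx : c < x := hca.trans_le hxab.1
  rw [uIcc_of_le hcb] at hx
  have h := (hx ⟨hcx.le, hxab.2⟩ c ⟨le_rfl, hcb⟩).const_sub (∫ y in Ioi c, f y)
  refine h.congr_of_eventuallyEq ?_
  filter_upwards [Ioi_mem_nhds hcx] with y hy
  exact integral_Ioi_eq_sub hf (le_of_lt hy)

/-! ### The auxiliary weight built from a tail integral. -/

section ExpTail

variable {q : ℝ → ℝ}

lemma antitone_integral_Ioi (hq : Integrable q) (hq0 : ∀ x, 0 ≤ q x) :
    Antitone fun x => ∫ y in Ioi x, q y :=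
  fun _ _ hxy => setIntegral_mono_set hq.integrableOn (Eventually.of_forall hq0)
    (Eventually.of_forall (Ioi_subset_Ioi hxy))

lemma integral_Ioi_le_integral (hq : Integrable q) (hq0 : ∀ x, 0 ≤ q x) (x : ℝ) :
    ∫ y in Ioi x, q y ≤ ∫ y, q y :=
  setIntegral_le_integral hq (Eventually.of_forall hq0)

lemma measurable_exp_mul_integral_Ioi (hq : Integrable q) (hq0 : ∀ x, 0 ≤ q x) (l : ℝ) :
    Measurable fun x => Real.exp (l * ∫ y in Ioi x, q y) :=
  ((antitone_integral_Ioi hq hq0).measurable.const_mul l).exp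

lemma integrable_mul_exp_integral_Ioi (hq : Integrable q) (hq0 : ∀ x, 0 ≤ q x) {l : ℝ}
    (hl : 0 ≤ l) : Integrable fun x => q x * Real.exp (l * ∫ y in Ioi x, q y) := by
  refine hq.mul_bdd (c := Real.exp (l * ∫ y, q y))
    (measurable_exp_mul_integral_Ioi hq hq0 l).aestronglyMeasurable
    (Eventually.of_forall fun x => ?_)
  rw [Real.norm_of_nonneg (Real.exp_pos _).le, Real.exp_le_exp]
  exact mul_le_mul_of_nonneg_left (integral_Ioi_le_integral hq hq0 x) hl

/-- Almost everywhere the integrand is `-1 / l` times the derivative of `exp (l ∫_y^∞ q)`. On `[x,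
R]` the fundamental theorem gives a difference of two positive terms, of which the one at `R` is
dropped. -/
lemma integral_mul_exp_integral_Ioi_le (hq : Integrable q) (hq0 : ∀ x, 0 ≤ q x) {l : ℝ}
    (hl : 0 < l) (x : ℝ) :
    ∫ y in Ioi x, q y * Real.exp (l * ∫ t in Ioi y, q t) ≤
      Real.exp (l * ∫ t in Ioi x, q t) / l := by
  set T : ℝ := ∫ t in Ioi x, q t with hT
  refine le_of_tendsto (intervalIntegral_tendsto_integral_Ioi x
    (integrable_mul_exp_integral_Ioi hq hq0 hl.le).integrableOn tendsto_id) ?_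
  filter_upwards [eventually_ge_atTop x] with R hR
  have hqi : IntervalIntegrable q volume x R := hq.intervalIntegrable
  set P : ℝ → ℝ := fun y => ∫ t in x..y, q t with hP
  have htail : ∀ y, x ≤ y → ∫ t in Ioi y, q t = T - P y := fun y hy =>
    integral_Ioi_eq_sub hq.integrableOn hy
  have hPac : AbsolutelyContinuousOnInterval P x R :=
    hqi.absolutelyContinuousOnInterval_intervalIntegral left_mem_uIcc
  obtain ⟨D, hD⟩ := hPac.exists_bound
  -- The primitive `P` has bounded range on `[x, R]`, where the exponential is Lipschitz, so the
  -- composition stays absolutely continuous although `q` is merely integrable.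
  have hLip : ∃ K : ℝ≥0, LipschitzOnWith K (fun s => Real.exp (l * (T - s))) (Icc (-D) D) := by
    refine ContDiffOn.exists_lipschitzOnWith (n := 1) ?_ (by decide) (convex_Icc _ _) isCompact_Icc
    exact ContDiff.contDiffOn (by fun_prop)
  obtain ⟨K, hK⟩ := hLip
  have hac : AbsolutelyContinuousOnInterval (fun y => Real.exp (l * (T - P y))) x R :=
    hK.comp_absolutelyContinuousOnInterval hPac fun y hy => abs_le.1 (hD y hy)
  have hFTC := hac.integral_deriv_eq_sub
  have hder : ∀ᵐ y, y ∈ uIoc x R →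
      deriv (fun y => Real.exp (l * (T - P y))) y =
        -l * (q y * Real.exp (l * ∫ t in Ioi y, q t)) := by
    filter_upwards [hqi.ae_hasDerivAt_integral] with y hy hyR
    have h1 := hy (uIoc_subset_uIcc hyR) x left_mem_uIcc
    rw [uIoc_of_le hR] at hyR
    have h2 := ((h1.const_sub T).const_mul l).exp
    rw [h2.deriv, htail y hyR.1.le]
    ring
  rw [intervalIntegral.integral_congr_ae hder, intervalIntegral.integral_const_mul] at hFTC
  have hPx : P x = 0 := intervalIntegral.integral_same
  rw [hPx, sub_zero] at hFTC
  rw [le_div_iff₀ hl, id]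
  have hpos := Real.exp_pos (l * (T - P R))
  linarith

end ExpTail

/-! ### Invertibility of `1 + G Q` -/

section Perturbed

variable {Q : ℝ → ℂ} {m k : ℂ}

lemma integrableOn_Ioi_of_pos (hloc : LocallyIntegrableOn Q (Ioi (0 : ℝ)) volume)
    (hQ : IntegrableOn Q (Ioi (1 : ℝ)) volume) {a : ℝ} (ha : 0 < a) : IntegrableOn Q (Ioi a) := by
  have h := hloc.integrableOn_compact_subset (Icc_subset_Ioi_zero (b := 1) ha) isCompact_Icc
  refine (h.union hQ).mono_set fun x hx => ?_
  rcases le_or_gt x 1 with h1 | h1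
  · exact Or.inl ⟨le_of_lt hx, h1⟩
  · exact Or.inr h1

lemma expWeight_pos (k : ℂ) (x : ℝ) : 0 < expWeight k x :=
  Real.exp_pos _

lemma continuous_expWeight (k : ℂ) : Continuous (expWeight k) := by
  unfold expWeight
  fun_prop

lemma exp_sub_mul_expWeight (k : ℂ) (x y : ℝ) :
    Real.exp ((y - x) * k.re) * expWeight k y = expWeight k x := by
  rw [expWeight, expWeight, ← Real.exp_add]
  congr 1
  ring

lemma backwardGreen_of_le {x y : ℝ} (h : y ≤ x) : backwardGreen m k x y = 0 := by
  rw [backwardGreen]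
  split_ifs with h'
  · have : x = y := le_antisymm h' h
    rw [this, canonicalBisolution]
    ring
  · rfl

lemma backwardGreen_of_lt {x y : ℝ} (h : x < y) :
    backwardGreen m k x y = -canonicalBisolution m k x y :=
  if_pos h.le

lemma kernelOp_backwardGreenMul {a x : ℝ} (hax : a ≤ x) (f : ℝ → ℂ) :
    kernelOp a (backwardGreenMul Q m k) f x =
      -∫ y in Ioi x, canonicalBisolution m k x y * (Q y * f y) := by
  have h : ∀ y, backwardGreenMul Q m k x y * f y = (Ioi x).indicator
      (fun y => -(canonicalBisolution m k x y * (Q y * f y))) y := by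
    intro y
    by_cases hy : y ∈ Ioi x
    · rw [indicator_of_mem hy, backwardGreenMul, backwardGreen_of_lt hy]
      ring
    · rw [indicator_of_notMem hy, backwardGreenMul, backwardGreen_of_le (not_lt.1 hy)]
      ring
  rw [kernelOp, integral_congr_ae (Eventually.of_forall h),
    setIntegral_indicator measurableSet_Ioi,
    inter_eq_self_of_subset_right (Ioi_subset_Ioi hax), integral_neg]

lemma aestronglyMeasurable_classical {a : ℝ} (ha : 0 < a) {h : ℝ → ℂ} (hh : IsClassical m k h) :
    AEStronglyMeasurable h (volume.restrict (Ioi a)) :=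
  (hh.continuousOn.mono (Ioi_subset_Ioi ha.le)).aestronglyMeasurable measurableSet_Ioi

theorem oneAddInvertible_backwardGreenMul (hk : 0 ≤ k.re) (hk0 : k ≠ 0) {a : ℝ} (ha : 0 < a)
    (hQ : IntegrableOn Q (Ioi a)) (m : ℂ) :
    OneAddInvertible a (expWeight k) (backwardGreenMul Q m k) := by
  obtain ⟨C, hC0, hC⟩ := exists_bisolution_bound m hk hk0 ha
  set q : ℝ → ℝ := (Ioi a).indicator fun y => ‖Q y‖ with hq
  have hqi : Integrable q := (integrable_indicator_iff measurableSet_Ioi).2 hQ.norm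
  have hq0 : ∀ x, 0 ≤ q x := fun x => indicator_nonneg (fun _ _ => norm_nonneg _) x
  -- Any `l > C` would do: the Schur constant below is `C / l`. The summand `1` keeps `l` positive
  -- even if `C = 0`.
  set l : ℝ := 2 * C + 1 with hl
  have hl0 : 0 < l := by positivity
  set e : ℝ → ℝ := fun x => Real.exp (l * ∫ y in Ioi x, q y) with he
  set φ : ℝ → ℝ := fun x => expWeight k x * e x with hφ
  have hepos : ∀ x, 0 < e x := fun x => Real.exp_pos _
  have hem : Measurable e := measurable_exp_mul_integral_Ioi hqi hq0 l
  have hφm : Measurable φ := (continuous_expWeight k).measurable.mul hem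
  have hφpos : ∀ x, 0 < φ x := fun x => mul_pos (expWeight_pos k x) (hepos x)
  have m₁ := aestronglyMeasurable_classical ha (isClassical_fundamentalPair_fst m k)
  have m₂ := aestronglyMeasurable_classical ha (isClassical_fundamentalPair_snd m k)
  have hKx : ∀ x, AEStronglyMeasurable (backwardGreenMul Q m k x) (volume.restrict (Ioi a)) := by
    intro x
    refine AEStronglyMeasurable.mul ?_ hQ.1
    have h : AEStronglyMeasurable (fun y => -canonicalBisolution m k x y)
        (volume.restrict (Ioi a)) := by
      unfold canonicalBisolution
      exact (((m₂.const_mul _).sub (m₁.const_mul _)).mul_const _).neg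
    exact h.indicator (measurableSet_Ici (a := x))
  have hK : AEStronglyMeasurable (fun p : ℝ × ℝ => backwardGreenMul Q m k p.1 p.2)
      ((volume.restrict (Ioi a)).prod (volume.restrict (Ioi a))) := by
    refine AEStronglyMeasurable.mul ?_ (hQ.1.comp_snd (μ := volume.restrict (Ioi a)))
    have h : AEStronglyMeasurable (fun p : ℝ × ℝ => -canonicalBisolution m k p.1 p.2)
        ((volume.restrict (Ioi a)).prod (volume.restrict (Ioi a))) := by
      unfold canonicalBisolution
      have a₁ := m₁.comp_fst (ν := volume.restrict (Ioi a))
      have a₂ := m₂.comp_fst (ν := volume.restrict (Ioi a))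
      have b₁ := m₁.comp_snd (μ := volume.restrict (Ioi a))
      have b₂ := m₂.comp_snd (μ := volume.restrict (Ioi a))
      exact (((a₁.mul b₂).sub (a₂.mul b₁)).mul_const _).neg
    exact h.indicator (measurableSet_le measurable_fst measurable_snd)
  have hle : ∀ x, a < x → ∀ y, a < y → ‖backwardGreenMul Q m k x y‖ * φ y ≤
      (Ioi x).indicator (fun y => C * expWeight k x * (q y * e y)) y := by
    intro x hx y hy
    by_cases hxy : y ∈ Ioi x
    · have hxy' : x < y := hxy
      rw [indicator_of_mem hxy, backwardGreenMul, backwardGreen_of_lt hxy', norm_mul, norm_neg,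
        hq, indicator_of_mem (show y ∈ Ioi a from hy)]
      have h1 := (hC x y hx.le hxy'.le).1
      calc ‖canonicalBisolution m k x y‖ * ‖Q y‖ * φ y
          ≤ C * Real.exp ((y - x) * k.re) * ‖Q y‖ * φ y := by
            gcongr
            exact (hφpos y).le
        _ = C * (Real.exp ((y - x) * k.re) * expWeight k y) * (‖Q y‖ * e y) := by
            simp only [hφ]
            ring
        _ = _ := by rw [exp_sub_mul_expWeight]
    · rw [indicator_of_notMem hxy, backwardGreenMul, backwardGreen_of_le (not_lt.1 hxy), zero_mul,
        norm_zero, zero_mul]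
  have hdom : ∀ x, IntegrableOn
      ((Ioi x).indicator (fun y => C * expWeight k x * (q y * e y))) (Ioi a) := fun x =>
    (((integrable_mul_exp_integral_Ioi hqi hq0 hl0.le).const_mul _).indicator
      measurableSet_Ioi).integrableOn
  have hint : ∀ x, a < x → IntegrableOn (fun y => ‖backwardGreenMul Q m k x y‖ * φ y) (Ioi a) := by
    intro x hx
    refine Integrable.mono' (hdom x) ((hKx x).norm.mul hφm.aestronglyMeasurable) ?_
    filter_upwards [ae_restrict_mem measurableSet_Ioi] with y hy
    rw [Real.norm_of_nonneg (mul_nonneg (norm_nonneg _) (hφpos y).le)]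
    exact hle x hx y hy
  have hinv : OneAddInvertible a φ (backwardGreenMul Q m k) := by
    refine oneAddInvertible_of_schur hφm (fun x _ => hφpos x) hK (fun x _ => hKx x) hint
      (θ := C / l) (by positivity) (by rw [div_lt_one hl0]; linarith) fun x hx => ?_
    refine (setIntegral_mono_on (hint x hx) (hdom x) measurableSet_Ioi (hle x hx)).trans ?_
    rw [setIntegral_indicator measurableSet_Ioi,
      inter_eq_self_of_subset_right (Ioi_subset_Ioi hx.le), integral_const_mul]
    calc C * expWeight k x * ∫ y in Ioi x, q y * e y
        ≤ C * expWeight k x * (e x / l) := by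
          have := (expWeight_pos k x).le
          gcongr
          exact integral_mul_exp_integral_Ioi_le hqi hq0 hl0 x
      _ = _ := by
          simp only [hφ]
          ring
  have he1 : ∀ x, 1 ≤ e x := fun x =>
    Real.one_le_exp (mul_nonneg hl0.le (integral_nonneg fun y => hq0 y))
  -- The extra factor satisfies `1 ≤ e ≤ exp (l ∫ q)`, so the contraction weight defines the same
  -- space as `expWeight k`.
  refine hinv.of_equivalent_weight hφm (continuous_expWeight k).measurable (fun x _ => hφpos x)
    (fun x _ => expWeight_pos k x) (B := (Real.exp (l * ∫ y, q y)).toNNReal) (D := 1)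
    (fun x _ => ?_) (fun x _ => ?_)
  · rw [Real.coe_toNNReal _ (Real.exp_pos _).le, mul_comm]
    refine mul_le_mul_of_nonneg_left (Real.exp_le_exp.2 ?_) (expWeight_pos k x).le
    exact mul_le_mul_of_nonneg_left (integral_Ioi_le_integral hqi hq0 x) hl0.le
  · rw [NNReal.coe_one, one_mul]
    exact le_mul_of_one_le_right (expWeight_pos k x).le (he1 x)

/-! ### The integral equation -/

/-- `w = (1 + G Q)⁻¹ w⁰` on `]a,∞[`. -/
def SolvesIntegralEq (Q : ℝ → ℂ) (m k : ℂ) (a : ℝ) (w : ℝ → ℂ) : Prop :=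
  MemWeighted a (expWeight k) w ∧
    ∀ x, a < x → w x + kernelOp a (backwardGreenMul Q m k) w x = freeJost m k x

lemma memWeighted_freeJost (m : ℂ) (hk : 0 ≤ k.re) (hk0 : k ≠ 0) {a : ℝ} (ha : 0 < a) :
    MemWeighted a (expWeight k) (freeJost m k) := by
  obtain ⟨C, -, hC⟩ := exists_norm_freeJost_le m hk hk0 ha
  refine (memWeighted_of_ae_bound (continuous_expWeight k).measurable
    (fun x _ => expWeight_pos k x) (aestronglyMeasurable_classical ha
      (isClassical_freeJost m hk hk0)) (M := C) ?_).1
  filter_upwards [ae_restrict_mem measurableSet_Ioi] with x hx using hC x hx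

lemma exists_solvesIntegralEq (hk : 0 ≤ k.re) (hk0 : k ≠ 0) {a : ℝ} (ha : 0 < a)
    (hQ : IntegrableOn Q (Ioi a)) (m : ℂ) : ∃ w, SolvesIntegralEq Q m k a w := by
  obtain ⟨C, hC⟩ := (oneAddInvertible_backwardGreenMul hk hk0 ha hQ m).surjective
  obtain ⟨g, hg, -, heq⟩ := hC _ (memWeighted_freeJost m hk hk0 ha)
  set w : ℝ → ℂ := fun x => freeJost m k x - kernelOp a (backwardGreenMul Q m k) g x with hw
  have hgw : g =ᵐ[volume.restrict (Ioi a)] w := by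
    filter_upwards [heq] with x hx
    simp only [hw]
    rw [← hx]
    ring
  refine ⟨w, ?_, fun x _ => ?_⟩
  · refine (memLp_congr_ae ?_).1 hg.memLp
    filter_upwards [hgw] with x hx
    rw [hx]
  · rw [← kernelOp_congr_ae hgw]
    simp [hw]

/-- The kernel vanishes for `y ≤ x`, so the equation at `x` sees only `]x,∞[` and not the left end
of the half-line. -/
lemma SolvesIntegralEq.mono {a b : ℝ} (hab : a ≤ b) {w : ℝ → ℂ}
    (h : SolvesIntegralEq Q m k a w) : SolvesIntegralEq Q m k b w := by
  refine ⟨h.1.memLp.mono_measure (Measure.restrict_mono (Ioi_subset_Ioi hab) le_rfl),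
    fun x hx => ?_⟩
  rw [kernelOp_backwardGreenMul hx.le,
    ← kernelOp_backwardGreenMul (a := a) (hab.trans hx.le)]
  exact h.2 x (hab.trans_lt hx)

lemma SolvesIntegralEq.congr {a : ℝ} {w v : ℝ → ℂ} (h : SolvesIntegralEq Q m k a w)
    (hvw : ∀ x, a < x → v x = w x) : SolvesIntegralEq Q m k a v := by
  have hae : w =ᵐ[volume.restrict (Ioi a)] v := by
    filter_upwards [ae_restrict_mem measurableSet_Ioi] with x hx
    exact (hvw x hx).symm
  refine ⟨(memLp_congr_ae ?_).1 h.1.memLp, fun x hx => ?_⟩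
  · filter_upwards [hae] with x hx
    rw [hx]
  · rw [hvw x hx, ← kernelOp_congr_ae hae]
    exact h.2 x hx

/-- Injectivity gives equality almost everywhere. The integral operator cannot distinguish the two
functions, so the pointwise equations turn this into equality at every `x`. -/
lemma SolvesIntegralEq.eq {a : ℝ} {w v : ℝ → ℂ} (hk : 0 ≤ k.re) (hk0 : k ≠ 0) (ha : 0 < a)
    (hQ : IntegrableOn Q (Ioi a)) (hw : SolvesIntegralEq Q m k a w)
    (hv : SolvesIntegralEq Q m k a v) {x : ℝ} (hx : a < x) : w x = v x := by
  have hae := (oneAddInvertible_backwardGreenMul hk hk0 ha hQ m).injective w v hw.1 hv.1 (by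
    filter_upwards [ae_restrict_mem measurableSet_Ioi] with y hy
    rw [hw.2 y hy, hv.2 y hy])
  have h1 := hw.2 x hx
  rw [← hv.2 x hx, kernelOp_congr_ae hae] at h1
  exact add_right_cancel h1

/-- The solutions of the integral equation on the half-lines `]a,∞[` fit together. -/
lemma exists_global_solution (hk : 0 ≤ k.re) (hk0 : k ≠ 0)
    (hQ : ∀ a, 0 < a → IntegrableOn Q (Ioi a)) (m : ℂ) :
    ∃ w, ∀ a, 0 < a → SolvesIntegralEq Q m k a w := by
  choose! W hW using fun a (ha : 0 < a) => exists_solvesIntegralEq hk hk0 ha (hQ a ha) m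
  -- Each `x` is evaluated in the solution on `]x/2,∞[`; it is compared with the solution on `]a,∞[`
  -- over the common half-line.
  refine ⟨fun x => W (x / 2) x, fun a ha => (hW a ha).congr fun x hx => ?_⟩
  have hx0 : 0 < x := ha.trans hx
  have hb : max a (x / 2) < x := max_lt hx (by linarith)
  have hb0 : 0 < max a (x / 2) := lt_max_of_lt_left ha
  exact SolvesIntegralEq.eq hk hk0 hb0 (hQ _ hb0)
    ((hW (x / 2) (by linarith)).mono (le_max_right _ _)) ((hW a ha).mono (le_max_left _ _)) hb

end Perturbed

section Perturbed

variable {Q : ℝ → ℂ} {m k : ℂ}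

/-! ### From the integral equation to the differential equation -/

lemma IsClassical.exists_norm_le {h : ℝ → ℂ} (hh : IsClassical m k h) (hk : 0 ≤ k.re)
    (hk0 : k ≠ 0) {a : ℝ} (ha : 0 < a) : ∃ C : ℝ, 0 ≤ C ∧ ∀ y, a ≤ y →
      ‖h y‖ * expWeight k y ≤ C ∧ ‖deriv h y‖ * expWeight k y ≤ C := by
  obtain ⟨C, hC0, hC⟩ := exists_growth_bound m hk hk0 ha
  have hw := (expWeight_pos k a).le
  refine ⟨C * expWeight k a * (‖h a‖ + ‖deriv h a‖), by positivity, fun y hy => ?_⟩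
  have key : ∀ r : ℝ, r ≤ C * Real.exp ((y - a) * k.re) * (‖h a‖ + ‖deriv h a‖) →
      r * expWeight k y ≤ C * expWeight k a * (‖h a‖ + ‖deriv h a‖) := by
    intro r hr
    calc r * expWeight k y
        ≤ C * Real.exp ((y - a) * k.re) * (‖h a‖ + ‖deriv h a‖) * expWeight k y :=
          mul_le_mul_of_nonneg_right hr (expWeight_pos k y).le
      _ = C * (Real.exp ((y - a) * k.re) * expWeight k y) * (‖h a‖ + ‖deriv h a‖) := by ring
      _ = _ := by rw [exp_sub_mul_expWeight]
  exact ⟨key _ (hC h hh a y le_rfl hy).1, key _ (hC h hh a y le_rfl hy).2⟩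

/-- The growth of `h` cancels the decay of `u`, leaving a multiple of `‖Q‖`. -/
lemma integrableOn_classical_mul {h u : ℝ → ℂ} (hh : IsClassical m k h) (hk : 0 ≤ k.re)
    (hk0 : k ≠ 0) {a : ℝ} (ha : 0 < a) (hQ : IntegrableOn Q (Ioi a))
    (hu : MemWeighted a (expWeight k) u) :
    IntegrableOn (fun y => h y * (Q y * u y)) (Ioi a) := by
  obtain ⟨C, hC0, hC⟩ := hh.exists_norm_le hk hk0 ha
  refine Integrable.mono' (hQ.norm.const_mul ((weightedNorm a (expWeight k) u).toReal * C))
    ((aestronglyMeasurable_classical ha hh).mul (hQ.1.mul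
      (hu.aestronglyMeasurable (continuous_expWeight k).measurable
        fun x _ => expWeight_pos k x))) ?_
  filter_upwards [hu.ae_norm_le fun x _ => expWeight_pos k x, ae_restrict_mem measurableSet_Ioi]
    with y hy hya
  rw [norm_mul, norm_mul]
  calc ‖h y‖ * (‖Q y‖ * ‖u y‖)
      ≤ ‖h y‖ * (‖Q y‖ * ((weightedNorm a (expWeight k) u).toReal * expWeight k y)) := by gcongr
    _ = (weightedNorm a (expWeight k) u).toReal * (‖h y‖ * expWeight k y) * ‖Q y‖ := by ring
    _ ≤ _ := by
      gcongr
      exact (hC y (le_of_lt hya)).1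

lemma integral_bisolution_eq {h₁ h₂ u : ℝ → ℂ} (c₁ : IsClassical m k h₁) (c₂ : IsClassical m k h₂)
    (hk : 0 ≤ k.re) (hk0 : k ≠ 0) {x : ℝ} (hx : 0 < x) (hQ : IntegrableOn Q (Ioi x))
    (hu : MemWeighted x (expWeight k) u) (α β W : ℂ) :
    ∫ y in Ioi x, (α * h₂ y - β * h₁ y) / W * (Q y * u y) =
      α / W * (∫ y in Ioi x, h₂ y * (Q y * u y)) - β / W * ∫ y in Ioi x, h₁ y * (Q y * u y) := by
  have i₁ := integrableOn_classical_mul c₁ hk hk0 hx hQ hu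
  have i₂ := integrableOn_classical_mul c₂ hk hk0 hx hQ hu
  rw [← integral_const_mul, ← integral_const_mul, ← integral_sub (i₂.const_mul _) (i₁.const_mul _)]
  refine integral_congr_ae (Eventually.of_forall fun y => ?_)
  simp only
  ring

lemma norm_integral_Ioi_kernel_le {G : ℝ → ℂ} {u : ℝ → ℂ} {a x C : ℝ} (hC : 0 ≤ C) (hax : a ≤ x)
    (hG : ∀ y, x ≤ y → ‖G y‖ ≤ C * Real.exp ((y - x) * k.re))
    (hQ : IntegrableOn Q (Ioi a)) (hu : MemWeighted a (expWeight k) u) :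
    ‖∫ y in Ioi x, G y * (Q y * u y)‖ ≤
      C * (weightedNorm a (expWeight k) u).toReal * expWeight k x * ∫ y in Ioi x, ‖Q y‖ := by
  have hQx := hQ.mono_set (Ioi_subset_Ioi hax)
  rw [← integral_const_mul]
  refine norm_integral_le_of_norm_le (hQx.norm.const_mul _) ?_
  filter_upwards [ae_restrict_of_ae_restrict_of_subset (Ioi_subset_Ioi hax)
    (hu.ae_norm_le fun x _ => expWeight_pos k x), ae_restrict_mem measurableSet_Ioi]
    with y hy hya
  rw [norm_mul, norm_mul]
  calc ‖G y‖ * (‖Q y‖ * ‖u y‖)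
      ≤ (C * Real.exp ((y - x) * k.re)) *
        (‖Q y‖ * ((weightedNorm a (expWeight k) u).toReal * expWeight k y)) := by
        gcongr
        exact hG y (le_of_lt hya)
    _ = C * (weightedNorm a (expWeight k) u).toReal *
        (Real.exp ((y - x) * k.re) * expWeight k y) * ‖Q y‖ := by ring
    _ = _ := by rw [exp_sub_mul_expWeight]

lemma isLittleO_of_le_integral_Ioi {f : ℝ → ℂ} {a D : ℝ} (hD : 0 ≤ D)
    (hQ : IntegrableOn Q (Ioi a))
    (h : ∀ x, a < x → ‖f x‖ ≤ D * expWeight k x * ∫ y in Ioi x, ‖Q y‖) :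
    f =o[atTop] expWeight k := by
  rw [isLittleO_iff]
  intro c hc
  have ht := tendsto_integral_Ioi_atTop hQ.norm
  have hev := ht.eventually_lt_const (show 0 < c / (D + 1) by positivity)
  filter_upwards [hev, eventually_gt_atTop a] with x hx hxa
  rw [Real.norm_of_nonneg (expWeight_pos k x).le]
  refine (h x hxa).trans ?_
  have hI : D * ∫ y in Ioi x, ‖Q y‖ ≤ c := by
    calc D * ∫ y in Ioi x, ‖Q y‖ ≤ D * (c / (D + 1)) := by gcongr
      _ ≤ (D + 1) * (c / (D + 1)) := by gcongr; linarith
      _ = c := by field_simp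
  nlinarith [expWeight_pos k x]

/-- Exhaustion of `]0,∞[` by the countably many intervals `[1/(n+1), n+1]`. -/
lemma ae_Ioi_zero_of_Icc {p : ℝ → Prop}
    (h : ∀ a b : ℝ, 0 < a → a ≤ b → ∀ᵐ x, x ∈ Icc a b → p x) :
    ∀ᵐ x ∂(volume.restrict (Ioi (0 : ℝ))), p x := by
  rw [ae_restrict_iff' measurableSet_Ioi]
  have hall : ∀ᵐ x : ℝ, ∀ n : ℕ, x ∈ Icc (1 / ((n : ℝ) + 1)) ((n : ℝ) + 1) → p x := by
    rw [ae_all_iff]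
    intro n
    have h0 : (0 : ℝ) ≤ n := Nat.cast_nonneg n
    refine h _ _ (by positivity) ?_
    rw [div_le_iff₀ (by positivity)]
    nlinarith
  filter_upwards [hall] with x hx hx0
  have hx0 : 0 < x := hx0
  obtain ⟨n, hn⟩ := exists_nat_ge (max x (1 / x))
  refine hx n ⟨?_, ?_⟩
  · rw [div_le_iff₀ (by positivity)]
    have h1 := (le_max_right x (1 / x)).trans hn
    rw [div_le_iff₀ hx0] at h1
    nlinarith
  · linarith [(le_max_left x (1 / x)).trans hn]

/-- A solution of the integral equation is a Jost solution. -/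
theorem isJostSolution_of_solvesIntegralEq (hk : 0 ≤ k.re) (hk0 : k ≠ 0)
    (hQ : ∀ a, 0 < a → IntegrableOn Q (Ioi a)) {w : ℝ → ℂ}
    (hw : ∀ a, 0 < a → SolvesIntegralEq Q m k a w) : IsJostSolution Q m k w := by
  set W := wronskian (fundamentalPair m k).1 (fundamentalPair m k).2 1 with hW
  have hW0 : W ≠ 0 := wronskian_fundamentalPair_ne_zero m k
  have hWx : ∀ x : ℝ, 0 < x → _ := fun x hx => wronskian_fundamentalPair m k (x := x) hx
  have c₀ := isClassical_freeJost m hk hk0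
  have c₁ := isClassical_fundamentalPair_fst m k
  have c₂ := isClassical_fundamentalPair_snd m k
  have hker : ∀ x y, canonicalBisolution m k x y = ((fundamentalPair m k).1 x *
    (fundamentalPair m k).2 y - (fundamentalPair m k).2 x * (fundamentalPair m k).1 y) / W :=
    fun _ _ => rfl
  have hkerD : ∀ x y, canonicalBisolutionDeriv m k x y = (deriv (fundamentalPair m k).1 x *
    (fundamentalPair m k).2 y - deriv (fundamentalPair m k).2 x * (fundamentalPair m k).1 y) / W :=
    fun _ _ => rfl
  rw [← hW] at hWx
  set h₁ := (fundamentalPair m k).1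
  set h₂ := (fundamentalPair m k).2
  set w₀ := freeJost m k
  set f₁ : ℝ → ℂ := fun y => h₁ y * (Q y * w y) with hf₁
  set f₂ : ℝ → ℂ := fun y => h₂ y * (Q y * w y) with hf₂
  have i₁ : ∀ a, 0 < a → IntegrableOn f₁ (Ioi a) := fun a ha =>
    integrableOn_classical_mul c₁ hk hk0 ha (hQ a ha) (hw a ha).1
  have i₂ : ∀ a, 0 < a → IntegrableOn f₂ (Ioi a) := fun a ha =>
    integrableOn_classical_mul c₂ hk hk0 ha (hQ a ha) (hw a ha).1
  -- Because the kernel is a sum of products, the integral operator is expressed through two tail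
  -- integrals, which are absolutely continuous in `x`.
  set A : ℝ → ℂ := fun x => ∫ y in Ioi x, f₂ y with hA
  set B : ℝ → ℂ := fun x => ∫ y in Ioi x, f₁ y with hB
  have hweq : ∀ x, 0 < x → w x = w₀ x + (h₁ x / W * A x - h₂ x / W * B x) := by
    intro x hx
    have h1 := (hw (x / 2) (by linarith)).2 x (by linarith)
    rw [kernelOp_backwardGreenMul (by linarith)] at h1
    simp only [hker] at h1
    rw [integral_bisolution_eq c₁ c₂ hk hk0 hx (hQ x hx) (hw x hx).1] at h1
    linear_combination h1
  -- Candidate for the derivative of `w`: the terms from differentiating `A` and `B` cancel, since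
  -- `h₁ h₂ - h₂ h₁ = 0`.
  set p : ℝ → ℂ := fun x => deriv w₀ x + (deriv h₁ x / W * A x - deriv h₂ x / W * B x) with hp
  have acA : ∀ a b, 0 < a → a ≤ b → AbsolutelyContinuousOnInterval A a b := fun a b ha hab =>
    absolutelyContinuous_integral_Ioi (i₂ (a / 2) (by linarith)) (by linarith) hab
  have acB : ∀ a b, 0 < a → a ≤ b → AbsolutelyContinuousOnInterval B a b := fun a b ha hab =>
    absolutelyContinuous_integral_Ioi (i₁ (a / 2) (by linarith)) (by linarith) hab
  have dA : ∀ a b, 0 < a → a ≤ b → ∀ᵐ x, x ∈ Icc a b → HasDerivAt A (-f₂ x) x :=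
    fun a b ha hab => ae_hasDerivAt_integral_Ioi (i₂ (a / 2) (by linarith)) (by linarith) hab
  have dB : ∀ a b, 0 < a → a ≤ b → ∀ᵐ x, x ∈ Icc a b → HasDerivAt B (-f₁ x) x :=
    fun a b ha hab => ae_hasDerivAt_integral_Ioi (i₁ (a / 2) (by linarith)) (by linarith) hab
  have acMul : ∀ {u v : ℝ → ℂ} {a b : ℝ}, AbsolutelyContinuousOnInterval u a b →
      AbsolutelyContinuousOnInterval v a b →
      AbsolutelyContinuousOnInterval (fun x => u x / W * v x) a b := by
    intro u v a b hu hv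
    refine (hu.fun_smul (hv.const_smul W⁻¹)).congr fun x _ => ?_
    simp only [smul_eq_mul]
    ring
  have acw : ∀ a b, 0 < a → a ≤ b → AbsolutelyContinuousOnInterval w a b := by
    intro a b ha hab
    refine ((c₀.absolutelyContinuous ha hab).fun_add
      ((acMul (c₁.absolutelyContinuous ha hab) (acA a b ha hab)).fun_sub
        (acMul (c₂.absolutelyContinuous ha hab) (acB a b ha hab)))).congr fun x hx => ?_
    rw [uIcc_of_le hab] at hx
    exact (hweq x (ha.trans_le hx.1)).symm
  have acp : ∀ a b, 0 < a → a ≤ b → AbsolutelyContinuousOnInterval p a b := fun a b ha hab =>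
    (c₀.absolutelyContinuous_deriv ha hab).fun_add
      ((acMul (c₁.absolutelyContinuous_deriv ha hab) (acA a b ha hab)).fun_sub
        (acMul (c₂.absolutelyContinuous_deriv ha hab) (acB a b ha hab)))
  have hpc : ContinuousOn p (Ioi 0) := by
    intro x hx
    have hx : 0 < x := hx
    have h := (acp (x / 2) (x + 1) (by linarith) (by linarith)).continuousOn
    rw [uIcc_of_le (by linarith)] at h
    exact (h.continuousAt (Icc_mem_nhds (by linarith) (by linarith))).continuousWithinAt
  have dw : ∀ a b, 0 < a → a ≤ b → ∀ᵐ x, x ∈ Icc a b → HasDerivAt w (p x) x := by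
    intro a b ha hab
    filter_upwards [dA a b ha hab, dB a b ha hab] with x hxA hxB hx
    have hx0 : 0 < x := ha.trans_le hx.1
    have h := (c₀ x hx0).1.fun_add ((((c₁ x hx0).1.div_const W).fun_mul (hxA hx)).fun_sub
      (((c₂ x hx0).1.div_const W).fun_mul (hxB hx)))
    refine (h.congr_deriv ?_).congr_of_eventuallyEq ?_
    · simp only [hp, hf₁, hf₂]
      ring
    · filter_upwards [Ioi_mem_nhds hx0] with y hy using hweq y hy
  -- So far `p` is the derivative only almost everywhere; as `w` is absolutely continuous and `p`
  -- continuous, `w` is a primitive of `p` and the relation holds at every point.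
  have hder : ∀ x, 0 < x → HasDerivAt w (p x) x := by
    intro x hx
    have hx2 : 0 < x / 2 := by linarith
    have hpi : ∀ y, x / 2 ≤ y → IntervalIntegrable p volume (x / 2) y := fun y hy => by
      refine ContinuousOn.intervalIntegrable ?_
      rw [uIcc_of_le hy]
      exact hpc.mono (Icc_subset_Ioi_zero hx2)
    have hI : HasDerivAt (fun y => ∫ t in (x / 2)..y, p t) (p x) x :=
      intervalIntegral.integral_hasDerivAt_right (hpi x (by linarith))
        (hpc.stronglyMeasurableAtFilter isOpen_Ioi x hx) (hpc.continuousAt (Ioi_mem_nhds hx))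
    refine (hI.const_add (w (x / 2))).congr_of_eventuallyEq ?_
    filter_upwards [Ici_mem_nhds (show x / 2 < x by linarith)] with y hy
    have := sub_eq_integral_of_absolutelyContinuous hy (acw _ _ hx2 hy) (hpi y hy)
      (dw _ _ hx2 hy)
    rw [← this]
    ring
  have hderiv : ∀ x, 0 < x → deriv w x = p x := fun x hx => (hder x hx).deriv
  have hAC1 : IsAC1 w := by
    refine ⟨fun x hx => (hder x hx).differentiableAt.differentiableWithinAt, fun a b ha hab => ?_⟩
    refine (acp a b ha hab).congr fun x hx => ?_
    rw [uIcc_of_le hab] at hx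
    exact (hderiv x (ha.trans_le hx.1)).symm
  obtain ⟨C, hC0, hC⟩ := exists_bisolution_bound m hk hk0 one_pos
  refine ⟨isSolution_iff.2 ⟨hAC1, ae_Ioi_zero_of_Icc fun a b ha hab => ?_⟩, ?_, ?_⟩
  · filter_upwards [dA a b ha hab, dB a b ha hab] with x hxA hxB hx
    have hx0 : 0 < x := ha.trans_le hx.1
    have h := (c₀ x hx0).2.fun_add ((((c₁ x hx0).2.div_const W).fun_mul (hxA hx)).fun_sub
      (((c₂ x hx0).2.div_const W).fun_mul (hxB hx)))
    have hev : deriv w =ᶠ[𝓝 x] p := by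
      filter_upwards [Ioi_mem_nhds hx0] with y hy using hderiv y hy
    have hdd : deriv p x = _ := h.deriv
    rw [hev.deriv_eq, hdd]
    -- In the second differentiation the terms from `A` and `B` no longer cancel: they combine to `Q
    -- w` times the normalised Wronskian.
    have hwr : (h₁ x * deriv h₂ x - deriv h₁ x * h₂ x) / W = 1 := by
      rw [hWx x hx0, div_self hW0]
    simp only [hf₁, hf₂]
    linear_combination (-besselCoeff m k x) * hweq x hx0 + (Q x * w x) * hwr
  · refine isLittleO_of_le_integral_Ioi (a := 1)
      (D := C * (weightedNorm 1 (expWeight k) w).toReal) (by positivity) (hQ 1 one_pos)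
      fun x hx => ?_
    have h1 := (hw 1 one_pos).2 x hx
    rw [kernelOp_backwardGreenMul hx.le] at h1
    rw [show w x - w₀ x = ∫ y in Ioi x, canonicalBisolution m k x y * (Q y * w y) by
      linear_combination h1]
    exact norm_integral_Ioi_kernel_le hC0 hx.le (fun y hy => (hC x y hx.le hy).1) (hQ 1 one_pos)
      (hw 1 one_pos).1
  · refine isLittleO_of_le_integral_Ioi (a := 1)
      (D := C * (weightedNorm 1 (expWeight k) w).toReal) (by positivity) (hQ 1 one_pos)
      fun x hx => ?_
    have hx0 : 0 < x := one_pos.trans hx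
    have h1 : deriv w x - deriv w₀ x =
        ∫ y in Ioi x, canonicalBisolutionDeriv m k x y * (Q y * w y) := by
      simp only [hkerD]
      rw [integral_bisolution_eq c₁ c₂ hk hk0 hx0 (hQ x hx0) (hw x hx0).1, hderiv x hx0]
      simp only [hp, hA, hB, hf₁, hf₂]
      ring
    rw [h1]
    exact norm_integral_Ioi_kernel_le hC0 hx.le (fun y hy => (hC x y hx.le hy).2) (hQ 1 one_pos)
      (hw 1 one_pos).1

/-! ### Uniqueness -/

lemma IsClassical.intervalIntegrable_mul {h v : ℝ → ℂ} (hh : IsClassical m k h)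
    (hv : ContinuousOn v (Ioi 0)) {a b : ℝ} (ha : 0 < a) (hab : a ≤ b)
    (hQ : IntegrableOn Q (Icc a b)) :
    IntervalIntegrable (fun y => h y * (Q y * v y)) volume a b := by
  refine IntegrableOn.intervalIntegrable ?_
  rw [uIcc_of_le hab]
  have h1 := hQ.continuousOn_mul ((hh.continuousOn.fun_mul hv).mono
    (Icc_subset_Ioi_zero ha)) isCompact_Icc
  refine h1.congr_fun (fun y _ => ?_) measurableSet_Icc
  simp only
  ring

/-- Lagrange's identity: the coefficients of the two equations differ by `Q`, so `f h'' - f'' h = -h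
Q f` almost everywhere. -/
lemma IsSolution.wronskian_sub {f h : ℝ → ℂ} (hf : IsSolution Q m k f) (hh : IsClassical m k h)
    {a b : ℝ} (ha : 0 < a) (hab : a ≤ b) (hQ : IntegrableOn Q (Icc a b)) :
    wronskian f h b - wronskian f h a = -∫ y in a..b, h y * (Q y * f y) := by
  have hAC := hf.1
  have hint := hh.intervalIntegrable_mul hAC.continuousOn ha hab hQ
  rw [← intervalIntegral.integral_neg]
  refine sub_eq_integral_of_absolutelyContinuous hab ?_ hint.neg ?_
  · exact ((hAC.absolutelyContinuous ha hab).fun_smul (hh.absolutelyContinuous_deriv ha hab)).fun_sub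
      ((hAC.2 a b ha hab).fun_smul (hh.absolutelyContinuous ha hab))
  · filter_upwards [hf.ae_hasDerivAt_deriv ha hab] with x hx hxab
    have hx0 : 0 < x := ha.trans_le hxab.1
    have h1 := ((hAC.hasDerivAt hx0).fun_mul (hh x hx0).2).fun_sub
      ((hx hxab).fun_mul (hh x hx0).1)
    exact h1.congr_deriv (by ring)

lemma memWeighted_of_isLittleO {u : ℝ → ℂ} (hu : ContinuousOn u (Ioi 0))
    (ho : u =o[atTop] expWeight k) {a : ℝ} (ha : 0 < a) : MemWeighted a (expWeight k) u := by
  have hev := (isLittleO_iff.1 ho) one_pos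
  obtain ⟨R, hR⟩ := eventually_atTop.1 hev
  have hc : ContinuousOn (fun x => ‖u x‖ / expWeight k x) (Icc a R) :=
    (hu.norm.div (continuous_expWeight k).continuousOn fun x _ => (expWeight_pos k x).ne').mono
      (Icc_subset_Ioi_zero ha)
  obtain ⟨M, hM⟩ := isCompact_Icc.exists_bound_of_continuousOn hc
  refine (memWeighted_of_ae_bound (continuous_expWeight k).measurable
    (fun x _ => expWeight_pos k x) ((hu.mono (Ioi_subset_Ioi ha.le)).aestronglyMeasurable
      measurableSet_Ioi) (M := max M 1) ?_).1
  filter_upwards [ae_restrict_mem measurableSet_Ioi] with x hx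
  have hpos := expWeight_pos k x
  rcases le_total x R with h | h
  · have h1 := hM x ⟨le_of_lt hx, h⟩
    rw [Real.norm_of_nonneg (by positivity), div_le_iff₀ hpos] at h1
    exact h1.trans (mul_le_mul_of_nonneg_right (le_max_left _ _) hpos.le)
  · have h1 := hR x h
    rw [Real.norm_of_nonneg hpos.le] at h1
    exact h1.trans (mul_le_mul_of_nonneg_right (le_max_right _ _) hpos.le)

lemma tendsto_mul_zero_of_isLittleO {u v : ℝ → ℂ} (hu : u =o[atTop] expWeight k) {C a : ℝ}
    (hv : ∀ y, a ≤ y → ‖v y‖ * expWeight k y ≤ C) :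
    Tendsto (fun x => u x * v x) atTop (𝓝 0) := by
  have hO : v =O[atTop] fun x => (expWeight k x)⁻¹ := by
    refine IsBigO.of_bound C ?_
    filter_upwards [eventually_ge_atTop a] with x hx
    have hpos := expWeight_pos k x
    rw [Real.norm_of_nonneg (inv_nonneg.2 hpos.le), ← div_eq_mul_inv, le_div_iff₀ hpos]
    exact hv x hx
  have h := hu.mul_isBigO hO
  simp only [mul_inv_cancel₀ (expWeight_pos k _).ne'] at h
  exact (isLittleO_one_iff ℝ).1 h

/-- The difference of two Jost solutions solves the homogeneous integral equation. -/
lemma IsJostSolution.wronskian_sub_eq {f g h : ℝ → ℂ} (hk : 0 ≤ k.re) (hk0 : k ≠ 0)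
    (hQ : ∀ a, 0 < a → IntegrableOn Q (Ioi a)) (hf : IsJostSolution Q m k f)
    (hg : IsJostSolution Q m k g) (hh : IsClassical m k h)
    {x : ℝ} (hx : 0 < x) (hu : MemWeighted x (expWeight k) fun y => f y - g y) :
    wronskian f h x - wronskian g h x = ∫ y in Ioi x, h y * (Q y * (f y - g y)) := by
  have ho : (fun y => f y - g y) =o[atTop] expWeight k := by
    refine (hf.sub_isLittleO.sub hg.sub_isLittleO).congr_left fun y => ?_
    ring
  have ho' : (fun y => deriv f y - deriv g y) =o[atTop] expWeight k := by
    refine (hf.deriv_sub_isLittleO.sub hg.deriv_sub_isLittleO).congr_left fun y => ?_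
    ring
  obtain ⟨C, -, hC⟩ := hh.exists_norm_le hk hk0 hx
  -- The boundary term at infinity vanishes: `h` and `h'` are `O(exp (x Re k))`, while `f - g` and
  -- its derivative are `o(exp (-x Re k))`. Both asymptotic conditions on a Jost solution are used.
  have hlim : Tendsto (fun R => wronskian f h R - wronskian g h R) atTop (𝓝 0) := by
    have h1 := (tendsto_mul_zero_of_isLittleO ho fun y hy => (hC y hy).2).sub
      (tendsto_mul_zero_of_isLittleO ho' fun y hy => (hC y hy).1)
    rw [sub_zero] at h1
    refine h1.congr fun R => ?_
    rw [wronskian, wronskian]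
    ring
  have hint := integrableOn_classical_mul hh hk hk0 hx (hQ x hx) hu
  have hlim2 := (intervalIntegral_tendsto_integral_Ioi x hint tendsto_id).const_sub
    (wronskian f h x - wronskian g h x)
  refine sub_eq_zero.1 (tendsto_nhds_unique (hlim2.congr' ?_) hlim)
  filter_upwards [eventually_ge_atTop x] with R hR
  have hQR : IntegrableOn Q (Icc x R) :=
    (hQ (x / 2) (by linarith)).mono_set fun y hy =>
      lt_of_lt_of_le (show x / 2 < x by linarith) hy.1
  have e1 := hf.isSolution.wronskian_sub hh hx hR hQR
  have e2 := hg.isSolution.wronskian_sub hh hx hR hQR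
  have e3 : ∫ y in x..R, h y * (Q y * (f y - g y)) =
      (∫ y in x..R, h y * (Q y * f y)) - ∫ y in x..R, h y * (Q y * g y) := by
    rw [← intervalIntegral.integral_sub
      (hh.intervalIntegrable_mul hf.isSolution.1.continuousOn hx hR hQR)
      (hh.intervalIntegrable_mul hg.isSolution.1.continuousOn hx hR hQR)]
    refine intervalIntegral.integral_congr fun y _ => ?_
    ring
  rw [id, e3]
  linear_combination e2 - e1

/-- For `u = f - g` one has `h₁ 𝒲(u, h₂) - h₂ 𝒲(u, h₁) = u 𝒲(h₁, h₂)`. Inserting the integral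
formulas for the two Wronskians gives `(1 + G Q) u = 0`, and injectivity of `1 + G Q` yields `u =
0`. -/
theorem IsJostSolution.eqOn {f g : ℝ → ℂ} (hk : 0 ≤ k.re) (hk0 : k ≠ 0)
    (hQ : ∀ a, 0 < a → IntegrableOn Q (Ioi a)) (hf : IsJostSolution Q m k f)
    (hg : IsJostSolution Q m k g) : EqOn f g (Ioi 0) := by
  set u : ℝ → ℂ := fun y => f y - g y with hu
  have ho : u =o[atTop] expWeight k := by
    refine (hf.sub_isLittleO.sub hg.sub_isLittleO).congr_left fun y => ?_
    simp only [hu]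
    ring
  have hmem : ∀ a, 0 < a → MemWeighted a (expWeight k) u := fun a ha =>
    memWeighted_of_isLittleO
      (hf.isSolution.1.continuousOn.sub hg.isSolution.1.continuousOn) ho ha
  have c₁ := isClassical_fundamentalPair_fst m k
  have c₂ := isClassical_fundamentalPair_snd m k
  have heq : ∀ a, 0 < a → ∀ x, a < x → u x + kernelOp a (backwardGreenMul Q m k) u x = 0 := by
    intro a ha x hax
    have hx : 0 < x := ha.trans hax
    have hW0 := wronskian_fundamentalPair_ne_zero m k
    have hWx := wronskian_fundamentalPair m k hx
    have e₁ := hf.wronskian_sub_eq hk hk0 hQ hg c₁ hx (hmem x hx)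
    have e₂ := hf.wronskian_sub_eq hk hk0 hQ hg c₂ hx (hmem x hx)
    rw [kernelOp_backwardGreenMul hax.le]
    unfold canonicalBisolution
    rw [integral_bisolution_eq c₁ c₂ hk hk0 hx (hQ x hx) (hmem x hx), ← e₁, ← e₂, ← hWx]
    rw [← hWx] at hW0
    simp only [wronskian, hu]
    field_simp
    ring
  intro x hx
  have hx : 0 < x := hx
  have hx2 : 0 < x / 2 := by linarith
  have hz : kernelOp (x / 2) (backwardGreenMul Q m k) (fun _ => 0) = fun _ => 0 := by
    funext y
    simp [kernelOp]
  have hae := (oneAddInvertible_backwardGreenMul hk hk0 hx2 (hQ _ hx2) m).injective u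
    (fun _ => 0) (hmem _ hx2) (by simp [MemWeighted]) (by
      filter_upwards [ae_restrict_mem measurableSet_Ioi] with y hy
      rw [heq _ hx2 y hy, hz, add_zero])
  have h1 := heq _ hx2 x (by linarith)
  rw [kernelOp_congr_ae hae, hz, add_zero] at h1
  exact sub_eq_zero.1 h1

end Perturbed

/-! ### Symmetry in `m` and the main theorem. -/

lemma isJostSolution_neg {Q : ℝ → ℂ} {m k : ℂ} {w : ℝ → ℂ} (h : IsJostSolution Q (-m) k w) :
    IsJostSolution Q m k w := by
  obtain ⟨h1, h2, h3⟩ := h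
  rw [freeJost_neg] at h2 h3
  refine ⟨⟨h1.1, ?_⟩, h2, h3⟩
  have := h1.2
  simpa only [besselOp, neg_sq] using this

end PerturbedBessel

end

theorem mainTheorem4 (Q : ℝ → ℂ)
    (hloc : LocallyIntegrableOn Q (Ioi (0 : ℝ)) volume)
    (hQ : IntegrableOn Q (Ioi (1 : ℝ)) volume)
    (k : ℂ) (hk : 0 ≤ k.re) (hk0 : k ≠ 0) :
    ∃ w : ℂ → ℝ → ℂ,
      (∀ m : ℂ,
        PerturbedBessel.IsJostSolution Q m k (w m) ∧
        (∀ g : ℝ → ℂ, PerturbedBessel.IsJostSolution Q m k g → EqOn g (w m) (Ioi 0)) ∧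
        (∀ a : ℝ, 0 < a →
          PerturbedBessel.IsInverseImage a (PerturbedBessel.expWeight k)
            (PerturbedBessel.backwardGreenMul Q m k)
            (PerturbedBessel.freeJost m k) (w m))) ∧
      ∀ m : ℂ, EqOn (w m) (w (-m)) (Ioi 0) := by
  have hQa : ∀ a, 0 < a → IntegrableOn Q (Ioi a) := fun a ha =>
    PerturbedBessel.integrableOn_Ioi_of_pos hloc hQ ha
  choose w hw using fun m => PerturbedBessel.exists_global_solution hk hk0 hQa m
  have hJ : ∀ m, PerturbedBessel.IsJostSolution Q m k (w m) := fun m =>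
    PerturbedBessel.isJostSolution_of_solvesIntegralEq hk hk0 hQa (hw m)
  refine ⟨w, fun m => ⟨hJ m, fun g hg => hg.eqOn hk hk0 hQa (hJ m), fun a ha => ?_⟩, fun m => ?_⟩
  · exact ⟨PerturbedBessel.oneAddInvertible_backwardGreenMul hk hk0 ha (hQa a ha) m,
      PerturbedBessel.memWeighted_freeJost m hk hk0 ha, (hw m a ha).1, (hw m a ha).2⟩
  · exact (hJ m).eqOn hk hk0 hQa (PerturbedBessel.isJostSolution_neg (hJ (-m)))
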